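/- Let $\mathbb{D}$ be the open unit disc and $dA=\pi^{-1}\,dx\,dy$. Let $\widehat{\mathcal D}$ be the class of radial weights $\omega$ on $\mathbb{D}$ (nonnegative, integrable, $\omega(z)=\omega(|z|)$) for which there is a constant $C$ such that $\widehat\omega(r):=\int_r^1\omega(s)\,ds\le C\,\widehat\omega\big(\tfrac{1+r}{2}\big)$ for all $0\le r<1$, both sides being finite. For $\omega\in\widehat{\mathcal D}$ write $\omega(\mathbb{D})=\int_{\mathbb D}\omega\,dA$, and let $D_\omega$ be the space of analytic functions $f$ in $\mathbb{D}$ with $\int_{\mathbb D}|f'|^2\omega\,dA<\infty$, with the inner product $$\langle f,g\rangle_{D_\omega}=f(0)\overline{g(0)}\,\omega(\mathbb{D})+\int_{\mathbb D}f'(z)\overline{g'(z)}\,\omega(z)\,dA(z).$$ **Theorem.** Let $0<p<\infty$, let $\omega\in\widehat{\mathcal D}$ be not almost everywhere zero, and let $N\in\mathbb{N}\cup\{0\}$. Then for every $a\in\mathbb{D}$ the space $D_\omega$ has a reproducing kernel $K^\omega_a\in D_\omega$, that is, $f(a)=\langle f,K^\omega_a\rangle_{D_\omega}$ for all $f\in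 D_\omega$, and the following assertions hold. (i) The integral means $M_p^p(r,f)=\frac1{2\pi}\int_0^{2\pi}|f(re^{i\theta})|^p\,d\theta$ satisfy $$M_p^p\big(r,(K^\omega_a)^{(N)}\big)\asymp\int_0^{|a|r}\frac{dt}{\widehat\omega(t)^p(1-t)^{p(N-1)}},\qquad r,|a|\to1^-.$$ (ii) If $v\in\widehat{\mathcal D}$, then $(K^\omega_a)^{(N)}$ belongs to $A^p_v$ for every $a\in\mathbb{D}$, that is, it is analytic in $\mathbb{D}$ with $\|(K^\omega_a)^{(N)}\|^p_{A^p_v}=\int_{\mathbb D}|(K^\omega_a)^{(N)}|^p\,v\,dA<\infty$, and $$\big\|(K^\omega_a)^{(N)}\big\|^p_{A^p_v}\asymp\int_0^{|a|}\frac{\widehat v(t)}{\widehat\omega(t)^p(1-t)^{p(N-1)}}\,dt,\qquad |a|\to1^-.$$ Here $F\asymp G$ means that there are constants $c,C>0$, independent of $r$ and $a$ (they may depend on $p,\omega,N$ and, in (ii), on $v$), such that $cG\le F\le CG$ for all $r$ and $|a|$ (in (ii), all $|a|$) in $[\rho,1)$, for some $\rho<1$. -/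

import Mathlib

open scoped Topology ComplexConjugate
open Filter Set MeasureTheory Asymptotics

namespace RadialDirichlet

noncomputable section

/-- The open unit disc `𝔻` of the complex plane. -/
def disc : Set ℂ := Metric.ball 0 1

/-- The normalized Lebesgue area measure `dA = dx dy / π`. -/
def areaMeasure : Measure ℂ := ENNReal.ofReal (Real.pi)⁻¹ • volume

/-- `ω̂ (r) = ∫_r^1 ω(s) ds`. A radial weight is given by its profile `ω : ℝ → ℝ`, of which only
the values on `[0, 1)` matter; its value at a point `z` of the disc is `ω ‖z‖`. -/
def hat (ω : ℝ → ℝ) (r : ℝ) : ℝ := ∫ s in r..1, ω s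

/-- The class `D̂` of radial weights with `ω̂(r) ≤ C ω̂((1 + r) / 2)` for all `0 ≤ r < 1`.
For a nonnegative radial `ω` integrable over the disc, the inequality at `r = 0` forces
`ω̂(0) < ∞`; this is recorded as `integrableOn`, which in turn gives the integrability of
`z ↦ ω ‖z‖` over the disc. -/
structure IsDHat (ω : ℝ → ℝ) : Prop where
  nonneg : ∀ s ∈ Ico (0 : ℝ) 1, 0 ≤ ω s
  integrableOn : IntegrableOn ω (Ico (0 : ℝ) 1)
  doubling : ∃ C : ℝ, ∀ r ∈ Ico (0 : ℝ) 1, hat ω r ≤ C * hat ω ((1 + r) / 2)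

/-- `ω(𝔻) = ∫_𝔻 ω dA`. -/
def mass (ω : ℝ → ℝ) : ℝ := ∫ z in disc, ω ‖z‖ ∂areaMeasure

/-- Membership in the Dirichlet space `D_ω`: `f` is analytic in the disc and
`∫_𝔻 |f'|² ω dA < ∞`. -/
def MemDirichlet (ω : ℝ → ℝ) (f : ℂ → ℂ) : Prop :=
  DifferentiableOn ℂ f disc ∧
    IntegrableOn (fun z : ℂ => ‖deriv f z‖ ^ 2 * ω ‖z‖) disc areaMeasure

/-- The inner product of `D_ω`:
`⟨f, g⟩ = f(0) conj(g(0)) ω(𝔻) + ∫_𝔻 f' conj(g') ω dA`. -/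
def dirichletInner (ω : ℝ → ℝ) (f g : ℂ → ℂ) : ℂ :=
  f 0 * conj (g 0) * (mass ω : ℂ) +
    ∫ z in disc, deriv f z * conj (deriv g z) * (ω ‖z‖ : ℂ) ∂areaMeasure

/-- `K` is the reproducing kernel of `D_ω` at the point `a`: it belongs to `D_ω`, and
`f(a) = ⟨f, K⟩` for every `f ∈ D_ω`. -/
def IsReproducingKernel (ω : ℝ → ℝ) (a : ℂ) (K : ℂ → ℂ) : Prop :=
  MemDirichlet ω K ∧ ∀ f : ℂ → ℂ, MemDirichlet ω f → f a = dirichletInner ω f K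

open Classical in
/-- The reproducing kernel `K^ω_a` of `D_ω` (its values on the disc are determined by
`IsReproducingKernel`; the value is `0` if there is no reproducing kernel). -/
def dirichletKernel (ω : ℝ → ℝ) (a : ℂ) : ℂ → ℂ :=
  if h : ∃ K : ℂ → ℂ, IsReproducingKernel ω a K then h.choose else 0

/-- The integral mean `M_p^p(r, f) = (1 / 2π) ∫_0^{2π} |f(r e^{iθ})|^p dθ`. -/
def integralMean (p r : ℝ) (f : ℂ → ℂ) : ℝ :=
  Real.circleAverage (fun z => ‖f z‖ ^ p) 0 r

/-- Membership in the weighted Bergman space `A^p_v`. -/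
def MemBergman (p : ℝ) (v : ℝ → ℝ) (f : ℂ → ℂ) : Prop :=
  DifferentiableOn ℂ f disc ∧
    IntegrableOn (fun z : ℂ => ‖f z‖ ^ p * v ‖z‖) disc areaMeasure

/-- `‖f‖^p_{A^p_v} = ∫_𝔻 |f|^p v dA`, for `f ∈ A^p_v`. -/
def bergmanNormPow (p : ℝ) (v : ℝ → ℝ) (f : ℂ → ℂ) : ℝ :=
  ∫ z in disc, ‖f z‖ ^ p * v ‖z‖ ∂areaMeasure

/-- The filter `|a| → 1⁻` on `ℂ`. -/
def toBoundary : Filter ℂ := comap (fun a : ℂ => ‖a‖) (𝓝[<] (1 : ℝ))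

end

end RadialDirichlet

/-! Monomials are orthogonal in D_ω, and z^(n+1) has squared norm 2(n+1)² times the odd moment
`oddMoment ω n`. Hence the kernel is K_a(z) = G(conj a · z) with the explicit positive coefficients
`kernelCoeff ω`, and its N-th derivative is (conj a)^N F(conj a · z) with F = G^(N). By rotation,
(i) concerns only the mean of |F|^p on the circle of radius u = |a|r. With ψ = `kernelScale ω N`,
that is ψ(t) = (1-t)^(1-N)/ω̂(t), the core claim is that this mean is comparable to 1 + ∫_0^u ψ^p.

The k-th coefficient of F is comparable to ψ(1-1/k)/k, and each difference of the coefficients gains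
a factor 1/k, because differencing the moments inserts r²-1 under the integral. Therefore F has size
at most S(1-y) at distance y from 1, where S = `logPrimitive ψ` = 1 + ∫ψ/(1-s): cut the series near
1/y, bound the head by absolute values and sum the tail by parts (`norm_powerSum_le`). On the
radius, positivity of the coefficients gives the reverse bound (`logPrimitive_le_norm_powerSum`).

The upper estimate of the mean integrates this pointwise bound and uses a Hardy inequality for S
(`hardy`), valid for every p > 0 because doubling gives ψ ≲ S. For the lower estimate no pointwise
bound is available off the radius. Cauchy's formula with a kernel concentrated where |1-z| is about
y recovers S(1-y) from a localized mean of |F|. That mean is traded for one of |F|^p, by the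
pointwise upper bound if p ≤ 1 and by absorbing the small values of |F| if p ≥ 1. Integration in y
and Fubini then remove the localization (`kernel_mul_norm_le`, `le_circleAverage`).

For (ii) the circle means are integrated against v. Integration by parts replaces v by v̂, and the
doubling properties of ψ^p and v̂ compare the result, which involves ψ(|a|t), with the integral over
[0,|a|]. -/

namespace RadialDirichlet

/-! ### Doubling functions and their logarithmic primitives -/

/-- A continuous positive function on `[0, 1)` that grows at most by a fixed factor when the
distance to `1` is halved. -/
structure IsDoubling (ψ : ℝ → ℝ) (C : ℝ) : Prop where
  continuousOn : ContinuousOn ψ (Ico 0 1)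
  pos : ∀ t ∈ Ico (0 : ℝ) 1, 0 < ψ t
  le_mul : ∀ t s : ℝ, 0 ≤ t → t ≤ s → s ≤ (1 + t) / 2 → t < 1 → ψ s ≤ C * ψ t

theorem le_pow_mul_of_doubling {f : ℝ → ℝ} {C : ℝ} (hC : 1 ≤ C)
    (hd : ∀ t s : ℝ, 0 ≤ t → t ≤ s → s ≤ (1 + t) / 2 → t < 1 → f s ≤ C * f t) (j : ℕ) :
    ∀ t s : ℝ, 0 ≤ t → t ≤ s → s < 1 → 1 - t ≤ 2 ^ j * (1 - s) → f s ≤ C ^ j * f t := by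
  induction j with
  | zero =>
    intro t s h0 hts hs h
    have : t = s := le_antisymm hts (by linarith)
    simp [this]
  | succ j ih =>
    intro t s h0 hts hs h
    -- The point `2 * s - 1` is twice as far from 1 as `s`, so one doubling step leads from it to
    -- `s`. The maximum with `t` covers an incomplete last step.
    have h1 : t ≤ max t (2 * s - 1) := le_max_left _ _
    have h2 : max t (2 * s - 1) ≤ s := max_le hts (by linarith)
    have h3 : s ≤ (1 + max t (2 * s - 1)) / 2 := by
      have := le_max_right t (2 * s - 1); linarith
    have h4 : 1 - t ≤ 2 ^ j * (1 - max t (2 * s - 1)) := by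
      rcases max_cases t (2 * s - 1) with ⟨h', _⟩ | ⟨h', _⟩
      · rw [h']
        have : (1 : ℝ) ≤ 2 ^ j := one_le_pow₀ (by norm_num)
        nlinarith
      · rw [h']; rw [pow_succ] at h; linarith
    calc f s ≤ C * f (max t (2 * s - 1)) := hd _ _ (h0.trans h1) h2 h3 (by linarith)
      _ ≤ C * (C ^ j * f t) := by
        gcongr; exact ih _ _ h0 h1 (by linarith) h4
      _ = C ^ (j + 1) * f t := by ring

/-- A ratio of distances between 2^n and 2^(n+1) costs n+1 doublings, and `C < 2 ^ A` turns C^n into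
the A-th power of that ratio. -/
theorem exists_growth_of_doubling {f : ℝ → ℝ} {C : ℝ} (hC : 1 ≤ C)
    (hf : ∀ t ∈ Ico (0 : ℝ) 1, 0 ≤ f t)
    (hd : ∀ t s : ℝ, 0 ≤ t → t ≤ s → s ≤ (1 + t) / 2 → t < 1 → f s ≤ C * f t) :
    ∃ A : ℕ, ∀ t s : ℝ, 0 ≤ t → t ≤ s → s < 1 → f s ≤ C * ((1 - t) / (1 - s)) ^ A * f t := by
  obtain ⟨A, hA⟩ := pow_unbounded_of_one_lt C (one_lt_two)
  refine ⟨A, fun t s h0 hts hs => ?_⟩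
  have hx : 1 ≤ (1 - t) / (1 - s) := by rw [one_le_div (by linarith)]; linarith
  obtain ⟨n, hn1, hn2⟩ := exists_nat_pow_near hx (one_lt_two)
  have hft := hf t ⟨h0, by linarith⟩
  calc f s ≤ C ^ (n + 1) * f t := by
        refine le_pow_mul_of_doubling hC hd (n + 1) t s h0 hts hs ?_
        rw [div_lt_iff₀ (by linarith)] at hn2
        exact hn2.le
    _ = C * C ^ n * f t := by ring
    _ ≤ C * ((2 : ℝ) ^ A) ^ n * f t := by gcongr
    _ = C * ((2 : ℝ) ^ n) ^ A * f t := by rw [← pow_mul, ← pow_mul, mul_comm A n]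
    _ ≤ C * ((1 - t) / (1 - s)) ^ A * f t := by gcongr

/-- The function `1 + ∫_0^t ψ(s) / (1 - s) ds`. -/
noncomputable def logPrimitive (ψ : ℝ → ℝ) (t : ℝ) : ℝ := 1 + ∫ s in (0 : ℝ)..t, ψ s / (1 - s)

namespace IsDoubling

variable {ψ : ℝ → ℝ} {C : ℝ}

theorem one_le (h : IsDoubling ψ C) : 1 ≤ C := by
  have h1 := h.le_mul 0 0 le_rfl le_rfl (by norm_num) one_pos
  have h2 := h.pos 0 ⟨le_rfl, one_pos⟩
  nlinarith

theorem continuousOn_div (h : IsDoubling ψ C) :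
    ContinuousOn (fun s => ψ s / (1 - s)) (Ico 0 1) :=
  h.continuousOn.div (by fun_prop) fun s hs => by have := hs.2; exact (sub_pos.2 this).ne'

theorem intervalIntegrable_div (h : IsDoubling ψ C) {a b : ℝ} (ha : a ∈ Ico (0 : ℝ) 1)
    (hb : b ∈ Ico (0 : ℝ) 1) : IntervalIntegrable (fun s => ψ s / (1 - s)) volume a b :=
  (h.continuousOn_div.mono (ordConnected_Ico.uIcc_subset ha hb)).intervalIntegrable

theorem intervalIntegrable_rpow (h : IsDoubling ψ C) (p : ℝ) {a b : ℝ} (ha : a ∈ Ico (0 : ℝ) 1)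
    (hb : b ∈ Ico (0 : ℝ) 1) : IntervalIntegrable (fun s => ψ s ^ p) volume a b :=
  ((h.continuousOn.rpow_const fun s hs => Or.inl (h.pos s hs).ne').mono
    (ordConnected_Ico.uIcc_subset ha hb)).intervalIntegrable

theorem logPrimitive_sub (h : IsDoubling ψ C) {a b : ℝ} (ha : a ∈ Ico (0 : ℝ) 1)
    (hb : b ∈ Ico (0 : ℝ) 1) :
    logPrimitive ψ b - logPrimitive ψ a = ∫ s in a..b, ψ s / (1 - s) := by
  have h0 : (0 : ℝ) ∈ Ico (0 : ℝ) 1 := ⟨le_rfl, one_pos⟩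
  rw [logPrimitive, logPrimitive,
    ← intervalIntegral.integral_add_adjacent_intervals (h.intervalIntegrable_div h0 ha)
      (h.intervalIntegrable_div ha hb)]
  ring

theorem div_nonneg (h : IsDoubling ψ C) {s : ℝ} (hs : s ∈ Ico (0 : ℝ) 1) : 0 ≤ ψ s / (1 - s) :=
  _root_.div_nonneg (h.pos s hs).le (by linarith [hs.2])

theorem logPrimitive_mono (h : IsDoubling ψ C) : MonotoneOn (logPrimitive ψ) (Ico 0 1) := by
  intro a ha b hb hab
  have := h.logPrimitive_sub ha hb
  have h2 : 0 ≤ ∫ s in a..b, ψ s / (1 - s) :=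
    intervalIntegral.integral_nonneg hab fun s hs =>
      h.div_nonneg ⟨ha.1.trans hs.1, hs.2.trans_lt hb.2⟩
  linarith

theorem one_le_logPrimitive (h : IsDoubling ψ C) {t : ℝ} (ht : t ∈ Ico (0 : ℝ) 1) :
    1 ≤ logPrimitive ψ t := by
  have := h.logPrimitive_mono ⟨le_rfl, one_pos⟩ ht ht.1
  simpa [logPrimitive] using this

theorem hasDerivAt_logPrimitive (h : IsDoubling ψ C) {t : ℝ} (ht : t ∈ Ioo (0 : ℝ) 1) :
    HasDerivAt (logPrimitive ψ) (ψ t / (1 - t)) t := by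
  have h1 : ContinuousOn (fun s => ψ s / (1 - s)) (Ioo 0 1) :=
    h.continuousOn_div.mono Ioo_subset_Ico_self
  have h2 := intervalIntegral.integral_hasDerivAt_right
    (h.intervalIntegrable_div ⟨le_rfl, one_pos⟩ ⟨ht.1.le, ht.2⟩)
    (h1.stronglyMeasurableAtFilter isOpen_Ioo t ht) (h1.continuousAt (isOpen_Ioo.mem_nhds ht))
  exact h2.const_add 1

theorem continuousOn_logPrimitive (h : IsDoubling ψ C) :
    ContinuousOn (logPrimitive ψ) (Ico 0 1) := by
  intro t ht
  have hb : (1 + t) / 2 ∈ Ico (0 : ℝ) 1 := ⟨by linarith [ht.1], by linarith [ht.2]⟩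
  have h2 := intervalIntegral.continuousOn_primitive_interval (μ := volume)
    (((intervalIntegrable_iff' (by simp)).1 (h.intervalIntegrable_div ⟨le_rfl, one_pos⟩ hb)))
  have h3 : ContinuousOn (logPrimitive ψ) (uIcc 0 ((1 + t) / 2)) := continuousOn_const.add h2
  rw [uIcc_of_le hb.1] at h3
  refine (h3 t ⟨ht.1, by linarith [ht.2]⟩).mono_of_mem_nhdsWithin ?_
  refine mem_nhdsWithin.2 ⟨Iio ((1 + t) / 2), isOpen_Iio, ?_, fun s hs => ⟨hs.2.1, hs.1.le⟩⟩
  simp only [mem_Iio]; linarith [ht.2]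

/-- The interval [2t-1, t] has length 1-t, and doubling bounds the integrand there below by
ψ(t)/(2C(1-t)), so this piece alone contributes ψ(t)/(2C). For t < 1/2 the interval leaves [0,1),
but there ψ(t) ≤ Cψ(0) is enough. -/
theorem le_logPrimitive (h : IsDoubling ψ C) :
    ∃ K : ℝ, 0 < K ∧ ∀ t ∈ Ico (0 : ℝ) 1, ψ t ≤ K * logPrimitive ψ t := by
  have h0 := h.pos 0 ⟨le_rfl, one_pos⟩
  have hC := h.one_le
  refine ⟨C * ψ 0 + 2 * C, by positivity, fun t ht => ?_⟩
  have hS := h.one_le_logPrimitive ht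
  rcases le_total t (1 / 2) with h1 | h1
  · have := h.le_mul 0 t le_rfl ht.1 (by linarith) one_pos
    nlinarith [mul_pos (zero_lt_one.trans_le hC) h0]
  · have ha : 2 * t - 1 ∈ Ico (0 : ℝ) 1 := ⟨by linarith, by linarith [ht.2]⟩
    have hd := h.logPrimitive_sub ha ht
    have hta : 2 * t - 1 ≤ t := by linarith [ht.2]
    have h3 : ∫ s in (2 * t - 1)..t, ψ t / (C * (2 * (1 - t))) ≤
        ∫ s in (2 * t - 1)..t, ψ s / (1 - s) := by
      refine intervalIntegral.integral_mono_on hta (by simp) (h.intervalIntegrable_div ha ht) ?_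
      intro s hs
      have hs1 : s < 1 := hs.2.trans_lt ht.2
      have h4 := h.le_mul s t (ha.1.trans hs.1) hs.2 (by linarith [hs.1]) hs1
      have h5 : 0 < 1 - t := sub_pos.2 ht.2
      rw [div_le_div_iff₀ (by positivity) (by linarith)]
      have h6 := h.pos s ⟨ha.1.trans hs.1, hs1⟩
      calc ψ t * (1 - s) ≤ (C * ψ s) * (2 * (1 - t)) := by
            gcongr
            linarith [hs.1]
        _ = ψ s * (C * (2 * (1 - t))) := by ring
    rw [intervalIntegral.integral_const, smul_eq_mul] at h3
    have h5 : (1 - t) ≠ 0 := (sub_pos.2 ht.2).ne'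
    have h6 : (t - (2 * t - 1)) * (ψ t / (C * (2 * (1 - t)))) = ψ t / (2 * C) := by
      field_simp; ring
    rw [h6, div_le_iff₀ (by positivity)] at h3
    have h7 := h.one_le_logPrimitive ha
    have : 0 ≤ C * ψ 0 := by positivity
    nlinarith

/-- On [t,s] both the length is at most (1-t)/2 and the denominator at least (1-t)/2, so the
increment is at most Cψ(t), which `le_logPrimitive` bounds by the value at t. -/
theorem logPrimitive_doubling (h : IsDoubling ψ C) :
    ∃ K : ℝ, 1 ≤ K ∧ ∀ t s : ℝ, 0 ≤ t → t ≤ s → s ≤ (1 + t) / 2 → t < 1 →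
      logPrimitive ψ s ≤ K * logPrimitive ψ t := by
  obtain ⟨K, hK, hK2⟩ := h.le_logPrimitive
  have hC := h.one_le
  refine ⟨1 + C * K, by nlinarith, fun t s h0 hts hs ht => ?_⟩
  have htm : t ∈ Ico (0 : ℝ) 1 := ⟨h0, ht⟩
  have hsm : s ∈ Ico (0 : ℝ) 1 := ⟨h0.trans hts, by linarith⟩
  have hd := h.logPrimitive_sub htm hsm
  have h3 : ∫ x in t..s, ψ x / (1 - x) ≤ ∫ x in t..s, C * ψ t / ((1 - t) / 2) := by
    refine intervalIntegral.integral_mono_on hts (h.intervalIntegrable_div htm hsm) (by simp) ?_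
    intro x hx
    have := h.pos t htm
    have := h.le_mul t x h0 hx.1 (hx.2.trans hs) ht
    gcongr
    linarith [hx.2]
  rw [intervalIntegral.integral_const, smul_eq_mul] at h3
  have h4 : (s - t) * (C * ψ t / ((1 - t) / 2)) ≤ C * ψ t := by
    have h5 : 0 < 1 - t := by linarith
    have := h.pos t htm
    rw [mul_div_assoc', div_le_iff₀ (by linarith)]
    rw [mul_comm]
    gcongr
    linarith
  have h6 := hK2 t htm
  have : C * ψ t ≤ C * (K * logPrimitive ψ t) := by gcongr
  linarith

theorem exists_growth_logPrimitive (h : IsDoubling ψ C) :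
    ∃ K : ℝ, 1 ≤ K ∧ ∃ A : ℕ, ∀ t s : ℝ, 0 ≤ t → t ≤ s → s < 1 →
      logPrimitive ψ s ≤ K * ((1 - t) / (1 - s)) ^ A * logPrimitive ψ t := by
  obtain ⟨K, hK, hK2⟩ := h.logPrimitive_doubling
  exact ⟨K, hK, exists_growth_of_doubling hK
    (fun _ ht => zero_le_one.trans (h.one_le_logPrimitive ht)) hK2⟩

theorem continuousOn_logPrimitive_rpow (h : IsDoubling ψ C) (p : ℝ) :
    ContinuousOn (fun t => logPrimitive ψ t ^ p) (Ico 0 1) :=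
  h.continuousOn_logPrimitive.rpow_const fun _ ht =>
    Or.inl (zero_lt_one.trans_le (h.one_le_logPrimitive ht)).ne'

theorem intervalIntegrable_logPrimitive_rpow (h : IsDoubling ψ C) (p : ℝ) {a b : ℝ}
    (ha : a ∈ Ico (0 : ℝ) 1) (hb : b ∈ Ico (0 : ℝ) 1) :
    IntervalIntegrable (fun s => logPrimitive ψ s ^ p) volume a b :=
  ((h.continuousOn_logPrimitive_rpow p).mono
    (ordConnected_Ico.uIcc_subset ha hb)).intervalIntegrable

/-! ### A Hardy inequality for all positive exponents -/

/-- If y ≤ εx the first term suffices. Otherwise x^(p-1) is compared with y^(p-1): for p ≥ 1 through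
x ≤ y/ε, for p ≤ 1 through x ≥ y/K. These give the two summands of the constant. -/
theorem exists_young {p ε K : ℝ} (hε : 0 < ε) (hK : 0 < K) :
    ∃ M : ℝ, 0 < M ∧ ∀ x y : ℝ, 0 < x → 0 < y → y ≤ K * x →
      x ^ (p - 1) * y ≤ ε * x ^ p + M * y ^ p := by
  refine ⟨ε ^ (1 - p) + K ^ (1 - p), by positivity, fun x y hx hy hyx => ?_⟩
  rcases le_total y (ε * x) with h | h
  · have : x ^ (p - 1) * y ≤ x ^ (p - 1) * (ε * x) := by gcongr
    have h2 : x ^ (p - 1) * (ε * x) = ε * x ^ p := by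
      rw [Real.rpow_sub_one hx.ne']; field_simp
    have : 0 ≤ (ε ^ (1 - p) + K ^ (1 - p)) * y ^ p := by positivity
    linarith
  · have hy' : y ^ p = y ^ (p - 1) * y := by rw [Real.rpow_sub_one hy.ne']; field_simp
    suffices x ^ (p - 1) ≤ (ε ^ (1 - p) + K ^ (1 - p)) * y ^ (p - 1) by
      have h3 : 0 ≤ ε * x ^ p := by positivity
      rw [hy', ← mul_assoc]
      nlinarith
    rcases le_total p 1 with h1 | h1
    · have h2 : x ^ (p - 1) ≤ (y / K) ^ (p - 1) :=
        Real.rpow_le_rpow_of_nonpos (by positivity) (by rwa [div_le_iff₀' hK]) (by linarith)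
      have h3 : (y / K) ^ (p - 1) = K ^ (1 - p) * y ^ (p - 1) := by
        rw [Real.div_rpow hy.le hK.le, show 1 - p = -(p - 1) by ring, Real.rpow_neg hK.le]
        field_simp
      have : 0 ≤ ε ^ (1 - p) * y ^ (p - 1) := by positivity
      rw [add_mul]; linarith
    · have h2 : x ^ (p - 1) ≤ (y / ε) ^ (p - 1) :=
        Real.rpow_le_rpow hx.le (by rwa [le_div_iff₀' hε]) (by linarith)
      have h3 : (y / ε) ^ (p - 1) = ε ^ (1 - p) * y ^ (p - 1) := by
        rw [Real.div_rpow hy.le hε.le, show 1 - p = -(p - 1) by ring, Real.rpow_neg hε.le]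
        field_simp
      have : 0 ≤ K ^ (1 - p) * y ^ (p - 1) := by positivity
      rw [add_mul]; linarith

/-- With S = `logPrimitive ψ`, the derivative of (1-t)S^p is -S^p + pS^(p-1)ψ. After integration,
Young's inequality with ε = 1/(2p) absorbs half of ∫S^p. The bound ψ ≤ KS is what admits p < 1. -/
theorem hardy (h : IsDoubling ψ C) {p : ℝ} (hp : 0 < p) :
    ∃ K : ℝ, 0 < K ∧ ∀ u ∈ Ico (0 : ℝ) 1,
      (1 - u) * logPrimitive ψ u ^ p + ∫ t in (0 : ℝ)..u, logPrimitive ψ t ^ p ≤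
        K * (1 + ∫ t in (0 : ℝ)..u, ψ t ^ p) := by
  obtain ⟨K, hK, hK2⟩ := h.le_logPrimitive
  obtain ⟨M, hM, hM2⟩ := exists_young (p := p) (ε := 1 / (2 * p)) (by positivity) hK
  refine ⟨2 + 2 * p * M, by positivity, fun u hu => ?_⟩
  have hz : (0 : ℝ) ∈ Ico (0 : ℝ) 1 := ⟨le_rfl, one_pos⟩
  have hsub : uIcc 0 u ⊆ Ico (0 : ℝ) 1 := ordConnected_Ico.uIcc_subset hz hu
  have hpos : ∀ t ∈ Ico (0 : ℝ) 1, 0 < logPrimitive ψ t := fun t ht =>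
    zero_lt_one.trans_le (h.one_le_logPrimitive ht)
  have i1 := h.intervalIntegrable_logPrimitive_rpow p hz hu
  have i1' : IntervalIntegrable (fun s => -(logPrimitive ψ s ^ p)) volume 0 u := i1.neg
  have c2 : ContinuousOn (fun t => logPrimitive ψ t ^ (p - 1) * ψ t) (uIcc 0 u) :=
    ((h.continuousOn_logPrimitive_rpow (p - 1)).mul h.continuousOn).mono hsub
  have i2 := c2.intervalIntegrable (μ := volume)
  have i3 := h.intervalIntegrable_rpow p hz hu
  have hftc : ∫ t in (0 : ℝ)..u, (-(logPrimitive ψ t ^ p) + p * (logPrimitive ψ t ^ (p - 1) * ψ t))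
      = (1 - u) * logPrimitive ψ u ^ p - 1 := by
    rw [intervalIntegral.integral_eq_sub_of_hasDerivAt_of_le (f := fun t =>
      (1 - t) * logPrimitive ψ t ^ p) hu.1 _ _ (i1'.add (i2.const_mul p))]
    · simp [logPrimitive]
    · exact (by fun_prop : ContinuousOn (fun t : ℝ => 1 - t) _).mul
        ((h.continuousOn_logPrimitive_rpow p).mono (by rwa [← uIcc_of_le hu.1]))
    · intro t ht
      have ht' : t ∈ Ioo (0 : ℝ) 1 := ⟨ht.1, ht.2.trans hu.2⟩
      have h1 := (h.hasDerivAt_logPrimitive ht').rpow_const (p := p)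
        (Or.inl (hpos t (Ioo_subset_Ico_self ht')).ne')
      have h2 := ((hasDerivAt_id t).const_sub 1).mul h1
      have h3 : 1 - t ≠ 0 := (sub_pos.2 ht'.2).ne'
      refine h2.congr_deriv ?_
      simp only [id]
      field_simp
  rw [intervalIntegral.integral_add i1' (i2.const_mul p), intervalIntegral.integral_neg,
    intervalIntegral.integral_const_mul] at hftc
  have hyoung : ∫ t in (0 : ℝ)..u, logPrimitive ψ t ^ (p - 1) * ψ t ≤
      ∫ t in (0 : ℝ)..u, (1 / (2 * p) * logPrimitive ψ t ^ p + M * ψ t ^ p) := by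
    refine intervalIntegral.integral_mono_on hu.1 i2 ((i1.const_mul _).add (i3.const_mul _)) ?_
    intro t ht
    have ht' : t ∈ Ico (0 : ℝ) 1 := ⟨ht.1, ht.2.trans_lt hu.2⟩
    exact hM2 _ _ (hpos t ht') (h.pos t ht') (hK2 t ht')
  rw [intervalIntegral.integral_add (i1.const_mul _) (i3.const_mul _),
    intervalIntegral.integral_const_mul, intervalIntegral.integral_const_mul] at hyoung
  set X := ∫ t in (0 : ℝ)..u, logPrimitive ψ t ^ p
  set Y := ∫ t in (0 : ℝ)..u, ψ t ^ p with hY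
  have hY0 : 0 ≤ Y := intervalIntegral.integral_nonneg hu.1 fun t ht =>
    (Real.rpow_nonneg (h.pos t ⟨ht.1, ht.2.trans_lt hu.2⟩).le p)
  have hu2 : 0 ≤ (1 - u) * logPrimitive ψ u ^ p :=
    mul_nonneg (by linarith [hu.2]) (Real.rpow_nonneg (hpos u hu).le p)
  have h8 : p * ∫ t in (0 : ℝ)..u, logPrimitive ψ t ^ (p - 1) * ψ t ≤ X / 2 + p * M * Y := by
    calc _ ≤ p * (1 / (2 * p) * X + M * Y) := by gcongr
      _ = _ := by field_simp
  have h9 : 0 ≤ p * M := by positivity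
  nlinarith

end IsDoubling


/-! ### Sequences with symbol-type differences -/

/-- `a = O(b)`, and the `j`-th difference of `a` is `O(b n / (n + 1) ^ j)` for `j ≤ m`. -/
def IsSymbol : ℕ → (ℕ → ℝ) → (ℕ → ℝ) → Prop
  | 0, b, a => ∃ K : ℝ, ∀ n, |a n| ≤ K * b n
  | m + 1, b, a => (∃ K : ℝ, ∀ n, |a n| ≤ K * b n) ∧
      IsSymbol m (fun n => b n / (n + 1)) (fun n => a (n + 1) - a n)

/-- A positive sequence each of whose terms is bounded by a fixed multiple of the previous one. -/
structure IsModerate (b : ℕ → ℝ) : Prop where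
  pos : ∀ n, 0 < b n
  succ_le : ∃ K : ℝ, ∀ n, b (n + 1) ≤ K * b n

namespace IsModerate

variable {b b' : ℕ → ℝ}

theorem exists_pos (h : IsModerate b) : ∃ K : ℝ, 0 < K ∧ ∀ n, b (n + 1) ≤ K * b n := by
  obtain ⟨K, hK⟩ := h.succ_le
  refine ⟨|K| + 1, by positivity, fun n => (hK n).trans ?_⟩
  have := h.pos n
  gcongr
  linarith [le_abs_self K]

theorem div (h : IsModerate b) : IsModerate fun n => b n / (n + 1) := by
  refine ⟨fun n => by have := h.pos n; positivity, ?_⟩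
  obtain ⟨K, hK0, hK⟩ := h.exists_pos
  refine ⟨K, fun n => ?_⟩
  have := h.pos n
  calc b (n + 1) / ((n + 1 : ℕ) + 1) ≤ K * b n / ((n : ℝ) + 1) := by
        gcongr
        · exact hK n
        · linarith
    _ = _ := by ring

theorem mul (h : IsModerate b) (h' : IsModerate b') : IsModerate fun n => b n * b' n := by
  refine ⟨fun n => mul_pos (h.pos n) (h'.pos n), ?_⟩
  obtain ⟨K, hK0, hK⟩ := h.exists_pos
  obtain ⟨K', hK0', hK'⟩ := h'.exists_pos
  refine ⟨K * K', fun n => ?_⟩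
  have := h.pos n
  have := (h'.pos (n + 1)).le
  calc b (n + 1) * b' (n + 1) ≤ (K * b n) * (K' * b' n) := by
        gcongr
        · exact hK n
        · exact hK' n
    _ = _ := by ring

end IsModerate

namespace IsSymbol

variable {m : ℕ} {b b' a a' : ℕ → ℝ}

theorem bound (h : IsSymbol m b a) : ∃ K : ℝ, ∀ n, |a n| ≤ K * b n := by
  cases m with
  | zero => exact h
  | succ m => exact h.1

theorem bound_pos (h : IsSymbol m b a) (hb : ∀ n, 0 < b n) :
    ∃ K : ℝ, 0 < K ∧ ∀ n, |a n| ≤ K * b n := by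
  obtain ⟨K, hK⟩ := h.bound
  refine ⟨|K| + 1, by positivity, fun n => (hK n).trans ?_⟩
  have := hb n
  gcongr
  linarith [le_abs_self K]

theorem of_succ (h : IsSymbol (m + 1) b a) : IsSymbol m b a := by
  induction m generalizing b a with
  | zero => exact h.1
  | succ m ih => exact ⟨h.1, ih h.2⟩

theorem shift (hb : IsModerate b) (h : IsSymbol m b a) : IsSymbol m b fun n => a (n + 1) := by
  have key : ∃ K : ℝ, ∀ n, |a (n + 1)| ≤ K * b n := by
    obtain ⟨K, hK0, hK⟩ := h.bound_pos hb.pos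
    obtain ⟨K', hK'⟩ := hb.succ_le
    refine ⟨K * K', fun n => (hK (n + 1)).trans ?_⟩
    rw [mul_assoc]
    gcongr
    exact hK' n
  induction m generalizing b a with
  | zero => exact key
  | succ m ih =>
    refine ⟨key, ih hb.div h.2 ?_⟩
    obtain ⟨K, hK0, hK⟩ := h.2.bound_pos hb.div.pos
    obtain ⟨K', hK'⟩ := hb.div.succ_le
    refine ⟨K * K', fun n => (hK (n + 1)).trans ?_⟩
    rw [mul_assoc]
    gcongr
    exact hK' n

theorem add (h : IsSymbol m b a) (h' : IsSymbol m b a') : IsSymbol m b fun n => a n + a' n := by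
  have key : ∃ K : ℝ, ∀ n, |a n + a' n| ≤ K * b n := by
    obtain ⟨K, hK⟩ := h.bound
    obtain ⟨K', hK'⟩ := h'.bound
    exact ⟨K + K', fun n => (abs_add_le _ _).trans (by linarith [hK n, hK' n])⟩
  induction m generalizing b a a' with
  | zero => exact key
  | succ m ih =>
    refine ⟨key, ?_⟩
    have h1 : ∃ K : ℝ, ∀ n : ℕ, |(a (n + 1) - a n) + (a' (n + 1) - a' n)| ≤ K * (b n / (n + 1)) := by
      obtain ⟨K, hK⟩ := h.2.bound
      obtain ⟨K', hK'⟩ := h'.2.bound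
      exact ⟨K + K', fun n => (abs_add_le _ _).trans (by linarith [hK n, hK' n])⟩
    convert ih h.2 h'.2 h1 using 2
    ring

theorem neg (h : IsSymbol m b a) : IsSymbol m b fun n => -a n := by
  induction m generalizing b a with
  | zero => simpa [IsSymbol] using h
  | succ m ih =>
    refine ⟨by simpa using h.1, ?_⟩
    convert ih h.2 using 2
    ring

/-- Discrete Leibniz rule: the difference of aa' at n is a(n+1)·Δa'(n) + Δa(n)·a'(n). The shifted
factor is the reason for `IsModerate`. -/
theorem mul (hb : IsModerate b) (hb' : IsModerate b') (h : IsSymbol m b a)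
    (h' : IsSymbol m b' a') : IsSymbol m (fun n => b n * b' n) fun n => a n * a' n := by
  have key : ∀ {m : ℕ} {b b' a a' : ℕ → ℝ}, IsModerate b → IsSymbol m b a →
      IsSymbol m b' a' → ∃ K : ℝ, ∀ n, |a n * a' n| ≤ K * (b n * b' n) := by
    intro m b b' a a' hb h h'
    obtain ⟨K, hK0, hK⟩ := h.bound_pos hb.pos
    obtain ⟨K', hK'⟩ := h'.bound
    refine ⟨K * K', fun n => ?_⟩
    rw [abs_mul]
    have := hb.pos n
    calc |a n| * |a' n| ≤ (K * b n) * (K' * b' n) := by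
          gcongr
          · exact hK n
          · exact hK' n
      _ = _ := by ring
  induction m generalizing b b' a a' with
  | zero => exact key hb h h'
  | succ m ih =>
    refine ⟨key hb h h', ?_⟩
    have h1 := ih hb hb'.div (h.of_succ.shift hb) h'.2
    have h2 := ih hb.div hb' h.2 h'.of_succ
    have e1 : (fun n : ℕ => b n * (b' n / (n + 1))) = fun n : ℕ => b n * b' n / (n + 1) := by
      ext n; ring
    have e2 : (fun n : ℕ => b n / (n + 1) * b' n) = fun n : ℕ => b n * b' n / (n + 1) := by
      ext n; ring
    rw [e1] at h1
    rw [e2] at h2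
    convert h1.add h2 using 2
    ring

/-- The difference of 1/a is -Δa(n)/(a(n)a(n+1)), in which the inverses are needed only to one order
less, so induction and the product rule apply. -/
theorem inv (hb : IsModerate b) (hb' : IsModerate fun n => (b n)⁻¹) {δ : ℝ} (hδ : 0 < δ)
    (h : IsSymbol m b a) (hlow : ∀ n, δ * b n ≤ a n) :
    IsSymbol m (fun n => (b n)⁻¹) fun n => (a n)⁻¹ := by
  have hpos : ∀ n, 0 < a n := fun n => (mul_pos hδ (hb.pos n)).trans_le (hlow n)
  have key : ∃ K : ℝ, ∀ n, |(a n)⁻¹| ≤ K * (b n)⁻¹ := by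
    refine ⟨δ⁻¹, fun n => ?_⟩
    rw [abs_of_pos (inv_pos.2 (hpos n)), ← mul_inv]
    have := hb.pos n
    gcongr
    exact hlow n
  induction m with
  | zero => exact key
  | succ m ih =>
    refine ⟨key, ?_⟩
    have h1 := ih h.of_succ
    have h2 := (h1.mul hb' hb' (h1.shift hb')).mul (hb'.mul hb') hb.div h.2.neg
    convert h2 using 2 with n n
    · have := (hb.pos n).ne'
      field_simp
    · have := (hpos n).ne'
      have := (hpos (n + 1)).ne'
      field_simp
      ring

end IsSymbol

/-! ### Power series and summation by parts -/

/-- The power series `∑ c n ζ ^ n`. -/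
noncomputable def powerSum (c : ℕ → ℝ) (ζ : ℂ) : ℂ := ∑' n, (c n : ℂ) * ζ ^ n

/-- At most polynomial growth. -/
def IsPolyBounded (c : ℕ → ℝ) : Prop := ∃ (K : ℝ) (B : ℕ), ∀ n, |c n| ≤ K * ((n : ℝ) + 1) ^ B

theorem summable_pow_succ_mul_geometric {r : ℝ} (hr0 : 0 ≤ r) (hr : r < 1) (B : ℕ) :
    Summable fun n : ℕ => ((n : ℝ) + 1) ^ B * r ^ n := by
  rcases hr0.eq_or_lt with rfl | hr0
  · refine summable_of_ne_finset_zero (s := {0}) fun n hn => ?_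
    simp only [Finset.mem_singleton] at hn
    simp [hn]
  have h := summable_pow_mul_geometric_of_norm_lt_one (R := ℝ) B
    (r := r) (by rwa [Real.norm_of_nonneg hr0.le])
  have h2 := ((summable_nat_add_iff 1).2 h).mul_right r⁻¹
  refine h2.congr fun n => ?_
  push_cast
  rw [pow_succ]
  field_simp

theorem IsPolyBounded.summable_norm {c : ℕ → ℝ} (hc : IsPolyBounded c) {ζ : ℂ} (hζ : ‖ζ‖ < 1) :
    Summable fun n => ‖(c n : ℂ) * ζ ^ n‖ := by
  obtain ⟨K, B, hK⟩ := hc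
  refine Summable.of_nonneg_of_le (fun n => norm_nonneg _) (fun n => ?_)
    ((summable_pow_succ_mul_geometric (norm_nonneg ζ) hζ B).mul_left K)
  rw [norm_mul, norm_pow, Complex.norm_real, Real.norm_eq_abs, ← mul_assoc]
  gcongr
  exact hK n

theorem IsPolyBounded.summable {c : ℕ → ℝ} (hc : IsPolyBounded c) {ζ : ℂ} (hζ : ‖ζ‖ < 1) :
    Summable fun n => (c n : ℂ) * ζ ^ n := (hc.summable_norm hζ).of_norm

theorem IsPolyBounded.shift {c : ℕ → ℝ} (hc : IsPolyBounded c) :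
    IsPolyBounded fun n => c (n + 1) := by
  obtain ⟨K, B, hK⟩ := hc
  have hK0 : 0 ≤ K := by have := (abs_nonneg _).trans (hK 0); simpa using this
  refine ⟨K * 2 ^ B, B, fun n => (hK (n + 1)).trans ?_⟩
  rw [mul_assoc, ← mul_pow]
  gcongr
  push_cast; linarith

/-- Growth of a comparison sequence which makes its `m`-fold quotient by `n + 1` decay like
`(n + 1)⁻²`. -/
def IsTempered (m : ℕ) (b : ℕ → ℝ) : Prop :=
  ∃ K : ℝ, 0 < K ∧ ∀ n k : ℕ, n ≤ k →
    b k * ((k : ℝ) + 1) ^ 2 * ((n : ℝ) + 1) ^ m ≤ K * b n * ((n : ℝ) + 1) ^ 2 * ((k : ℝ) + 1) ^ m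

theorem IsTempered.div {m : ℕ} {b : ℕ → ℝ} (h : IsTempered (m + 1) b) :
    IsTempered m fun n => b n / (n + 1) := by
  obtain ⟨K, hK0, hK⟩ := h
  refine ⟨K, hK0, fun n k hnk => ?_⟩
  have h1 := hK n k hnk
  have hn : (0 : ℝ) < (n : ℝ) + 1 := by positivity
  have hk : (0 : ℝ) < (k : ℝ) + 1 := by positivity
  have h2 := div_le_div_of_nonneg_right h1 (mul_pos hn hk).le
  calc b k / ((k : ℝ) + 1) * ((k : ℝ) + 1) ^ 2 * ((n : ℝ) + 1) ^ m =
        b k * ((k : ℝ) + 1) ^ 2 * ((n : ℝ) + 1) ^ (m + 1) / (((n : ℝ) + 1) * ((k : ℝ) + 1)) := by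
        rw [pow_succ _ m]; field_simp
    _ ≤ _ := h2
    _ = _ := by rw [pow_succ _ m]; field_simp

theorem IsTempered.isPolyBounded {m : ℕ} {b a : ℕ → ℝ} (h : IsTempered m b) (hb : ∀ n, 0 < b n)
    (ha : ∃ K : ℝ, ∀ n, |a n| ≤ K * b n) : IsPolyBounded a := by
  obtain ⟨K, hK0, hK⟩ := h
  obtain ⟨K', hK'⟩ := ha
  have hK'0 : 0 ≤ K' := by
    have := (abs_nonneg _).trans (hK' 0)
    exact nonneg_of_mul_nonneg_left this (hb 0)
  refine ⟨K' * (K * b 0), m, fun n => (hK' n).trans ?_⟩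
  rw [mul_assoc K']
  gcongr
  have h1 := hK 0 n (Nat.zero_le _)
  simp only [Nat.cast_zero, zero_add, one_pow, mul_one] at h1
  refine le_trans ?_ h1
  have := hb n
  have : (1 : ℝ) ≤ ((n : ℝ) + 1) ^ 2 := one_le_pow₀ (by linarith [n.cast_nonneg (α := ℝ)])
  nlinarith

/-- Telescoping: 1/(x+1)² ≤ 2/(x+1) - 2/(x+2) for x ≥ 0. -/
theorem tsum_inv_sq_tail_le (n : ℕ) :
    Summable (fun k : ℕ => 1 / ((n + k : ℕ) + 1 : ℝ) ^ 2) ∧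
      ∑' k : ℕ, 1 / ((n + k : ℕ) + 1 : ℝ) ^ 2 ≤ 2 / ((n : ℝ) + 1) := by
  have hpart : ∀ N : ℕ, ∑ k ∈ Finset.range N, 1 / ((n + k : ℕ) + 1 : ℝ) ^ 2 ≤
      2 / ((n : ℝ) + 1) - 2 / ((n : ℝ) + N + 1) := by
    intro N
    induction N with
    | zero => simp
    | succ N ih =>
      rw [Finset.sum_range_succ]
      have h2 : 1 / ((n + N : ℕ) + 1 : ℝ) ^ 2 ≤
          2 / ((n : ℝ) + N + 1) - 2 / ((n : ℝ) + (N + 1 : ℕ) + 1) := by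
        push_cast
        rw [div_sub_div _ _ (by positivity) (by positivity),
          div_le_div_iff₀ (by positivity) (by positivity)]
        have : (0 : ℝ) ≤ (n : ℝ) + N := by positivity
        nlinarith [mul_nonneg this this, mul_nonneg (mul_nonneg this this) this]
      linarith
  have hnn : ∀ k : ℕ, 0 ≤ 1 / ((n + k : ℕ) + 1 : ℝ) ^ 2 := fun k => by positivity
  have hle : ∀ N : ℕ, ∑ k ∈ Finset.range N, 1 / ((n + k : ℕ) + 1 : ℝ) ^ 2 ≤
      2 / ((n : ℝ) + 1) := fun N => (hpart N).trans (by
    have : 0 ≤ 2 / ((n : ℝ) + N + 1) := by positivity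
    linarith)
  exact ⟨summable_of_sum_range_le hnn hle, Real.tsum_le_of_sum_range_le hnn hle⟩

/-- Abel summation: (1-ζ) times the tail is its first term plus ζ times the tail of the differenced
coefficients. Differencing gains 1/(n+1), while division by 1-ζ loses at most 2(n+1). After m rounds
the comparison sequence decays like an inverse square and absolute values suffice. -/
theorem norm_tail_le (m : ℕ) {b a : ℕ → ℝ} (hb : ∀ n, 0 < b n) (ha : IsSymbol m b a)
    (ht : IsTempered m b) :
    ∃ K : ℝ, 0 < K ∧ ∀ (ζ : ℂ) (n : ℕ), ‖ζ‖ < 1 → 1 ≤ 2 * (((n : ℝ) + 1) * ‖1 - ζ‖) →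
      ‖∑' k : ℕ, (a (n + k) : ℂ) * ζ ^ (n + k)‖ ≤ K * ((n + 1) * b n) := by
  induction m generalizing b a with
  | zero =>
    obtain ⟨K, hK0, hK⟩ := ha.bound_pos hb
    obtain ⟨M, hM0, hM⟩ := ht
    refine ⟨K * M * 2, by positivity, fun ζ n hζ _ => ?_⟩
    obtain ⟨hs, hle⟩ := tsum_inv_sq_tail_le n
    have hterm : ∀ k : ℕ, ‖(a (n + k) : ℂ) * ζ ^ (n + k)‖ ≤
        K * M * b n * ((n : ℝ) + 1) ^ 2 * (1 / ((n + k : ℕ) + 1 : ℝ) ^ 2) := by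
      intro k
      rw [norm_mul, norm_pow, Complex.norm_real, Real.norm_eq_abs]
      have h1 := hM n (n + k) (Nat.le_add_right _ _)
      simp only [pow_zero, mul_one] at h1
      have h2 : b (n + k) ≤ M * b n * ((n : ℝ) + 1) ^ 2 * (1 / ((n + k : ℕ) + 1 : ℝ) ^ 2) := by
        rw [mul_one_div, le_div_iff₀ (by positivity)]
        exact h1
      calc |a (n + k)| * ‖ζ‖ ^ (n + k) ≤ |a (n + k)| * 1 := by
            gcongr; exact pow_le_one₀ (norm_nonneg _) hζ.le
        _ ≤ K * b (n + k) := by rw [mul_one]; exact hK _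
        _ ≤ K * (M * b n * ((n : ℝ) + 1) ^ 2 * (1 / ((n + k : ℕ) + 1 : ℝ) ^ 2)) := by gcongr
        _ = _ := by ring
    refine (tsum_of_norm_bounded (hs.mul_left _).hasSum hterm).trans ?_
    rw [tsum_mul_left]
    have := hb n
    calc _ ≤ K * M * b n * ((n : ℝ) + 1) ^ 2 * (2 / ((n : ℝ) + 1)) := by gcongr
      _ = _ := by field_simp
  | succ m ih =>
    obtain ⟨K, hK0, hK⟩ := ha.bound_pos hb
    obtain ⟨M, hM0, hM⟩ := ih (fun n => by have := hb n; positivity) ha.2 ht.div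
    refine ⟨2 * (K + M), by positivity, fun ζ n hζ hn => ?_⟩
    have hsum : Summable fun k : ℕ => (a (n + k) : ℂ) * ζ ^ (n + k) := by
      have := (ht.isPolyBounded hb ha.bound).summable hζ
      simpa only [add_comm n] using (summable_nat_add_iff n).2 this
    have hsum1 := (summable_nat_add_iff 1).2 hsum
    have h1 := hM ζ n hζ hn
    have hbn := hb n
    have hid : (1 - ζ) * ∑' k : ℕ, (a (n + k) : ℂ) * ζ ^ (n + k) = a n * ζ ^ n +
        ζ * ∑' k : ℕ, ((a (n + k + 1) - a (n + k) : ℝ) : ℂ) * ζ ^ (n + k) := by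
      have e1 : ∑' k : ℕ, (a (n + k) : ℂ) * ζ ^ (n + k) =
          a n * ζ ^ n + ∑' k : ℕ, (a (n + (k + 1)) : ℂ) * ζ ^ (n + (k + 1)) := by
        rw [hsum.tsum_eq_zero_add]; simp
      have e2 : ζ * ∑' k : ℕ, ((a (n + k + 1) - a (n + k) : ℝ) : ℂ) * ζ ^ (n + k) =
          ∑' k : ℕ, (a (n + (k + 1)) : ℂ) * ζ ^ (n + (k + 1)) -
            ζ * ∑' k : ℕ, (a (n + k) : ℂ) * ζ ^ (n + k) := by
        rw [← tsum_mul_left, ← tsum_mul_left, ← hsum1.tsum_sub (hsum.mul_left ζ)]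
        refine tsum_congr fun k => ?_
        push_cast
        rw [← add_assoc, pow_succ]
        ring
      rw [e2, sub_mul, one_mul, e1]
      ring
    have hnorm := congrArg norm hid
    rw [norm_mul] at hnorm
    have hR : ‖(a n : ℂ) * ζ ^ n +
        ζ * ∑' k : ℕ, ((a (n + k + 1) - a (n + k) : ℝ) : ℂ) * ζ ^ (n + k)‖ ≤ (K + M) * b n := by
      refine (norm_add_le _ _).trans ?_
      rw [norm_mul, norm_mul, norm_pow, Complex.norm_real, Real.norm_eq_abs]
      have h3 : |a n| * ‖ζ‖ ^ n ≤ K * b n * 1 := by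
        gcongr
        · exact hK n
        · exact pow_le_one₀ (norm_nonneg _) hζ.le
      have h4 : M * (((n : ℝ) + 1) * (b n / ((n : ℝ) + 1))) = M * b n := by field_simp
      rw [h4] at h1
      have h5 : ‖ζ‖ * ‖∑' k : ℕ, ((a (n + k + 1) - a (n + k) : ℝ) : ℂ) * ζ ^ (n + k)‖ ≤
          1 * (M * b n) := by gcongr
      linarith
    rw [← hnorm] at hR
    set X := ‖∑' k : ℕ, (a (n + k) : ℂ) * ζ ^ (n + k)‖
    have hX : 0 ≤ X := norm_nonneg _
    calc X ≤ 2 * (((n : ℝ) + 1) * ‖1 - ζ‖) * X := le_mul_of_one_le_left hX hn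
      _ = 2 * ((n : ℝ) + 1) * (‖1 - ζ‖ * X) := by ring
      _ ≤ 2 * ((n : ℝ) + 1) * ((K + M) * b n) := by gcongr
      _ = _ := by ring


/-! ### Pointwise size of power series with model coefficients -/

/-- The sequence `ψ(1 - 1 / (k + 1)) / (k + 1)`. -/
noncomputable def coeffModel (ψ : ℝ → ℝ) (k : ℕ) : ℝ :=
  ψ (1 - 1 / ((k : ℝ) + 1)) / ((k : ℝ) + 1)

theorem one_sub_inv_mem (k : ℕ) : 1 - 1 / ((k : ℝ) + 1) ∈ Ico (0 : ℝ) 1 := by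
  have h : (0 : ℝ) < (k : ℝ) + 1 := by positivity
  have h1 : 1 / ((k : ℝ) + 1) ≤ 1 := by
    rw [div_le_one h]; linarith [k.cast_nonneg (α := ℝ)]
  have h2 : 0 < 1 / ((k : ℝ) + 1) := by positivity
  exact ⟨by linarith, by linarith⟩

theorem one_sub_inv_le {k n : ℕ} (h : k ≤ n) :
    1 - 1 / ((k : ℝ) + 1) ≤ 1 - 1 / ((n : ℝ) + 1) := by
  have : (k : ℝ) ≤ n := by exact_mod_cast h
  gcongr

theorem one_sub_inv_succ_le (k : ℕ) :
    1 - 1 / (((k + 1 : ℕ) : ℝ) + 1) ≤ (1 + (1 - 1 / ((k : ℝ) + 1))) / 2 := by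
  have : 1 / (2 * ((k : ℝ) + 1)) ≤ 1 / (((k + 1 : ℕ) : ℝ) + 1) := by
    gcongr; push_cast; linarith [k.cast_nonneg (α := ℝ)]
  have h2 : 1 / (2 * ((k : ℝ) + 1)) = 1 / ((k : ℝ) + 1) / 2 := by field_simp
  linarith

namespace IsDoubling

variable {ψ : ℝ → ℝ} {C : ℝ}

theorem coeffModel_pos (h : IsDoubling ψ C) (k : ℕ) : 0 < coeffModel ψ k :=
  div_pos (h.pos _ (one_sub_inv_mem k)) (by positivity)

theorem isModerate_coeffModel (h : IsDoubling ψ C) : IsModerate (coeffModel ψ) := by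
  refine ⟨h.coeffModel_pos, C, fun n => ?_⟩
  have h1 := h.le_mul _ _ (one_sub_inv_mem n).1 (one_sub_inv_le (Nat.le_succ n))
    (one_sub_inv_succ_le n) (one_sub_inv_mem n).2
  have := h.pos _ (one_sub_inv_mem n)
  have := h.pos _ (one_sub_inv_mem (n + 1))
  have := h.one_le
  calc coeffModel ψ (n + 1) ≤ C * ψ (1 - 1 / ((n : ℝ) + 1)) / ((n : ℝ) + 1) := by
        unfold coeffModel
        gcongr
        linarith
    _ = C * coeffModel ψ n := by unfold coeffModel; ring

/-- If ψ grows with exponent A in the inverse distance to 1, the model coefficients grow at most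
with exponent A-1, so finitely many differences force inverse-square decay. -/
theorem exists_isTempered (h : IsDoubling ψ C) : ∃ m, IsTempered m (coeffModel ψ) := by
  obtain ⟨A, hA⟩ := exists_growth_of_doubling h.one_le (fun t ht => (h.pos t ht).le) h.le_mul
  have hC := h.one_le
  refine ⟨A + 2, C, by positivity, fun n k hnk => ?_⟩
  have h1 := hA _ _ (one_sub_inv_mem n).1 (one_sub_inv_le hnk) (one_sub_inv_mem k).2
  have hn : (0 : ℝ) < (n : ℝ) + 1 := by positivity
  have hk : (0 : ℝ) < (k : ℝ) + 1 := by positivity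
  have h2 : (1 - (1 - 1 / ((n : ℝ) + 1))) / (1 - (1 - 1 / ((k : ℝ) + 1))) =
      ((k : ℝ) + 1) / ((n : ℝ) + 1) := by
    rw [sub_sub_cancel, sub_sub_cancel]; field_simp
  rw [h2] at h1
  have hnk' : ((n : ℝ) + 1) ≤ (k : ℝ) + 1 := by
    have : (n : ℝ) ≤ k := by exact_mod_cast hnk
    linarith
  have := h.pos _ (one_sub_inv_mem n)
  unfold coeffModel
  calc _ ≤ (C * (((k : ℝ) + 1) / ((n : ℝ) + 1)) ^ A * ψ (1 - 1 / ((n : ℝ) + 1))) / ((k : ℝ) + 1) *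
        ((k : ℝ) + 1) ^ 2 * ((n : ℝ) + 1) ^ (A + 2) := by gcongr
    _ = C * ψ (1 - 1 / ((n : ℝ) + 1)) * (((k : ℝ) + 1) ^ (A + 1)) * ((n : ℝ) + 1) ^ 2 := by
        generalize ψ (1 - 1 / ((n : ℝ) + 1)) = y
        rw [div_pow, pow_add _ A 2, pow_succ _ A]; field_simp
    _ ≤ C * ψ (1 - 1 / ((n : ℝ) + 1)) * (((k : ℝ) + 1) ^ (A + 1) *
        (((k : ℝ) + 1) / ((n : ℝ) + 1))) * ((n : ℝ) + 1) ^ 2 := by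
        gcongr
        refine le_mul_of_one_le_right (by positivity) ?_
        rwa [one_le_div hn]
    _ = _ := by
        generalize ψ (1 - 1 / ((n : ℝ) + 1)) = y
        rw [pow_add _ A 2, pow_succ _ A]; field_simp

/-- Between consecutive nodes 1-s is comparable to 1/(k+1) and the length is 1/((k+1)(k+2)), so the
integral of ψ/(1-s) is comparable to a single model coefficient. Summed up, this makes
`logPrimitive` the continuous form of the partial sums. -/
theorem sub_le_and_le_sub (h : IsDoubling ψ C) (k : ℕ) :
    coeffModel ψ (k + 1) ≤ C * (logPrimitive ψ (1 - 1 / (((k + 1 : ℕ) : ℝ) + 1)) -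
        logPrimitive ψ (1 - 1 / ((k : ℝ) + 1))) ∧
      logPrimitive ψ (1 - 1 / (((k + 1 : ℕ) : ℝ) + 1)) - logPrimitive ψ (1 - 1 / ((k : ℝ) + 1)) ≤
        C * coeffModel ψ k := by
  have hC := h.one_le
  have hle := one_sub_inv_le (Nat.le_succ k)
  have hm0 := one_sub_inv_mem k
  have hm1 := one_sub_inv_mem (k + 1)
  have hd := one_sub_inv_succ_le k
  have hi := h.intervalIntegrable_div hm0 hm1
  have hp1 := h.pos _ hm1
  have hp0 := h.pos _ hm0
  have hlen : 1 - 1 / (((k + 1 : ℕ) : ℝ) + 1) - (1 - 1 / ((k : ℝ) + 1)) =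
      1 / (((k : ℝ) + 1) * ((k : ℝ) + 2)) := by
    push_cast; field_simp; ring
  rw [h.logPrimitive_sub hm0 hm1]
  constructor
  · have h3 : ∫ s in (1 - 1 / ((k : ℝ) + 1))..(1 - 1 / (((k + 1 : ℕ) : ℝ) + 1)),
        (ψ (1 - 1 / (((k + 1 : ℕ) : ℝ) + 1)) / C) / (1 / ((k : ℝ) + 1)) ≤
        ∫ s in (1 - 1 / ((k : ℝ) + 1))..(1 - 1 / (((k + 1 : ℕ) : ℝ) + 1)), ψ s / (1 - s) := by
      refine intervalIntegral.integral_mono_on hle (by simp) hi fun s hs => ?_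
      have hs1 : s < 1 := hs.2.trans_lt hm1.2
      have h4 := h.le_mul s _ (hm0.1.trans hs.1) hs.2 (by linarith [hs.1]) hs1
      have h5 := h.pos s ⟨hm0.1.trans hs.1, hs1⟩
      have h6 : ψ (1 - 1 / (((k + 1 : ℕ) : ℝ) + 1)) / C ≤ ψ s := by
        rwa [div_le_iff₀' (by positivity)]
      have h7 : 0 < 1 - s := sub_pos.2 hs1
      have h8 : 1 - s ≤ 1 / ((k : ℝ) + 1) := by linarith [hs.1]
      gcongr
    rw [intervalIntegral.integral_const, smul_eq_mul, hlen] at h3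
    refine le_trans (le_of_eq ?_) (mul_le_mul_of_nonneg_left h3 (by positivity))
    unfold coeffModel
    push_cast
    field_simp
    ring
  · have h3 : ∫ s in (1 - 1 / ((k : ℝ) + 1))..(1 - 1 / (((k + 1 : ℕ) : ℝ) + 1)), ψ s / (1 - s) ≤
        ∫ s in (1 - 1 / ((k : ℝ) + 1))..(1 - 1 / (((k + 1 : ℕ) : ℝ) + 1)),
        (C * ψ (1 - 1 / ((k : ℝ) + 1))) / (1 / (((k + 1 : ℕ) : ℝ) + 1)) := by
      refine intervalIntegral.integral_mono_on hle hi (by simp) fun s hs => ?_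
      have h4 := h.le_mul _ s hm0.1 hs.1 (by linarith [hs.2]) hm0.2
      gcongr
      linarith [hs.2]
    rw [intervalIntegral.integral_const, smul_eq_mul, hlen] at h3
    refine h3.trans (le_of_eq ?_)
    unfold coeffModel
    push_cast
    field_simp
    ring

theorem sum_coeffModel_le (h : IsDoubling ψ C) :
    ∃ K : ℝ, 0 < K ∧ ∀ n : ℕ, ∑ k ∈ Finset.range (n + 1), coeffModel ψ k ≤
      K * logPrimitive ψ (1 - 1 / ((n : ℝ) + 1)) := by
  have hC := h.one_le
  have h0 := h.pos 0 ⟨le_rfl, one_pos⟩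
  refine ⟨C + ψ 0, by positivity, fun n => ?_⟩
  induction n with
  | zero =>
    simp [coeffModel, logPrimitive]
    linarith
  | succ n ih =>
    rw [Finset.sum_range_succ]
    have h1 := (h.sub_le_and_le_sub n).1
    have h2 := h.logPrimitive_mono (one_sub_inv_mem n) (one_sub_inv_mem (n + 1))
      (one_sub_inv_le (Nat.le_succ n))
    nlinarith [mul_nonneg h0.le (sub_nonneg.2 h2)]

theorem logPrimitive_le_sum (h : IsDoubling ψ C) (n : ℕ) :
    logPrimitive ψ (1 - 1 / ((n : ℝ) + 1)) ≤ 1 + C * ∑ k ∈ Finset.range n, coeffModel ψ k := by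
  induction n with
  | zero => simp [logPrimitive]
  | succ n ih =>
    rw [Finset.sum_range_succ]
    have h1 := (h.sub_le_and_le_sub n).2
    linarith

end IsDoubling

/-- Coefficients comparable to `coeffModel ψ`, shifted by one, with symbol-type regularity. -/
structure IsKernelCoeff (ψ : ℝ → ℝ) (c : ℕ → ℝ) : Prop where
  zero_pos : 0 < c 0
  lower : ∃ δ : ℝ, 0 < δ ∧ ∀ k, δ * coeffModel ψ k ≤ c (k + 1)
  isSymbol : ∀ m, IsSymbol m (coeffModel ψ) fun k => c (k + 1)

namespace IsKernelCoeff

variable {ψ : ℝ → ℝ} {C : ℝ} {c : ℕ → ℝ}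

theorem isPolyBounded_shift (hc : IsKernelCoeff ψ c) (h : IsDoubling ψ C) :
    IsPolyBounded fun k => c (k + 1) := by
  obtain ⟨m, hm⟩ := h.exists_isTempered
  exact hm.isPolyBounded h.coeffModel_pos (hc.isSymbol 0).bound

theorem isPolyBounded (hc : IsKernelCoeff ψ c) (h : IsDoubling ψ C) : IsPolyBounded c := by
  obtain ⟨K, B, hK⟩ := hc.isPolyBounded_shift h
  have hK0 : 0 ≤ K := by have := (abs_nonneg _).trans (hK 0); simpa using this
  refine ⟨K + |c 0|, B, fun n => ?_⟩
  have h1 : ∀ x : ℕ, (1 : ℝ) ≤ ((x : ℝ) + 1) ^ B := fun x =>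
    one_le_pow₀ (by linarith [x.cast_nonneg (α := ℝ)])
  cases n with
  | zero =>
    refine le_trans (by linarith) (le_mul_of_one_le_right (by positivity) (h1 0))
  | succ n =>
    refine (hK n).trans ?_
    gcongr
    · linarith [abs_nonneg (c 0)]
    · linarith

theorem powerSum_eq (hc : IsKernelCoeff ψ c) (h : IsDoubling ψ C) {ζ : ℂ} (hζ : ‖ζ‖ < 1) :
    powerSum c ζ = c 0 + ζ * powerSum (fun k => c (k + 1)) ζ := by
  unfold powerSum
  rw [((hc.isPolyBounded h).summable hζ).tsum_eq_zero_add, ← tsum_mul_left]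
  simp only [pow_zero, mul_one]
  congr 1
  refine tsum_congr fun k => ?_
  rw [pow_succ]; ring

/-- The head, up to about 1/|1-ζ|, is at most a partial sum of model coefficients. The tail is at
most (n+1)·`coeffModel ψ n`, which is a value of ψ and hence also dominated by `logPrimitive`. -/
theorem norm_powerSum_le (hc : IsKernelCoeff ψ c) (h : IsDoubling ψ C) :
    ∃ K : ℝ, 0 < K ∧ ∀ ζ : ℂ, ‖ζ‖ < 1 →
      ‖powerSum c ζ‖ ≤ K * logPrimitive ψ (1 - min 1 ‖1 - ζ‖) := by
  obtain ⟨m, hm⟩ := h.exists_isTempered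
  obtain ⟨K₁, hK₁0, hK₁⟩ := norm_tail_le m h.coeffModel_pos (hc.isSymbol m) hm
  obtain ⟨K₂, hK₂0, hK₂⟩ := (hc.isSymbol 0).bound_pos h.coeffModel_pos
  obtain ⟨K₃, hK₃0, hK₃⟩ := h.sum_coeffModel_le
  obtain ⟨K₄, hK₄0, hK₄⟩ := h.le_logPrimitive
  refine ⟨c 0 + (K₂ * K₃ + K₁ * K₄), by have := hc.zero_pos; positivity, fun ζ hζ => ?_⟩
  set x := min 1 ‖1 - ζ‖ with hx
  have hne : ζ ≠ 1 := by rintro rfl; simp at hζ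
  have hx0 : 0 < x := lt_min one_pos (norm_pos_iff.2 (sub_ne_zero.2 hne.symm))
  have hx1 : x ≤ 1 := min_le_left _ _
  have hxm : 1 - x ∈ Ico (0 : ℝ) 1 := ⟨by linarith, by linarith⟩
  -- The cut satisfies n+1 ≤ 1/x < n+2 ≤ 2(n+1): the first inequality places the node 1-1/(n+1)
  -- below 1-x, the others give the hypothesis of `norm_tail_le`.
  obtain ⟨n, hn⟩ : ∃ n : ℕ, ⌊1 / x⌋₊ = n + 1 := by
    refine Nat.exists_eq_succ_of_ne_zero (Nat.floor_pos.2 ?_).ne'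
    rwa [one_le_div hx0]
  have hn1 : ((n : ℝ) + 1) ≤ 1 / x := by
    have := Nat.floor_le (show 0 ≤ 1 / x by positivity)
    rw [hn] at this; exact_mod_cast this
  have hn2 : 1 / x < (n : ℝ) + 2 := by
    have := Nat.lt_floor_add_one (1 / x)
    rw [hn] at this; push_cast at this; linarith
  have hle : 1 - 1 / ((n : ℝ) + 1) ≤ 1 - x := by
    have : x ≤ 1 / ((n : ℝ) + 1) := by
      rw [le_div_iff₀ (by positivity)]; rw [le_div_iff₀ hx0] at hn1; linarith
    linarith
  have hS := h.logPrimitive_mono (one_sub_inv_mem n) hxm hle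
  have hS1 := h.one_le_logPrimitive hxm
  have hcond : 1 ≤ 2 * (((n : ℝ) + 1) * ‖1 - ζ‖) := by
    rw [div_lt_iff₀ hx0] at hn2
    have hxle : x ≤ ‖1 - ζ‖ := min_le_right _ _
    have : ((n : ℝ) + 1) * x ≤ ((n : ℝ) + 1) * ‖1 - ζ‖ := by gcongr
    nlinarith [mul_nonneg (n.cast_nonneg (α := ℝ)) hx0.le]
  have htail := hK₁ ζ n hζ hcond
  have hsum := (hc.isPolyBounded_shift h).summable hζ
  have hsplit : powerSum (fun k => c (k + 1)) ζ =
      ∑ k ∈ Finset.range n, (c (k + 1) : ℂ) * ζ ^ k +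
        ∑' k : ℕ, (c (n + k + 1) : ℂ) * ζ ^ (n + k) := by
    unfold powerSum
    rw [← hsum.sum_add_tsum_nat_add n]
    congr 1
    refine tsum_congr fun k => ?_
    rw [add_comm k n]
  have hhead : ‖∑ k ∈ Finset.range n, (c (k + 1) : ℂ) * ζ ^ k‖ ≤
      K₂ * K₃ * logPrimitive ψ (1 - x) := by
    calc _ ≤ ∑ k ∈ Finset.range n, K₂ * coeffModel ψ k := by
          refine norm_sum_le_of_le _ fun k _ => ?_
          rw [norm_mul, norm_pow, Complex.norm_real, Real.norm_eq_abs]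
          refine (mul_le_of_le_one_right (abs_nonneg _)
            (pow_le_one₀ (norm_nonneg _) hζ.le)).trans (hK₂ k)
      _ = K₂ * ∑ k ∈ Finset.range n, coeffModel ψ k := by rw [Finset.mul_sum]
      _ ≤ K₂ * ∑ k ∈ Finset.range (n + 1), coeffModel ψ k := by
          gcongr ?_ * ?_
          rw [Finset.sum_range_succ]
          linarith [h.coeffModel_pos n]
      _ ≤ K₂ * (K₃ * logPrimitive ψ (1 - 1 / ((n : ℝ) + 1))) := by
          gcongr
          exact hK₃ n
      _ ≤ K₂ * (K₃ * logPrimitive ψ (1 - x)) := by gcongr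
      _ = _ := by ring
  have htail2 : ‖∑' k : ℕ, (c (n + k + 1) : ℂ) * ζ ^ (n + k)‖ ≤
      K₁ * K₄ * logPrimitive ψ (1 - x) := by
    refine htail.trans ?_
    have : ((n : ℝ) + 1) * coeffModel ψ n = ψ (1 - 1 / ((n : ℝ) + 1)) := by
      unfold coeffModel; field_simp
    rw [this]
    have := hK₄ _ (one_sub_inv_mem n)
    calc K₁ * ψ (1 - 1 / ((n : ℝ) + 1)) ≤ K₁ * (K₄ * logPrimitive ψ (1 - x)) := by
          gcongr
          exact this.trans (by gcongr)
      _ = _ := by ring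
  rw [hc.powerSum_eq h hζ]
  calc ‖(c 0 : ℂ) + ζ * powerSum (fun k => c (k + 1)) ζ‖
      ≤ ‖(c 0 : ℂ)‖ + ‖ζ‖ * ‖powerSum (fun k => c (k + 1)) ζ‖ := by
        rw [← norm_mul]; exact norm_add_le _ _
    _ ≤ c 0 * 1 + 1 * (K₂ * K₃ * logPrimitive ψ (1 - x) + K₁ * K₄ * logPrimitive ψ (1 - x)) := by
        rw [Complex.norm_real, Real.norm_of_nonneg hc.zero_pos.le, mul_one]
        gcongr
        rw [hsplit]
        exact (norm_add_le _ _).trans (add_le_add hhead htail2)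
    _ ≤ c 0 * logPrimitive ψ (1 - x) +
        1 * (K₂ * K₃ * logPrimitive ψ (1 - x) + K₁ * K₄ * logPrimitive ψ (1 - x)) := by
        have := hc.zero_pos
        gcongr
    _ = _ := by ring

/-- At a real point all terms are nonnegative and t^k stays above e^(-2) for k ≤ 1/(1-t), t ≥ 1/2,
so the sum dominates the corresponding partial sum of coefficients. -/
theorem logPrimitive_le_norm_powerSum (hc : IsKernelCoeff ψ c) (h : IsDoubling ψ C) :
    ∃ K : ℝ, 0 < K ∧ ∀ t ∈ Ico (0 : ℝ) 1, logPrimitive ψ t ≤ K * ‖powerSum c t‖ := by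
  obtain ⟨δ, hδ, hlow⟩ := hc.lower
  have hc0 := hc.zero_pos
  have hC := h.one_le
  have hpos : ∀ k, 0 < c (k + 1) := fun k => (mul_pos hδ (h.coeffModel_pos k)).trans_le (hlow k)
  have hS2 := h.one_le_logPrimitive (t := 1 / 2) ⟨by norm_num, by norm_num⟩
  refine ⟨(1 + C * (Real.exp 2 / δ) * c 0 + logPrimitive ψ (1 / 2)) / c 0, by positivity,
    fun t ht => ?_⟩
  have htn : ‖(t : ℂ)‖ < 1 := by rw [Complex.norm_real, Real.norm_of_nonneg ht.1]; exact ht.2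
  have hreal : powerSum c t = ((∑' n, c n * t ^ n : ℝ) : ℂ) := by
    unfold powerSum; push_cast; rfl
  have hsumR : Summable fun n => c n * t ^ n := by
    have := (hc.isPolyBounded h).summable htn
    rw [← Complex.summable_ofReal]; push_cast; exact this
  have hcnn : ∀ n, 0 ≤ c n * t ^ n := fun n => by
    have := ht.1
    cases n with
    | zero => simpa using hc0.le
    | succ n => have := (hpos n).le; positivity
  have hpart : ∀ n : ℕ, c 0 + ∑ k ∈ Finset.range n, c (k + 1) * t ^ (k + 1) ≤
      ‖powerSum c t‖ := by
    intro n
    rw [hreal, Complex.norm_real, Real.norm_of_nonneg (tsum_nonneg hcnn)]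
    refine le_trans (le_of_eq ?_) (hsumR.sum_le_tsum (Finset.range (n + 1)) fun k _ => hcnn k)
    rw [Finset.sum_range_succ']; simp [add_comm]
  have hc0le : c 0 ≤ ‖powerSum c t‖ := by simpa using hpart 0
  rcases le_total t (1 / 2) with h2 | h2
  · have h3 := h.logPrimitive_mono ht ⟨by norm_num, by norm_num⟩ h2
    rw [div_mul_eq_mul_div, le_div_iff₀ hc0]
    have : 0 ≤ 1 + C * (Real.exp 2 / δ) * c 0 := by positivity
    calc logPrimitive ψ t * c 0 ≤ logPrimitive ψ (1 / 2) * ‖powerSum c t‖ := by gcongr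
      _ ≤ _ := by gcongr; linarith
  · have h1t : 0 < 1 - t := sub_pos.2 ht.2
    set n := ⌊1 / (1 - t)⌋₊ with hn
    have hn1 : (n : ℝ) * (1 - t) ≤ 1 := by
      have := Nat.floor_le (show 0 ≤ 1 / (1 - t) by positivity)
      rwa [le_div_iff₀ h1t] at this
    have hn2 : 1 < ((n : ℝ) + 1) * (1 - t) := by
      have := Nat.lt_floor_add_one (1 / (1 - t))
      rwa [div_lt_iff₀ h1t] at this
    have htle : t ≤ 1 - 1 / ((n : ℝ) + 1) := by
      have : 1 / ((n : ℝ) + 1) ≤ 1 - t := by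
        rw [div_le_iff₀ (by positivity)]; linarith
      linarith
    have hS := (h.logPrimitive_mono ht (one_sub_inv_mem n) htle).trans (h.logPrimitive_le_sum n)
    -- For t ≥ 1/2, log t ≥ 1 - 1/t ≥ -2(1-t), and n(1-t) ≤ 1.
    have hexp : Real.exp (-2) ≤ t ^ n := by
      have ht0 : 0 < t := by linarith
      have h4 := Real.one_sub_inv_le_log_of_pos ht0
      rw [← Real.exp_log ht0, ← Real.exp_nat_mul]
      refine Real.exp_le_exp.2 ?_
      have h5 : -(2 * (1 - t)) ≤ 1 - t⁻¹ := by
        have : t⁻¹ ≤ 2 := by rw [inv_le_comm₀ ht0 (by norm_num)]; linarith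
        have h6 : 1 - t⁻¹ = -((1 - t) * t⁻¹) := by field_simp; ring
        rw [h6]; nlinarith
      have h7 : (n : ℝ) * (-(2 * (1 - t))) ≤ n * Real.log t := by gcongr; linarith
      linarith
    have hsum2 : ∑ k ∈ Finset.range n, coeffModel ψ k ≤
        Real.exp 2 / δ * ∑ k ∈ Finset.range n, c (k + 1) * t ^ (k + 1) := by
      rw [Finset.mul_sum]
      refine Finset.sum_le_sum fun k hk => ?_
      have hk' : k + 1 ≤ n := Finset.mem_range.1 hk
      have h8 : Real.exp (-2) ≤ t ^ (k + 1) := hexp.trans (pow_le_pow_of_le_one ht.1 ht.2.le hk')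
      have h9 := h.coeffModel_pos k
      calc coeffModel ψ k = Real.exp 2 / δ * ((δ * coeffModel ψ k) * Real.exp (-2)) := by
            rw [Real.exp_neg]; field_simp
        _ ≤ _ := by
            have := (hpos k).le
            gcongr
            exact hlow k
    have hp := hpart n
    have hfin : logPrimitive ψ t ≤ 1 + C * (Real.exp 2 / δ) * ‖powerSum c t‖ := by
      have : ∑ k ∈ Finset.range n, c (k + 1) * t ^ (k + 1) ≤ ‖powerSum c t‖ := by linarith
      calc logPrimitive ψ t ≤ 1 + C * ∑ k ∈ Finset.range n, coeffModel ψ k := hS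
        _ ≤ 1 + C * (Real.exp 2 / δ * ‖powerSum c t‖) := by
            gcongr; exact hsum2.trans (by gcongr)
        _ = _ := by ring
    refine hfin.trans ?_
    rw [div_mul_eq_mul_div, le_div_iff₀ hc0]
    have : 0 ≤ logPrimitive ψ (1 / 2) * ‖powerSum c t‖ := by positivity
    nlinarith

end IsKernelCoeff


/-! ### Circle means: the upper estimate -/

open Real (pi_pos circleAverage)

theorem IsPolyBounded.deriv {c : ℕ → ℝ} (hc : IsPolyBounded c) :
    IsPolyBounded fun n => ((n : ℝ) + 1) * c (n + 1) := by
  obtain ⟨K, B, hK⟩ := hc.shift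
  refine ⟨K, B + 1, fun n => ?_⟩
  rw [abs_mul, abs_of_nonneg (by positivity : (0 : ℝ) ≤ (n : ℝ) + 1), pow_succ]
  calc ((n : ℝ) + 1) * |c (n + 1)| ≤ ((n : ℝ) + 1) * (K * ((n : ℝ) + 1) ^ B) := by
        gcongr; exact hK n
    _ = _ := by ring

theorem IsPolyBounded.hasDerivAt {c : ℕ → ℝ} (hc : IsPolyBounded c) {ζ : ℂ} (hζ : ‖ζ‖ < 1) :
    HasDerivAt (powerSum c) (powerSum (fun n => ((n : ℝ) + 1) * c (n + 1)) ζ) ζ := by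
  obtain ⟨ρ, hρ1, hρ2⟩ := exists_between hζ
  have hρ0 : 0 < ρ := (norm_nonneg ζ).trans_lt hρ1
  have hρn : ‖(ρ : ℂ)‖ < 1 := by rwa [Complex.norm_real, Real.norm_of_nonneg hρ0.le]
  have h1 := (hc.deriv.summable_norm hρn)
  have hu : Summable fun n : ℕ => ‖(c n : ℂ) * (n * (ρ : ℂ) ^ (n - 1))‖ := by
    rw [← summable_nat_add_iff 1]
    refine h1.congr fun n => ?_
    congr 1
    rw [Nat.add_sub_cancel]
    push_cast
    ring
  have h2 := hasDerivAt_tsum_of_isPreconnected (g := fun (n : ℕ) (y : ℂ) => (c n : ℂ) * y ^ n)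
    (g' := fun (n : ℕ) (y : ℂ) => (c n : ℂ) * (n * y ^ (n - 1))) hu
    (Metric.isOpen_ball (x := (0 : ℂ)) (ε := ρ)) (convex_ball (0 : ℂ) ρ).isPreconnected
    (fun n y _ => (hasDerivAt_pow n y).const_mul _)
    (fun n y hy => by
      rw [norm_mul, norm_mul, norm_mul, norm_mul, norm_pow, norm_pow, Complex.norm_real ρ,
        Real.norm_of_nonneg hρ0.le]
      rw [mem_ball_zero_iff] at hy
      gcongr)
    (mem_ball_zero_iff.2 hρ1) (hc.summable hζ) (mem_ball_zero_iff.2 hρ1)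
  refine h2.congr_deriv ?_
  have h3 : Summable fun n : ℕ => (c n : ℂ) * (n * ζ ^ (n - 1)) := by
    refine Summable.of_norm_bounded hu fun n => ?_
    rw [norm_mul, norm_mul, norm_mul, norm_mul, norm_pow, norm_pow, Complex.norm_real ρ,
        Real.norm_of_nonneg hρ0.le]
    gcongr
  rw [h3.tsum_eq_zero_add]
  unfold powerSum
  simp only [Nat.cast_zero, zero_mul, mul_zero, zero_add, add_tsub_cancel_right]
  refine tsum_congr fun n => ?_
  push_cast
  ring

theorem IsPolyBounded.differentiableOn {c : ℕ → ℝ} (hc : IsPolyBounded c) :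
    DifferentiableOn ℂ (powerSum c) (Metric.ball 0 1) := fun _ hζ =>
  (hc.hasDerivAt (mem_ball_zero_iff.1 hζ)).differentiableAt.differentiableWithinAt

theorem circleAverage_eq_symm {E : Type*} [NormedAddCommGroup E] [NormedSpace ℝ E] (f : ℂ → E)
    (u : ℝ) : circleAverage f 0 u = (2 * Real.pi)⁻¹ • ∫ θ in (-Real.pi)..Real.pi, f (circleMap 0 u θ) := by
  have hper : Function.Periodic (fun θ => f (circleMap 0 u θ)) (2 * Real.pi) := fun θ => by
    simp only [periodic_circleMap 0 u θ]
  have h := hper.intervalIntegral_add_eq 0 (-Real.pi)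
  rw [Real.circleAverage_def]
  rw [zero_add, show -Real.pi + 2 * Real.pi = Real.pi by ring] at h
  rw [h]

theorem integral_abs_div_pi {f : ℝ → ℝ} (hf : Continuous f) :
    ∫ θ in (-Real.pi)..Real.pi, f (|θ| / Real.pi) = 2 * Real.pi * ∫ y in (0 : ℝ)..1, f y := by
  have hc : Continuous fun θ : ℝ => f (|θ| / Real.pi) := by fun_prop
  have h1 : ∫ θ in (0 : ℝ)..Real.pi, f (|θ| / Real.pi) = Real.pi * ∫ y in (0 : ℝ)..1, f y := by
    have h2 : ∫ θ in (0 : ℝ)..Real.pi, f (|θ| / Real.pi) =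
        ∫ θ in (0 : ℝ)..Real.pi, f (θ / Real.pi) := by
      refine intervalIntegral.integral_congr fun θ hθ => ?_
      rw [uIcc_of_le pi_pos.le] at hθ
      simp only [abs_of_nonneg hθ.1]
    rw [h2, intervalIntegral.integral_comp_div _ pi_pos.ne', smul_eq_mul, zero_div,
      div_self pi_pos.ne']
  have h3 : ∫ θ in (-Real.pi)..0, f (|θ| / Real.pi) = ∫ θ in (0 : ℝ)..Real.pi, f (|θ| / Real.pi) := by
    have := intervalIntegral.integral_comp_neg (a := 0) (b := Real.pi)
      fun θ : ℝ => f (|θ| / Real.pi)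
    simp only [abs_neg, neg_zero] at this
    exact this.symm
  rw [← intervalIntegral.integral_add_adjacent_intervals (b := 0) (hc.intervalIntegrable _ _)
    (hc.intervalIntegrable _ _), h3, h1]
  ring

theorem circleAverage_le_of_le {f : ℂ → ℝ} {g : ℝ → ℝ} {u : ℝ}
    (hf : Continuous fun θ => f (circleMap 0 u θ)) (hg : Continuous g)
    (h : ∀ θ ∈ Icc (-Real.pi) Real.pi, f (circleMap 0 u θ) ≤ g (|θ| / Real.pi)) :
    circleAverage f 0 u ≤ ∫ y in (0 : ℝ)..1, g y := by
  have hpi := pi_pos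
  rw [circleAverage_eq_symm, smul_eq_mul]
  have h1 := intervalIntegral.integral_mono_on (by linarith) (hf.intervalIntegrable (μ := volume) _ _)
    ((by fun_prop : Continuous fun θ : ℝ => g (|θ| / Real.pi)).intervalIntegrable _ _) h
  rw [integral_abs_div_pi hg] at h1
  calc _ ≤ (2 * Real.pi)⁻¹ * (2 * Real.pi * ∫ y in (0 : ℝ)..1, g y) := by gcongr
    _ = _ := by field_simp

theorem norm_circleAverage_le (f : ℂ → ℂ) (u : ℝ) :
    ‖circleAverage f 0 u‖ ≤ circleAverage (fun z => ‖f z‖) 0 u := by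
  have hpi := pi_pos
  rw [Real.circleAverage_def, Real.circleAverage_def, norm_smul, smul_eq_mul,
    Real.norm_of_nonneg (by positivity)]
  gcongr
  exact intervalIntegral.norm_integral_le_integral_norm (by positivity)

theorem one_sub_le_norm_one_sub {u : ℝ} (hu : 0 ≤ u) (θ : ℝ) :
    1 - u ≤ ‖1 - circleMap 0 u θ‖ := by
  have := norm_sub_norm_le (1 : ℂ) (circleMap 0 u θ)
  simpa [norm_circleMap_zero, abs_of_nonneg hu] using this

/-- Jordan's inequality gives 2|θ|/π ≤ |e^(iθ)-1|, and moving the point to radius u changes the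
distance by 1-u, itself at most |1-ue^(iθ)|. -/
theorem abs_div_pi_le_norm_one_sub {u : ℝ} (hu : u ∈ Ico (0 : ℝ) 1) {θ : ℝ}
    (hθ : θ ∈ Icc (-Real.pi) Real.pi) : |θ| / Real.pi ≤ ‖1 - circleMap 0 u θ‖ := by
  have hpi := pi_pos
  have h1 := one_sub_le_norm_one_sub hu.1 θ
  have h2 : 2 * (|θ| / Real.pi) ≤ ‖Complex.exp (Complex.I * θ) - 1‖ := by
    rw [Complex.norm_exp_I_mul_ofReal_sub_one, Real.norm_eq_abs, abs_mul, abs_two]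
    have := Real.mul_abs_le_abs_sin (x := θ / 2) (by
      rw [abs_div, abs_two]; gcongr; exact abs_le.2 hθ)
    rw [abs_div, abs_two] at this
    calc 2 * (|θ| / Real.pi) = 2 * (2 / Real.pi * (|θ| / 2)) := by field_simp
      _ ≤ _ := by gcongr
  have h3 : ‖Complex.exp (Complex.I * θ) - 1‖ ≤ ‖1 - circleMap 0 u θ‖ + (1 - u) := by
    have e : Complex.exp (Complex.I * θ) - 1 =
        -(1 - circleMap 0 u θ) + ((1 - u : ℝ) : ℂ) * Complex.exp (Complex.I * θ) := by
      rw [circleMap, mul_comm Complex.I]; push_cast; ring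
    rw [e]
    refine (norm_add_le _ _).trans ?_
    rw [norm_neg, norm_mul, Complex.norm_real, mul_comm Complex.I, Complex.norm_exp_ofReal_mul_I,
      Real.norm_of_nonneg (by linarith [hu.2]), mul_one]
  linarith

theorem circleMap_mem_disc {u : ℝ} (hu : u ∈ Ico (0 : ℝ) 1) (θ : ℝ) : ‖circleMap 0 u θ‖ < 1 := by
  rw [norm_circleMap_zero, abs_of_nonneg hu.1]; exact hu.2

theorem continuous_powerSum_circleMap {c : ℕ → ℝ} (hc : IsPolyBounded c) {u : ℝ}
    (hu : u ∈ Ico (0 : ℝ) 1) : Continuous fun θ => powerSum c (circleMap 0 u θ) :=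
  hc.differentiableOn.continuousOn.comp_continuous (continuous_circleMap 0 u) fun θ =>
    mem_ball_zero_iff.2 (circleMap_mem_disc hu θ)

namespace IsKernelCoeff

variable {ψ : ℝ → ℝ} {C : ℝ} {c : ℕ → ℝ}

/-- Since |1-ue^(iθ)| exceeds both 1-u and |θ|/π, the pointwise bound is K·S(min(u, 1-|θ|/π)). Its
p-th power integrates to exactly the left side of `hardy`. -/
theorem circleAverage_le (hc : IsKernelCoeff ψ c) (h : IsDoubling ψ C) {p : ℝ} (hp : 0 < p) :
    ∃ K : ℝ, 0 < K ∧ ∀ u ∈ Ico (0 : ℝ) 1,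
      circleAverage (fun z => ‖powerSum c z‖ ^ p) 0 u ≤ K * (1 + ∫ t in (0 : ℝ)..u, ψ t ^ p) := by
  obtain ⟨K, hK0, hK⟩ := hc.norm_powerSum_le h
  obtain ⟨M, hM0, hM⟩ := h.hardy hp
  refine ⟨K ^ p * M, by positivity, fun u hu => ?_⟩
  have hz : (0 : ℝ) ∈ Ico (0 : ℝ) 1 := ⟨le_rfl, one_pos⟩
  have hTm : ∀ x : ℝ, max 0 (min u x) ∈ Ico (0 : ℝ) 1 := fun x =>
    ⟨le_max_left _ _, max_lt one_pos ((min_le_left _ _).trans_lt hu.2)⟩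
  -- Clamping the argument to [0,u] makes the majorant continuous on the whole line.
  set T : ℝ → ℝ := fun x => logPrimitive ψ (max 0 (min u x)) ^ p with hT
  have hTc : Continuous T :=
    (h.continuousOn_logPrimitive_rpow p).comp_continuous (by fun_prop) hTm
  have hcont := continuous_powerSum_circleMap (hc.isPolyBounded h) hu
  have h1 : circleAverage (fun z => ‖powerSum c z‖ ^ p) 0 u ≤
      ∫ y in (0 : ℝ)..1, K ^ p * T (1 - y) := by
    refine circleAverage_le_of_le (g := fun y => K ^ p * T (1 - y))
      (hcont.norm.rpow_const fun _ => Or.inr hp.le) (by fun_prop) fun θ hθ => ?_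
    have hpi := pi_pos
    have h2 := hK _ (circleMap_mem_disc hu θ)
    have h3 := one_sub_le_norm_one_sub hu.1 θ
    have h4 := abs_div_pi_le_norm_one_sub hu hθ
    have h5 : |θ| / Real.pi ≤ 1 := by rw [div_le_one hpi]; exact abs_le.2 hθ
    have h6 : 0 ≤ |θ| / Real.pi := by positivity
    have h7 : 1 - min 1 ‖1 - circleMap 0 u θ‖ ≤ max 0 (min u (1 - |θ| / Real.pi)) := by
      refine le_max_of_le_right (le_min ?_ ?_)
      · have : 1 - u ≤ min 1 ‖1 - circleMap 0 u θ‖ := le_min (by linarith [hu.1]) h3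
        linarith
      · linarith [le_min h5 h4]
    have h8 : 1 - min 1 ‖1 - circleMap 0 u θ‖ ∈ Ico (0 : ℝ) 1 :=
      ⟨by linarith [min_le_left 1 ‖1 - circleMap 0 u θ‖], h7.trans_lt (hTm _).2⟩
    have h9 := h.logPrimitive_mono h8 (hTm _) h7
    have h10 := h.one_le_logPrimitive h8
    calc ‖powerSum c (circleMap 0 u θ)‖ ^ p
        ≤ (K * logPrimitive ψ (max 0 (min u (1 - |θ| / Real.pi)))) ^ p := by
          gcongr
          exact h2.trans (by gcongr)
      _ = K ^ p * T (1 - |θ| / Real.pi) := by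
          rw [Real.mul_rpow hK0.le (by linarith)]
  refine h1.trans ?_
  rw [intervalIntegral.integral_const_mul, mul_assoc]
  gcongr
  refine le_trans (le_of_eq ?_) (hM u hu)
  rw [intervalIntegral.integral_comp_sub_left (fun y => T y), sub_self, sub_zero,
    ← intervalIntegral.integral_add_adjacent_intervals (b := u) (hTc.intervalIntegrable _ _)
      (hTc.intervalIntegrable _ _), add_comm]
  congr 1
  · have : ∫ x in u..1, T x = ∫ x in u..1, logPrimitive ψ u ^ p := by
      refine intervalIntegral.integral_congr fun x hx => ?_
      rw [uIcc_of_le hu.2.le] at hx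
      simp only [hT]
      rw [min_eq_left hx.1, max_eq_right hu.1]
    rw [this, intervalIntegral.integral_const, smul_eq_mul]
  · refine intervalIntegral.integral_congr fun x hx => ?_
    rw [uIcc_of_le hu.1] at hx
    simp only [hT]
    rw [min_eq_right hx.2, max_eq_right hx.1]

/-! ### Circle means: the lower estimate -/

/-- Cauchy's formula against a kernel localized at distance `h` from the boundary point `1`. -/
theorem norm_le_circleAverage_localized {F : ℂ → ℂ} (hF : DifferentiableOn ℂ F (Metric.ball 0 1))
    (m : ℕ) {u h : ℝ} (hu : u < 1) (hu2 : 1 / 2 < u) (hh : 2 * (1 - u) ≤ h) (hh1 : h ≤ 1) :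
    ‖F ((1 - h : ℝ) : ℂ)‖ ≤ 5 * 4 ^ (m + 1) *
      circleAverage (fun z => ‖1 - z‖ ^ m * h / (‖1 - z‖ + h) ^ (m + 2) * ‖F z‖) 0 u := by
  have hu0 : 0 < u := by linarith
  have hh0 : 0 < h := by linarith
  -- The multiplier is holomorphic in the disc (its pole is 1+h) and equals 2^(-(m+1)) at 1-h. Its
  -- zero of order m at 1 damps the points closer to 1 than h, where F may be large.
  set g : ℂ → ℂ := fun z => F z * ((1 - z) ^ m * h / ((1 - z) + h) ^ (m + 1)) with hg
  have hne : ∀ z : ℂ, ‖z‖ < 1 → (1 - z) + h ≠ 0 := by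
    intro z hz h0
    have h1 := congrArg Complex.re h0
    simp only [Complex.add_re, Complex.sub_re, Complex.one_re, Complex.ofReal_re,
      Complex.zero_re] at h1
    have := (Complex.re_le_norm z)
    linarith
  have hgd : DifferentiableOn ℂ g (Metric.ball 0 1) := by
    refine hF.mul (DifferentiableOn.div (by fun_prop) (by fun_prop) fun z hz => ?_)
    exact pow_ne_zero _ (hne z (mem_ball_zero_iff.1 hz))
  have hsub : Metric.closedBall (0 : ℂ) u ⊆ Metric.ball 0 1 := Metric.closedBall_subset_ball hu
  have hdc : DiffContOnCl ℂ g (Metric.ball 0 |u|) := by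
    rw [abs_of_pos hu0]
    exact (hgd.mono hsub).diffContOnCl_ball subset_rfl
  have ht : (((1 - h : ℝ) : ℂ)) ∈ Metric.ball (0 : ℂ) |u| := by
    rw [mem_ball_zero_iff, Complex.norm_real, abs_of_pos hu0,
      Real.norm_of_nonneg (by linarith)]
    linarith
  have hcauchy := hdc.circleAverage_smul_div ht
  have hgt : ‖g ((1 - h : ℝ) : ℂ)‖ = ‖F ((1 - h : ℝ) : ℂ)‖ / 2 ^ (m + 1) := by
    have e : (1 : ℂ) - ((1 - h : ℝ) : ℂ) = h := by push_cast; ring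
    simp only [hg, e]
    have e2 : (h : ℂ) ^ m * h / (h + h) ^ (m + 1) = ((1 / 2 ^ (m + 1) : ℝ) : ℂ) := by
      have : (h : ℂ) ≠ 0 := by exact_mod_cast hh0.ne'
      push_cast
      rw [← two_mul, mul_pow, ← pow_succ]
      field_simp
    rw [e2, norm_mul, Complex.norm_real, Real.norm_of_nonneg (by positivity)]
    ring
  have hsphere : ∀ z ∈ Metric.sphere (0 : ℂ) |u|, ‖z‖ = u := fun z hz => by
    rw [mem_sphere_zero_iff_norm, abs_of_pos hu0] at hz; exact hz
  have hη : ∀ z : ℂ, ‖z‖ < 1 → 0 < ‖1 - z‖ + h := fun z _ => by positivity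
  have hbound : ∀ z : ℂ, ‖z‖ = u → ‖((z - 0) / (z - ((1 - h : ℝ) : ℂ))) • g z‖ ≤
      5 * 2 ^ (m + 1) * (‖1 - z‖ ^ m * h / (‖1 - z‖ + h) ^ (m + 2) * ‖F z‖) := by
    intro z hz
    have hz1 : ‖z‖ < 1 := by linarith
    have hd1 : h / 2 ≤ ‖z - ((1 - h : ℝ) : ℂ)‖ := by
      have := norm_sub_norm_le z ((1 - h : ℝ) : ℂ)
      rw [Complex.norm_real, Real.norm_of_nonneg (by linarith), hz] at this
      linarith
    have hd2 : ‖1 - z‖ ≤ ‖z - ((1 - h : ℝ) : ℂ)‖ + h := by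
      have e : (1 : ℂ) - z = -(z - ((1 - h : ℝ) : ℂ)) + (h : ℂ) := by push_cast; ring
      rw [e]
      refine (norm_add_le _ _).trans ?_
      rw [norm_neg, Complex.norm_real, Real.norm_of_nonneg hh0.le]
    -- With d = |z-(1-h)|: |1-z| + h ≤ d + 2h ≤ 5d, as h ≤ 2d.
    have hd3 : (‖1 - z‖ + h) / 5 ≤ ‖z - ((1 - h : ℝ) : ℂ)‖ := by linarith
    have hd4 : (‖1 - z‖ + h) / 2 ≤ ‖(1 - z) + h‖ := by
      have hre : 0 ≤ (1 - z).re := by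
        have := Complex.re_le_norm z
        simp only [Complex.sub_re, Complex.one_re]
        linarith
      have h1 : ‖1 - z‖ ≤ ‖(1 - z) + h‖ := by
        rw [Complex.norm_def, Complex.norm_def]
        refine Real.sqrt_le_sqrt ?_
        simp only [Complex.normSq_apply, Complex.add_re, Complex.ofReal_re, Complex.add_im,
          Complex.ofReal_im, add_zero]
        nlinarith [mul_nonneg hre hh0.le]
      have h2 : h ≤ ‖(1 - z) + h‖ := by
        refine le_trans ?_ (Complex.re_le_norm _)
        simp only [Complex.add_re, Complex.ofReal_re]
        linarith
      linarith
    have hp := hη z hz1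
    rw [norm_smul, norm_div, sub_zero, hz]
    simp only [hg, norm_mul, norm_div, norm_pow, Complex.norm_real, Real.norm_of_nonneg hh0.le]
    calc u / ‖z - ((1 - h : ℝ) : ℂ)‖ * (‖F z‖ * (‖1 - z‖ ^ m * h / ‖1 - z + h‖ ^ (m + 1)))
        ≤ 1 / ((‖1 - z‖ + h) / 5) *
          (‖F z‖ * (‖1 - z‖ ^ m * h / ((‖1 - z‖ + h) / 2) ^ (m + 1))) := by gcongr
      _ = _ := by rw [div_pow, pow_succ _ (m + 1)]; field_simp
  have hFc : ContinuousOn F (Metric.sphere (0 : ℂ) |u|) :=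
    hF.continuousOn.mono fun z hz => mem_ball_zero_iff.2 (by rw [hsphere z hz]; exact hu)
  have hci : CircleIntegrable (fun z => ‖1 - z‖ ^ m * h / (‖1 - z‖ + h) ^ (m + 2) * ‖F z‖) 0 u := by
    refine ContinuousOn.circleIntegrable' ?_
    refine ContinuousOn.mul (ContinuousOn.div (by fun_prop) (by fun_prop) fun z hz => ?_) hFc.norm
    exact (pow_pos (hη z (by rw [hsphere z hz]; exact hu)) _).ne'
  have hci2 : CircleIntegrable (fun z => ‖((z - 0) / (z - ((1 - h : ℝ) : ℂ))) • g z‖) 0 u := by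
    have h1 : ContinuousOn (fun z : ℂ => z - 0) (Metric.sphere 0 |u|) := by fun_prop
    have h2 : ContinuousOn (fun z : ℂ => z - ((1 - h : ℝ) : ℂ)) (Metric.sphere 0 |u|) := by fun_prop
    have h3 : ContinuousOn g (Metric.sphere 0 |u|) :=
      hgd.continuousOn.mono fun z hz => mem_ball_zero_iff.2 (by rw [hsphere z hz]; exact hu)
    refine ContinuousOn.circleIntegrable' ((h1.div h2 fun z hz h0 => ?_).smul h3).norm
    rw [sub_eq_zero] at h0
    rw [h0] at hz
    have := hsphere _ hz
    rw [mem_ball_zero_iff, this, abs_of_pos hu0] at ht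
    exact lt_irrefl _ ht
  have hmain : ‖g ((1 - h : ℝ) : ℂ)‖ ≤ 5 * 2 ^ (m + 1) *
      circleAverage (fun z => ‖1 - z‖ ^ m * h / (‖1 - z‖ + h) ^ (m + 2) * ‖F z‖) 0 u := by
    rw [← hcauchy]
    refine (norm_circleAverage_le _ _).trans ?_
    rw [← smul_eq_mul, ← Real.circleAverage_fun_smul]
    exact Real.circleAverage_mono hci2 (hci.const_smul) fun z hz => hbound z (hsphere z hz)
  rw [hgt, div_le_iff₀ (by positivity)] at hmain
  refine hmain.trans (le_of_eq ?_)
  rw [show (4 : ℝ) = 2 * 2 by norm_num, mul_pow]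
  ring

end IsKernelCoeff


theorem circleAverage_mono_of_continuous {f g : ℂ → ℝ} {u : ℝ}
    (hf : ContinuousOn f (Metric.sphere 0 |u|)) (hg : ContinuousOn g (Metric.sphere 0 |u|))
    (h : ∀ z ∈ Metric.sphere (0 : ℂ) |u|, f z ≤ g z) :
    circleAverage f 0 u ≤ circleAverage g 0 u :=
  Real.circleAverage_mono hf.circleIntegrable' hg.circleIntegrable' h

theorem integral_poisson_le_one {h : ℝ} (hh : 0 < h) :
    ∫ y in (0 : ℝ)..1, h / (|y| + h) ^ 2 ≤ 1 := by
  have h1 : ∫ y in (0 : ℝ)..1, h / (|y| + h) ^ 2 = ∫ y in (0 : ℝ)..1, h / (y + h) ^ 2 := by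
    refine intervalIntegral.integral_congr fun y hy => ?_
    rw [uIcc_of_le zero_le_one] at hy
    simp only [abs_of_nonneg hy.1]
  have hne : ∀ y ∈ uIcc (0 : ℝ) 1, y + h ≠ 0 := fun y hy => by
    rw [uIcc_of_le zero_le_one] at hy
    linarith [hy.1]
  rw [h1, intervalIntegral.integral_eq_sub_of_hasDerivAt (f := fun y => -(h / (y + h)))]
  · have : 0 ≤ h / (1 + h) := by positivity
    rw [zero_add, div_self hh.ne']
    linarith
  · intro y hy
    have h2 := hne y hy
    have h3 := (((hasDerivAt_id y).add_const h).inv h2).const_mul (-h)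
    have e : (fun y => -(h / (y + h))) = fun y => -h * (y + h)⁻¹ := by
      ext y; ring
    rw [e]
    refine h3.congr_deriv ?_
    simp only [id]
    field_simp
  · refine ContinuousOn.intervalIntegrable (ContinuousOn.div (by fun_prop) (by fun_prop) ?_)
    exact fun y hy => pow_ne_zero _ (hne y hy)

/-- The same kernel with the two distances exchanged: here the localization parameter is integrated,
as needed after Fubini. -/
theorem integral_dual_poisson_le_one {η a : ℝ} (hη : 0 < η) (ha : 0 ≤ a) (ha1 : a ≤ 1) :
    ∫ h in a..1, η / (η + h) ^ 2 ≤ 1 := by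
  have hne : ∀ y ∈ uIcc a 1, η + y ≠ 0 := fun y hy => by
    rw [uIcc_of_le ha1] at hy
    linarith [hy.1]
  rw [intervalIntegral.integral_eq_sub_of_hasDerivAt (f := fun y => -(η / (η + y)))]
  · have h1 : 0 ≤ η / (η + 1) := by positivity
    have h2 : η / (η + a) ≤ 1 := by rw [div_le_one (by positivity)]; linarith
    linarith
  · intro y hy
    have h2 := hne y hy
    have h3 := (((hasDerivAt_id y).const_add η).inv h2).const_mul (-η)
    have e : (fun y => -(η / (η + y))) = fun y => -η * (η + y)⁻¹ := by
      ext y; ring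
    rw [e]
    refine h3.congr_deriv ?_
    simp only [id]
    field_simp
  · refine ContinuousOn.intervalIntegrable (ContinuousOn.div (by fun_prop) (by fun_prop) ?_)
    exact fun y hy => pow_ne_zero _ (hne y hy)

theorem circleAverage_poisson_le_one {u h : ℝ} (hu : u ∈ Ico (0 : ℝ) 1) (hh : 0 < h) :
    circleAverage (fun z => h / (‖1 - z‖ + h) ^ 2) 0 u ≤ 1 := by
  have hc : Continuous fun z : ℂ => h / (‖1 - z‖ + h) ^ 2 :=
    Continuous.div (by fun_prop) (by fun_prop) fun z => by positivity
  refine (circleAverage_le_of_le (g := fun y => h / (|y| + h) ^ 2)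
    (hc.comp (continuous_circleMap 0 u)) ?_ fun θ hθ => ?_).trans (integral_poisson_le_one hh)
  · exact Continuous.div (by fun_prop) (by fun_prop) fun z => by positivity
  · have h1 := abs_div_pi_le_norm_one_sub hu hθ
    have hpi := pi_pos
    have h2 : |(|θ| / Real.pi)| = |θ| / Real.pi := abs_of_nonneg (by positivity)
    rw [h2]
    have : 0 ≤ |θ| / Real.pi := by positivity
    gcongr

/-- The first majorant has circle mean at most 1, the second has integral at most 1 in h, and the
third shows that the zero of order A+1 pays for a growth factor ((x+h)/x)^A. -/
theorem kernel_le {x h : ℝ} (hx : 0 < x) (hh : 0 < h) (A : ℕ) :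
    x ^ (A + 1) * h / (x + h) ^ (A + 1 + 2) ≤ h / (x + h) ^ 2 ∧
    x ^ (A + 1) * h / (x + h) ^ (A + 1 + 2) ≤ x / (x + h) ^ 2 ∧
    x ^ (A + 1) * h / (x + h) ^ (A + 1 + 2) * ((x + h) / x) ^ A ≤ x / (x + h) ^ 2 := by
  have hs : 0 < x + h := by positivity
  have h1 : x ^ (A + 1) ≤ (x + h) ^ (A + 1) := by gcongr; linarith
  have h2 : x ^ A ≤ (x + h) ^ A := by gcongr; linarith
  refine ⟨?_, ?_, ?_⟩
  · calc x ^ (A + 1) * h / (x + h) ^ (A + 1 + 2)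
        ≤ (x + h) ^ (A + 1) * h / (x + h) ^ (A + 1 + 2) := by gcongr
      _ = _ := by rw [pow_add _ (A + 1)]; field_simp
  · calc x ^ (A + 1) * h / (x + h) ^ (A + 1 + 2)
        = x * (x ^ A * h) / (x + h) ^ (A + 1 + 2) := by ring
      _ ≤ x * ((x + h) ^ A * (x + h)) / (x + h) ^ (A + 1 + 2) := by gcongr; linarith
      _ = _ := by rw [← pow_succ, pow_add _ (A + 1)]; field_simp
  · calc x ^ (A + 1) * h / (x + h) ^ (A + 1 + 2) * ((x + h) / x) ^ A
        = x * h / (x + h) ^ 3 := by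
          rw [div_pow, pow_succ x, pow_add _ (A + 1), pow_succ _ A, pow_succ _ 2]; field_simp
      _ ≤ x * (x + h) / (x + h) ^ 3 := by gcongr; linarith
      _ = _ := by field_simp

theorem integral_integral_kernel_le {η f : ℝ → ℝ} (hηc : Continuous η) (hη0 : ∀ θ, 0 < η θ)
    (hfc : Continuous f) (hf0 : ∀ θ, 0 ≤ f θ) {a b : ℝ} (ha0 : 0 < a) (ha1 : a ≤ 1) (hb : 0 ≤ b) :
    (Continuous fun y => ∫ θ in (0 : ℝ)..b, η θ / (η θ + |y|) ^ 2 * f θ) ∧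
      ∫ y in a..1, ∫ θ in (0 : ℝ)..b, η θ / (η θ + |y|) ^ 2 * f θ ≤ ∫ θ in (0 : ℝ)..b, f θ := by
  have hG : Continuous (Function.uncurry fun y θ : ℝ => η θ / (η θ + |y|) ^ 2 * f θ) := by
    refine Continuous.mul (Continuous.div (by fun_prop) (by fun_prop) fun x => ?_) (by fun_prop)
    have h1 := hη0 x.2
    positivity
  refine ⟨intervalIntegral.continuous_parametric_intervalIntegral_of_continuous' hG _ _, ?_⟩
  have hcont2 : Continuous fun θ => ∫ y in a..1, η θ / (η θ + |y|) ^ 2 * f θ :=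
    intervalIntegral.continuous_parametric_intervalIntegral_of_continuous'
      (f := fun θ y : ℝ => η θ / (η θ + |y|) ^ 2 * f θ) (hG.comp continuous_swap) _ _
  rw [intervalIntegral_intervalIntegral_swap]
  · refine intervalIntegral.integral_mono_on hb (hcont2.intervalIntegrable _ _)
      (hfc.intervalIntegrable _ _) fun θ _ => ?_
    rw [intervalIntegral.integral_mul_const]
    refine mul_le_of_le_one_left (hf0 θ) ?_
    refine le_trans (le_of_eq ?_) (integral_dual_poisson_le_one (hη0 θ) ha0.le ha1)
    refine intervalIntegral.integral_congr fun y hy => ?_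
    rw [uIcc_of_le ha1] at hy
    simp only [abs_of_pos (ha0.trans_le hy.1)]
  · have hcpt : IsCompact (Icc a 1 ×ˢ Icc (0 : ℝ) b) := isCompact_Icc.prod isCompact_Icc
    rw [uIoc_of_le ha1, uIoc_of_le hb]
    exact (hG.continuousOn.integrableOn_compact hcpt).mono_set
      (prod_mono Ioc_subset_Icc_self Ioc_subset_Icc_self)

namespace IsKernelCoeff

variable {ψ : ℝ → ℝ} {C : ℝ} {c : ℕ → ℝ}

/-- Pointwise splitting of `‖F‖` into a small multiple of the model at distance `h` and a part
controlled by `‖F‖ ^ p`. -/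
theorem kernel_mul_norm_le (hc : IsKernelCoeff ψ c) (h : IsDoubling ψ C) {p : ℝ} (hp : 0 < p) :
    ∃ A : ℕ, ∀ ε : ℝ, 0 < ε → ∃ K : ℝ, 0 < K ∧ ∀ (z : ℂ) (y : ℝ), ‖z‖ < 1 → 0 < y → y ≤ 1 →
      ‖1 - z‖ ^ (A + 1) * y / (‖1 - z‖ + y) ^ (A + 1 + 2) * ‖powerSum c z‖ ≤
        ε * logPrimitive ψ (1 - y) * (y / (‖1 - z‖ + y) ^ 2) +
          K * logPrimitive ψ (1 - y) ^ (1 - p) *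
            (‖1 - z‖ / (‖1 - z‖ + y) ^ 2 * ‖powerSum c z‖ ^ p) := by
  obtain ⟨K, hK0, hK⟩ := hc.norm_powerSum_le h
  obtain ⟨M, hM1, A, hM⟩ := h.exists_growth_logPrimitive
  refine ⟨A, fun ε hε => ⟨K ^ (1 - p) * M + ε ^ (1 - p), by positivity, fun z y hz hy hy1 => ?_⟩⟩
  have hne : z ≠ 1 := by rintro rfl; simp at hz
  set x := ‖1 - z‖ with hx
  have hx0 : 0 < x := norm_pos_iff.2 (sub_ne_zero.2 hne.symm)
  obtain ⟨k1, k2, k3⟩ := kernel_le hx0 hy A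
  set k := x ^ (A + 1) * y / (x + y) ^ (A + 1 + 2) with hk
  have hk0 : 0 ≤ k := by positivity
  have hym : 1 - y ∈ Ico (0 : ℝ) 1 := ⟨by linarith, by linarith⟩
  have hS := h.one_le_logPrimitive hym
  set S := logPrimitive ψ (1 - y)
  have hS0 : 0 < S := by linarith
  set f := ‖powerSum c z‖ with hf
  have hf0 : 0 ≤ f := norm_nonneg _
  rcases hf0.eq_or_lt with hf00 | hf0
  · rw [← hf00]
    simp only [mul_zero]
    positivity
  have hsplit : f = f ^ p * f ^ (1 - p) := by
    rw [← Real.rpow_add hf0]; simp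
  -- The factor f^(1-p) is to be replaced by a multiple of S^(1-p). For p ≤ 1 the pointwise upper
  -- bound does this with a loss ((x+y)/x)^A, covered by `k3`. For p ≥ 1 either f ≤ εS, which goes
  -- into the ε-term, or f^(1-p) ≤ (εS)^(1-p).
  rcases le_total p 1 with hp1 | hp1
  · have hx1m : 1 - min 1 x ∈ Ico (0 : ℝ) 1 :=
      ⟨by linarith [min_le_left 1 x], by linarith [lt_min one_pos hx0]⟩
    have hone : 1 ≤ ((x + y) / x) ^ A := by
      refine one_le_pow₀ ?_
      rw [one_le_div hx0]; linarith
    have hgrow : logPrimitive ψ (1 - min 1 x) ≤ M * ((x + y) / x) ^ A * S := by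
      rcases le_total y (min 1 x) with h1 | h1
      · have h2 := h.logPrimitive_mono hx1m hym (by linarith)
        refine h2.trans (le_mul_of_one_le_left hS0.le ?_)
        nlinarith
      · have h2 := hM _ _ hym.1 (by linarith : 1 - y ≤ 1 - min 1 x) hx1m.2
        refine h2.trans ?_
        have h3 : (1 - (1 - y)) / (1 - (1 - min 1 x)) ≤ (x + y) / x := by
          rw [sub_sub_cancel, sub_sub_cancel]
          rcases le_total 1 x with h4 | h4
          · rw [min_eq_left h4] at h1 ⊢
            rw [div_one]
            exact hy1.trans (by rw [one_le_div hx0]; linarith)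
          · rw [min_eq_right h4]
            gcongr
            linarith
        have h5 : 0 ≤ (1 - (1 - y)) / (1 - (1 - min 1 x)) := by
          rw [sub_sub_cancel, sub_sub_cancel]
          have := lt_min one_pos hx0
          positivity
        gcongr
    have hfle : f ^ (1 - p) ≤ K ^ (1 - p) * (M * ((x + y) / x) ^ A * S ^ (1 - p)) := by
      have hfS : f ≤ K * (M * ((x + y) / x) ^ A * S) := (hK z hz).trans (by gcongr)
      calc f ^ (1 - p) ≤ (K * (M * ((x + y) / x) ^ A * S)) ^ (1 - p) :=
            Real.rpow_le_rpow hf0.le hfS (by linarith)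
        _ = K ^ (1 - p) * ((M * ((x + y) / x) ^ A) ^ (1 - p) * S ^ (1 - p)) := by
            rw [Real.mul_rpow hK0.le (by positivity), Real.mul_rpow (by positivity) hS0.le]
        _ ≤ _ := by
            gcongr
            refine (Real.rpow_le_rpow_of_exponent_le ?_ (by linarith : 1 - p ≤ 1)).trans
              (le_of_eq (Real.rpow_one _))
            nlinarith
    have hfin : k * f ≤ K ^ (1 - p) * M * S ^ (1 - p) * (x / (x + y) ^ 2 * f ^ p) := by
      calc k * f = k * (f ^ p * f ^ (1 - p)) := by rw [← hsplit]
        _ ≤ k * (f ^ p * (K ^ (1 - p) * (M * ((x + y) / x) ^ A * S ^ (1 - p)))) := by gcongr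
        _ = K ^ (1 - p) * M * S ^ (1 - p) * (k * ((x + y) / x) ^ A * f ^ p) := by ring
        _ ≤ _ := by gcongr
    have h6 : 0 ≤ ε * S * (y / (x + y) ^ 2) := by positivity
    have h7 : 0 ≤ ε ^ (1 - p) * S ^ (1 - p) * (x / (x + y) ^ 2 * f ^ p) := by positivity
    calc k * f ≤ _ := hfin
      _ ≤ _ := by rw [add_mul, add_mul]; linarith
  · rcases le_total f (ε * S) with h1 | h1
    · have h2 : k * f ≤ (y / (x + y) ^ 2) * (ε * S) := by gcongr
      have h3 : 0 ≤ (K ^ (1 - p) * M + ε ^ (1 - p)) * S ^ (1 - p) *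
        (x / (x + y) ^ 2 * f ^ p) := by positivity
      linarith
    · have hfle : f ^ (1 - p) ≤ ε ^ (1 - p) * S ^ (1 - p) := by
        rw [← Real.mul_rpow hε.le hS0.le]
        exact Real.rpow_le_rpow_of_nonpos (by positivity) h1 (by linarith)
      have hfin : k * f ≤ ε ^ (1 - p) * S ^ (1 - p) * (x / (x + y) ^ 2 * f ^ p) := by
        calc k * f = k * (f ^ p * f ^ (1 - p)) := by rw [← hsplit]
          _ ≤ (x / (x + y) ^ 2) * (f ^ p * (ε ^ (1 - p) * S ^ (1 - p))) := by gcongr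
          _ = _ := by ring
      have h6 : 0 ≤ ε * S * (y / (x + y) ^ 2) := by positivity
      have h7 : 0 ≤ K ^ (1 - p) * M * S ^ (1 - p) * (x / (x + y) ^ 2 * f ^ p) := by positivity
      calc k * f ≤ _ := hfin
        _ ≤ _ := by rw [add_mul, add_mul]; linarith

/-- The value on the radius at 1-y is at least S up to a constant, and the localized Cauchy formula
bounds it by a mean of |F|. Splitting that mean gives S ≤ S/2 + const·S^(1-p)·Q, to be multiplied by
S^(p-1). -/
theorem logPrimitive_rpow_le_circleAverage (hc : IsKernelCoeff ψ c) (h : IsDoubling ψ C) {p : ℝ}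
    (hp : 0 < p) :
    ∃ K : ℝ, 0 < K ∧ ∀ u y : ℝ, 1 / 2 < u → u < 1 → 2 * (1 - u) ≤ y → y ≤ 1 →
      logPrimitive ψ (1 - y) ^ p ≤
        K * circleAverage (fun z => ‖1 - z‖ / (‖1 - z‖ + y) ^ 2 * ‖powerSum c z‖ ^ p) 0 u := by
  obtain ⟨K₁, hK₁0, hK₁⟩ := hc.logPrimitive_le_norm_powerSum h
  obtain ⟨A, hA⟩ := hc.kernel_mul_norm_le h hp
  set B : ℝ := 5 * 4 ^ (A + 1 + 1) with hB
  have hB0 : 0 < B := by positivity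
  -- This ε makes the first term contribute at most S/2, because the mean of y/(|1-z|+y)² is at most
  -- 1.
  obtain ⟨K₂, hK₂0, hK₂⟩ := hA (1 / (2 * (K₁ * B))) (by positivity)
  refine ⟨2 * (K₁ * B * K₂), by positivity, fun u y hu hu1 hy hy1 => ?_⟩
  have hy0 : 0 < y := by linarith
  have hum : u ∈ Ico (0 : ℝ) 1 := ⟨by linarith, hu1⟩
  have hym : 1 - y ∈ Ico (0 : ℝ) 1 := ⟨by linarith, by linarith⟩
  have hS := h.one_le_logPrimitive hym
  have h1 := hK₁ _ hym
  have hdiff := (hc.isPolyBounded h).differentiableOn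
  have h2 := norm_le_circleAverage_localized hdiff (A + 1) hu1 hu hy hy1
  set S := logPrimitive ψ (1 - y)
  have hS0 : 0 < S := by linarith
  have hsphere : ∀ z ∈ Metric.sphere (0 : ℂ) |u|, ‖z‖ < 1 := fun z hz => by
    rw [mem_sphere_zero_iff_norm, abs_of_nonneg hum.1] at hz; linarith
  have hFc : ContinuousOn (fun z => ‖powerSum c z‖) (Metric.sphere (0 : ℂ) |u|) :=
    (hdiff.continuousOn.mono fun z hz => mem_ball_zero_iff.2 (hsphere z hz)).norm
  have hFp : ContinuousOn (fun z => ‖powerSum c z‖ ^ p) (Metric.sphere (0 : ℂ) |u|) :=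
    hFc.rpow_const fun _ _ => Or.inr hp.le
  have hP : Continuous fun z : ℂ => y / (‖1 - z‖ + y) ^ 2 :=
    Continuous.div (by fun_prop) (by fun_prop) fun z => by positivity
  have hQ : ContinuousOn (fun z : ℂ => ‖1 - z‖ / (‖1 - z‖ + y) ^ 2 * ‖powerSum c z‖ ^ p)
      (Metric.sphere (0 : ℂ) |u|) :=
    (Continuous.div (by fun_prop) (by fun_prop) fun z => by positivity).continuousOn.mul hFp
  have hk : ContinuousOn (fun z : ℂ => ‖1 - z‖ ^ (A + 1) * y / (‖1 - z‖ + y) ^ (A + 1 + 2) *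
      ‖powerSum c z‖) (Metric.sphere (0 : ℂ) |u|) :=
    (Continuous.div (by fun_prop) (by fun_prop) fun z => by positivity).continuousOn.mul hFc
  have h3 := circleAverage_mono_of_continuous hk
    ((hP.continuousOn.const_smul (1 / (2 * (K₁ * B)) * S)).add
      (hQ.const_smul (K₂ * S ^ (1 - p)))) fun z hz => hK₂ z y (hsphere z hz) hy0 hy1
  rw [Real.circleAverage_add (hP.continuousOn.circleIntegrable'.const_smul)
    (hQ.circleIntegrable'.const_smul), Real.circleAverage_smul, Real.circleAverage_smul,
    smul_eq_mul, smul_eq_mul] at h3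
  have h4 := circleAverage_poisson_le_one hum hy0
  set Q := circleAverage (fun z : ℂ => ‖1 - z‖ / (‖1 - z‖ + y) ^ 2 * ‖powerSum c z‖ ^ p) 0 u
  have h5 : S ≤ S / 2 + K₁ * B * K₂ * S ^ (1 - p) * Q := by
    calc S ≤ K₁ * (B * (1 / (2 * (K₁ * B)) * S * 1 + K₂ * S ^ (1 - p) * Q)) := by
          refine h1.trans ?_
          gcongr
          refine h2.trans ?_
          gcongr
          refine h3.trans ?_
          gcongr
      _ = _ := by field_simp
  have h6 : S ^ p = S ^ (p - 1) * S := by rw [Real.rpow_sub_one hS0.ne']; field_simp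
  have h7 : S ^ (p - 1) * S ^ (1 - p) = 1 := by
    rw [← Real.rpow_add hS0]; simp
  rw [h6]
  calc S ^ (p - 1) * S ≤ S ^ (p - 1) * (2 * (K₁ * B * K₂ * S ^ (1 - p) * Q)) := by
        gcongr; linarith
    _ = 2 * (K₁ * B * K₂) * (S ^ (p - 1) * S ^ (1 - p)) * Q := by ring
    _ = _ := by rw [h7, mul_one]

/-- Integrating the localized bound over 2(1-u) ≤ y ≤ 1 and exchanging integrals leaves |F|^p times
the integral in y of |1-z|/(|1-z|+y)², at most 1. -/
theorem integral_logPrimitive_le_circleAverage (hc : IsKernelCoeff ψ c) (h : IsDoubling ψ C)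
    {p : ℝ} (hp : 0 < p) :
    ∃ K : ℝ, 0 < K ∧ ∀ u : ℝ, 1 / 2 < u → u < 1 →
      ∫ t in (0 : ℝ)..(2 * u - 1), logPrimitive ψ t ^ p ≤
        K * circleAverage (fun z => ‖powerSum c z‖ ^ p) 0 u := by
  obtain ⟨K, hK0, hK⟩ := hc.logPrimitive_rpow_le_circleAverage h hp
  refine ⟨K, hK0, fun u hu hu1 => ?_⟩
  have hum : u ∈ Ico (0 : ℝ) 1 := ⟨by linarith, hu1⟩
  have hpi := pi_pos
  have ha0 : 0 < 2 * (1 - u) := by linarith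
  have ha1 : 2 * (1 - u) ≤ 1 := by linarith
  have hη0 : ∀ θ, 0 < ‖1 - circleMap 0 u θ‖ := fun θ => by
    have := one_sub_le_norm_one_sub hum.1 θ
    linarith
  have hηc : Continuous fun θ => ‖1 - circleMap 0 u θ‖ := by
    have := continuous_circleMap 0 u
    fun_prop
  have hfc : Continuous fun θ => ‖powerSum c (circleMap 0 u θ)‖ ^ p :=
    (continuous_powerSum_circleMap (hc.isPolyBounded h) hum).norm.rpow_const fun _ => Or.inr hp.le
  obtain ⟨hc1, hc2⟩ := integral_integral_kernel_le hηc hη0 hfc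
    (fun θ => Real.rpow_nonneg (norm_nonneg _) p) ha0 ha1 (b := 2 * Real.pi) (by positivity)
  have hpt : ∀ y ∈ Icc (2 * (1 - u)) 1, logPrimitive ψ (1 - y) ^ p ≤
      K * ((2 * Real.pi)⁻¹ * ∫ θ in (0 : ℝ)..(2 * Real.pi), ‖1 - circleMap 0 u θ‖ /
        (‖1 - circleMap 0 u θ‖ + |y|) ^ 2 * ‖powerSum c (circleMap 0 u θ)‖ ^ p) := by
    intro y hy
    rw [abs_of_pos (ha0.trans_le hy.1)]
    have := hK u y hu hu1 hy.1 hy.2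
    rwa [Real.circleAverage_def, smul_eq_mul] at this
  have h1 : ∫ t in (0 : ℝ)..(2 * u - 1), logPrimitive ψ t ^ p =
      ∫ y in (2 * (1 - u))..1, logPrimitive ψ (1 - y) ^ p := by
    rw [intervalIntegral.integral_comp_sub_left (fun t => logPrimitive ψ t ^ p), sub_self,
      show 1 - 2 * (1 - u) = 2 * u - 1 by ring]
  have hint : IntervalIntegrable (fun y => logPrimitive ψ (1 - y) ^ p) volume (2 * (1 - u)) 1 := by
    refine ContinuousOn.intervalIntegrable ?_
    rw [uIcc_of_le ha1]
    refine (h.continuousOn_logPrimitive_rpow p).comp (f := fun y => 1 - y) (by fun_prop)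
      fun y hy => ?_
    exact ⟨by linarith [hy.2], by linarith [hy.1]⟩
  have h2 := intervalIntegral.integral_mono_on ha1 hint
    (((hc1.intervalIntegrable _ _).const_mul _).const_mul _) hpt
  rw [intervalIntegral.integral_const_mul, intervalIntegral.integral_const_mul] at h2
  rw [h1, Real.circleAverage_def, smul_eq_mul]
  exact h2.trans (by gcongr)

/-- It remains to pass from 2u-1 to u as upper limit, by doubling of S, and from S to ψ ≤ MS. The
summand 1 is absorbed because S ≥ 1 on an interval of length at least 1/2. -/
theorem le_circleAverage (hc : IsKernelCoeff ψ c) (h : IsDoubling ψ C) {p : ℝ} (hp : 0 < p) :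
    ∃ K : ℝ, 0 < K ∧ ∀ u : ℝ, 3 / 4 ≤ u → u < 1 →
      1 + ∫ t in (0 : ℝ)..u, ψ t ^ p ≤
        K * circleAverage (fun z => ‖powerSum c z‖ ^ p) 0 u := by
  obtain ⟨K, hK0, hK⟩ := hc.integral_logPrimitive_le_circleAverage h hp
  obtain ⟨M, hM0, hM⟩ := h.le_logPrimitive
  obtain ⟨D, hD1, hD⟩ := h.logPrimitive_doubling
  set S := logPrimitive ψ with hS
  have hhalf : (1 / 2 : ℝ) ∈ Ico (0 : ℝ) 1 := ⟨by norm_num, by norm_num⟩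
  have hz : (0 : ℝ) ∈ Ico (0 : ℝ) 1 := ⟨by norm_num, by norm_num⟩
  have hS2 := h.one_le_logPrimitive hhalf
  refine ⟨(2 + M ^ p * (2 * S (1 / 2) ^ p + D ^ p)) * K, by positivity, fun u hu hu1 => ?_⟩
  have hum : u ∈ Ico (0 : ℝ) 1 := ⟨by linarith, hu1⟩
  have hvm : 2 * u - 1 ∈ Ico (0 : ℝ) 1 := ⟨by linarith, by linarith⟩
  have hpos : ∀ t ∈ Ico (0 : ℝ) 1, 0 < S t := fun t ht =>
    zero_lt_one.trans_le (h.one_le_logPrimitive ht)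
  have h1 : 1 ≤ 2 * ∫ t in (0 : ℝ)..(2 * u - 1), S t ^ p := by
    have : ∫ t in (0 : ℝ)..(2 * u - 1), (1 : ℝ) ≤ ∫ t in (0 : ℝ)..(2 * u - 1), S t ^ p :=
      intervalIntegral.integral_mono_on hvm.1 (by simp)
        (h.intervalIntegrable_logPrimitive_rpow p hz hvm) fun t ht =>
        Real.one_le_rpow (h.one_le_logPrimitive ⟨ht.1, ht.2.trans_lt hvm.2⟩) hp.le
    rw [intervalIntegral.integral_const, smul_eq_mul] at this
    linarith
  have h2 : ∫ t in (0 : ℝ)..u, ψ t ^ p ≤ M ^ p * ∫ t in (0 : ℝ)..u, S t ^ p := by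
    rw [← intervalIntegral.integral_const_mul]
    refine intervalIntegral.integral_mono_on hum.1 (h.intervalIntegrable_rpow p hz hum)
      ((h.intervalIntegrable_logPrimitive_rpow p hz hum).const_mul _) fun t ht => ?_
    have htm : t ∈ Ico (0 : ℝ) 1 := ⟨ht.1, ht.2.trans_lt hum.2⟩
    rw [← Real.mul_rpow hM0.le (hpos t htm).le]
    exact Real.rpow_le_rpow (h.pos t htm).le (hM t htm) hp.le
  have h3 : ∫ t in (0 : ℝ)..(1 / 2), S t ^ p ≤ S (1 / 2) ^ p := by
    have : ∫ t in (0 : ℝ)..(1 / 2), S t ^ p ≤ ∫ t in (0 : ℝ)..(1 / 2), S (1 / 2) ^ p :=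
      intervalIntegral.integral_mono_on hhalf.1 (h.intervalIntegrable_logPrimitive_rpow p hz hhalf)
        (by simp) fun t ht => by
          have htm : t ∈ Ico (0 : ℝ) 1 := ⟨ht.1, ht.2.trans_lt hhalf.2⟩
          exact Real.rpow_le_rpow (hpos t htm).le (h.logPrimitive_mono htm hhalf ht.2) hp.le
    rw [intervalIntegral.integral_const, smul_eq_mul] at this
    have h4 := Real.rpow_nonneg (hpos _ hhalf).le p
    linarith
  have h4 : ∫ t in (1 / 2)..u, S t ^ p ≤ D ^ p * ∫ t in (0 : ℝ)..(2 * u - 1), S t ^ p := by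
    -- The map s ↦ (1+s)/2 carries [0, 2u-1] onto [1/2, u] and halves the distance to 1.
    have e : ∫ t in (1 / 2)..u, S t ^ p =
        1 / 2 * ∫ s in (0 : ℝ)..(2 * u - 1), S (s / 2 + 1 / 2) ^ p := by
      rw [intervalIntegral.integral_comp_div_add (fun t => S t ^ p) two_ne_zero, smul_eq_mul,
        zero_div, zero_add, show (2 * u - 1) / 2 + 1 / 2 = u by ring]
      ring
    have h5 : ∫ s in (0 : ℝ)..(2 * u - 1), S (s / 2 + 1 / 2) ^ p ≤
        ∫ s in (0 : ℝ)..(2 * u - 1), D ^ p * S s ^ p := by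
      refine intervalIntegral.integral_mono_on hvm.1 ?_
        ((h.intervalIntegrable_logPrimitive_rpow p hz hvm).const_mul _) fun s hs => ?_
      · refine ContinuousOn.intervalIntegrable ?_
        rw [uIcc_of_le hvm.1]
        refine (h.continuousOn_logPrimitive_rpow p).comp (by fun_prop) fun y hy => ?_
        exact ⟨by linarith [hy.1], by linarith [hy.2]⟩
      · have hsm : s ∈ Ico (0 : ℝ) 1 := ⟨hs.1, hs.2.trans_lt hvm.2⟩
        have hsm2 : s / 2 + 1 / 2 ∈ Ico (0 : ℝ) 1 := ⟨by linarith [hs.1], by linarith [hsm.2]⟩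
        rw [← Real.mul_rpow (by positivity) (hpos s hsm).le]
        exact Real.rpow_le_rpow (hpos _ hsm2).le
          (hD s _ hs.1 (by linarith [hsm.2]) (by linarith) hsm.2) hp.le
    rw [intervalIntegral.integral_const_mul] at h5
    have h6 : 0 ≤ D ^ p * ∫ t in (0 : ℝ)..(2 * u - 1), S t ^ p := by
      have : 0 ≤ ∫ t in (0 : ℝ)..(2 * u - 1), S t ^ p := by linarith
      positivity
    linarith
  have h5 : ∫ t in (0 : ℝ)..u, S t ^ p =
      (∫ t in (0 : ℝ)..(1 / 2), S t ^ p) + ∫ t in (1 / 2)..u, S t ^ p :=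
    (intervalIntegral.integral_add_adjacent_intervals
      (h.intervalIntegrable_logPrimitive_rpow p hz hhalf)
      (h.intervalIntegrable_logPrimitive_rpow p hhalf hum)).symm
  have h6 := hK u (by linarith) hu1
  set X := ∫ t in (0 : ℝ)..(2 * u - 1), S t ^ p
  have hs2 := Real.rpow_nonneg (hpos _ hhalf).le p
  calc 1 + ∫ t in (0 : ℝ)..u, ψ t ^ p ≤ 2 * X + M ^ p * (S (1 / 2) ^ p + D ^ p * X) := by
        gcongr
        refine h2.trans ?_
        gcongr
        linarith
    _ ≤ 2 * X + M ^ p * (S (1 / 2) ^ p * (2 * X) + D ^ p * X) := by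
        gcongr
        exact le_mul_of_one_le_right hs2 h1
    _ = (2 + M ^ p * (2 * S (1 / 2) ^ p + D ^ p)) * X := by ring
    _ ≤ (2 + M ^ p * (2 * S (1 / 2) ^ p + D ^ p)) *
        (K * circleAverage (fun z => ‖powerSum c z‖ ^ p) 0 u) := by gcongr
    _ = _ := by ring

end IsKernelCoeff


/-! ### Radial weights: tails and moments -/

/-- Integration by parts for absolutely continuous primitives, since the densities are only
integrable. The boundary terms vanish: the primitive of g at 0 and `hat v` at 1. -/
theorem integral_primitive_mul_eq {g v : ℝ → ℝ} (hg : IntervalIntegrable g volume 0 1)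
    (hv : IntervalIntegrable v volume 0 1) :
    ∫ r in (0 : ℝ)..1, (∫ t in (0 : ℝ)..r, g t) * v r = ∫ t in (0 : ℝ)..1, g t * hat v t := by
  have hac1 := hg.absolutelyContinuousOnInterval_intervalIntegral (c := 0) (by simp)
  have hac2 := (hv.absolutelyContinuousOnInterval_intervalIntegral (c := 1) (by simp))
  have h := hac1.integral_mul_deriv_eq_deriv_mul hac2
  have e1 : ∫ r in (0 : ℝ)..1, (∫ t in (0 : ℝ)..r, g t) * deriv (fun x => ∫ t in (1 : ℝ)..x, v t) r =
      ∫ r in (0 : ℝ)..1, (∫ t in (0 : ℝ)..r, g t) * v r := by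
    refine intervalIntegral.integral_congr_ae ?_
    filter_upwards [hv.ae_hasDerivAt_integral] with x hx hx2
    rw [(hx (uIoc_subset_uIcc hx2) 1 (by simp)).deriv]
  have e2 : ∫ r in (0 : ℝ)..1, deriv (fun x => ∫ t in (0 : ℝ)..x, g t) r * (∫ t in (1 : ℝ)..r, v t) =
      ∫ r in (0 : ℝ)..1, -(g r * hat v r) := by
    refine intervalIntegral.integral_congr_ae ?_
    filter_upwards [hg.ae_hasDerivAt_integral] with x hx hx2
    rw [(hx (uIoc_subset_uIcc hx2) 0 (by simp)).deriv, intervalIntegral.integral_symm, hat]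
    ring
  rw [e1, e2] at h
  simpa using h

namespace IsDHat

variable {ω : ℝ → ℝ}

theorem intervalIntegrable (h : IsDHat ω) : IntervalIntegrable ω volume 0 1 :=
  (intervalIntegrable_iff_integrableOn_Ico_of_le zero_le_one).2 h.integrableOn

theorem intervalIntegrable_of_mem (h : IsDHat ω) {a b : ℝ} (ha : a ∈ Icc (0 : ℝ) 1)
    (hb : b ∈ Icc (0 : ℝ) 1) : IntervalIntegrable ω volume a b := by
  refine h.intervalIntegrable.mono_set ?_
  rw [uIcc_of_le zero_le_one]
  exact ordConnected_Icc.uIcc_subset ha hb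

theorem integral_mul_nonneg (h : IsDHat ω) {g : ℝ → ℝ} {a : ℝ} (ha : a ∈ Icc (0 : ℝ) 1)
    (hg : ∀ s ∈ Ico a 1, 0 ≤ g s) : 0 ≤ ∫ s in a..1, g s * ω s := by
  refine intervalIntegral.integral_nonneg_of_ae_restrict ha.2 ?_
  rw [← restrict_Ico_eq_restrict_Icc]
  filter_upwards [ae_restrict_mem measurableSet_Ico] with s hs
  exact mul_nonneg (hg s hs) (h.nonneg s ⟨ha.1.trans hs.1, hs.2⟩)

theorem integral_mul_mono (h : IsDHat ω) {f g : ℝ → ℝ} {a : ℝ} (ha : a ∈ Icc (0 : ℝ) 1)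
    (hf : ContinuousOn f (Icc a 1)) (hg : ContinuousOn g (Icc a 1))
    (hfg : ∀ s ∈ Ico a 1, f s ≤ g s) :
    ∫ s in a..1, f s * ω s ≤ ∫ s in a..1, g s * ω s := by
  have hi := h.intervalIntegrable_of_mem ha (right_mem_Icc.2 zero_le_one)
  rw [← uIcc_of_le ha.2] at hf hg
  rw [← sub_nonneg, ← intervalIntegral.integral_sub (hi.continuousOn_mul hg)
    (hi.continuousOn_mul hf)]
  simp_rw [← sub_mul]
  exact h.integral_mul_nonneg (g := fun s => g s - f s) ha fun s hs => sub_nonneg.2 (hfg s hs)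

theorem hat_nonneg (h : IsDHat ω) {t : ℝ} (ht : t ∈ Icc (0 : ℝ) 1) : 0 ≤ hat ω t := by
  simpa [hat] using h.integral_mul_nonneg (g := fun _ => 1) ht (by simp)

theorem hat_anti (h : IsDHat ω) : AntitoneOn (hat ω) (Icc 0 1) := by
  intro a ha b hb hab
  have h1 := intervalIntegral.integral_add_adjacent_intervals
    (h.intervalIntegrable_of_mem ha hb)
    (h.intervalIntegrable_of_mem hb (right_mem_Icc.2 zero_le_one))
  have h2 : 0 ≤ ∫ s in a..b, ω s := by
    refine intervalIntegral.integral_nonneg_of_ae_restrict hab ?_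
    rw [← restrict_Ico_eq_restrict_Icc]
    filter_upwards [ae_restrict_mem measurableSet_Ico] with s hs
    exact h.nonneg s ⟨ha.1.trans hs.1, hs.2.trans_le hb.2⟩
  unfold hat
  linarith

theorem continuousOn_hat (h : IsDHat ω) : ContinuousOn (hat ω) (Icc 0 1) := by
  have h1 := intervalIntegral.continuousOn_primitive_interval_left (μ := volume)
    (((integrableOn_Icc_iff_integrableOn_Ico (by simp)).2 h.integrableOn :
      IntegrableOn ω (Icc 0 1)).mono_set (uIcc_of_le (zero_le_one' ℝ)).le)
  rwa [uIcc_of_le zero_le_one] at h1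

theorem exists_doubling (h : IsDHat ω) :
    ∃ C : ℝ, 1 ≤ C ∧ ∀ t s : ℝ, 0 ≤ t → t ≤ s → s ≤ (1 + t) / 2 → t < 1 →
      hat ω t ≤ C * hat ω s := by
  obtain ⟨C, hC⟩ := h.doubling
  refine ⟨max C 1, le_max_right _ _, fun t s h0 hts hs ht => ?_⟩
  have hm : (1 + t) / 2 ∈ Icc (0 : ℝ) 1 := ⟨by linarith, by linarith⟩
  have hsm : s ∈ Icc (0 : ℝ) 1 := ⟨by linarith, by linarith⟩
  have h1 := h.hat_nonneg hm
  calc hat ω t ≤ C * hat ω ((1 + t) / 2) := hC t ⟨h0, ht⟩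
    _ ≤ max C 1 * hat ω ((1 + t) / 2) := by gcongr; exact le_max_left _ _
    _ ≤ max C 1 * hat ω s := by
        have := le_max_right C 1
        gcongr
        exact h.hat_anti hsm hm hs

/-- Doubling propagates positivity along the points 1-2^(-j), and monotonicity fills the gaps. -/
theorem hat_pos (h : IsDHat ω) (h0 : 0 < hat ω 0) {t : ℝ} (ht : t ∈ Ico (0 : ℝ) 1) :
    0 < hat ω t := by
  obtain ⟨C, hC1, hC⟩ := h.exists_doubling
  have hj : ∀ j : ℕ, 0 < hat ω (1 - (1 / 2) ^ j) := by
    intro j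
    induction j with
    | zero => simpa using h0
    | succ j ih =>
      have hp : (0 : ℝ) < (1 / 2) ^ j := by positivity
      have hp1 : ((1 : ℝ) / 2) ^ j ≤ 1 := pow_le_one₀ (by norm_num) (by norm_num)
      have h1 := hC (1 - (1 / 2) ^ j) (1 - (1 / 2) ^ (j + 1)) (by linarith)
        (by rw [pow_succ]; linarith) (by rw [pow_succ]; linarith) (by linarith)
      exact pos_of_mul_pos_right (ih.trans_le h1) (by linarith)
  obtain ⟨j, hj2⟩ := exists_pow_lt_of_lt_one (sub_pos.2 ht.2) (one_half_lt_one (α := ℝ))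
  have hp : (0 : ℝ) < (1 / 2) ^ j := by positivity
  exact (hj j).trans_le (h.hat_anti ⟨ht.1, ht.2.le⟩ ⟨by linarith [ht.1], by linarith⟩ (by linarith))

theorem exists_growth (h : IsDHat ω) (h0 : 0 < hat ω 0) :
    ∃ C : ℝ, 1 ≤ C ∧ ∃ A : ℕ, ∀ t s : ℝ, 0 ≤ t → t ≤ s → s < 1 →
      hat ω t ≤ C * ((1 - t) / (1 - s)) ^ A * hat ω s := by
  obtain ⟨C, hC1, hC⟩ := h.exists_doubling
  obtain ⟨A, hA⟩ := exists_growth_of_doubling (f := fun t => (hat ω t)⁻¹) hC1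
    (fun t ht => (inv_pos.2 (h.hat_pos h0 ht)).le) fun t s h1 h2 h3 h4 => by
      have hs := h.hat_pos h0 (t := s) ⟨h1.trans h2, by linarith⟩
      have ht := h.hat_pos h0 (t := t) ⟨h1, h4⟩
      rw [← div_eq_mul_inv, inv_eq_one_div, div_le_div_iff₀ hs ht, one_mul]
      exact hC t s h1 h2 h3 h4
  refine ⟨C, hC1, A, fun t s h1 h2 h3 => ?_⟩
  have hs := h.hat_pos h0 (t := s) ⟨h1.trans h2, h3⟩
  have ht := h.hat_pos h0 (t := t) ⟨h1, h2.trans_lt h3⟩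
  have h4 := hA t s h1 h2 h3
  rw [← div_eq_mul_inv, inv_eq_one_div, div_le_div_iff₀ hs ht, one_mul] at h4
  exact h4

/-- The polynomial growth of the tail is absorbed by an exponential with rate (k+1)/2 only, which
leaves half of the decay of t^k for integration. -/
theorem hat_le_exp_mul (h : IsDHat ω) (h0 : 0 < hat ω 0) :
    ∃ K : ℝ, 0 < K ∧ ∀ (k : ℕ), ∀ t ∈ Icc (0 : ℝ) 1,
      hat ω t ≤ K * Real.exp (((k : ℝ) + 1) * (1 - t) / 2) * hat ω (1 - 1 / ((k : ℝ) + 1)) := by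
  obtain ⟨C, hC1, A, hA⟩ := h.exists_growth h0
  refine ⟨C * (2 ^ A * A.factorial), by positivity, fun k t ht => ?_⟩
  have hm := one_sub_inv_mem k
  have hs0 := h.hat_pos h0 hm
  have hx : 0 ≤ ((k : ℝ) + 1) * (1 - t) / 2 := by
    have := sub_nonneg.2 ht.2
    positivity
  have h1 : (1 : ℝ) ≤ 2 ^ A * A.factorial := by
    have h2 : (1 : ℝ) ≤ 2 ^ A := one_le_pow₀ (by norm_num)
    have h3 : (1 : ℝ) ≤ A.factorial := by exact_mod_cast A.factorial_pos
    nlinarith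
  rcases le_total t (1 - 1 / ((k : ℝ) + 1)) with h2 | h2
  · refine (hA t _ ht.1 h2 hm.2).trans ?_
    rw [sub_sub_cancel]
    gcongr ?_ * _
    rw [mul_assoc C]
    gcongr
    have h3 := Real.pow_div_factorial_le_exp _ hx A
    rw [div_le_iff₀ (by positivity)] at h3
    calc ((1 - t) / (1 / ((k : ℝ) + 1))) ^ A
        = 2 ^ A * (((k : ℝ) + 1) * (1 - t) / 2) ^ A := by
          rw [← mul_pow]; congr 1; field_simp
      _ ≤ 2 ^ A * (Real.exp (((k : ℝ) + 1) * (1 - t) / 2) * A.factorial) := by gcongr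
      _ = _ := by ring
  · refine (h.hat_anti ⟨hm.1, hm.2.le⟩ ht h2).trans (le_mul_of_one_le_left hs0.le ?_)
    have h3 : 1 ≤ Real.exp (((k : ℝ) + 1) * (1 - t) / 2) := Real.one_le_exp hx
    have h4 : 1 ≤ C * (2 ^ A * A.factorial) := by nlinarith
    nlinarith

/-- After integration by parts the integrand is a power of t times ω̂. The power decays like
exp(-n(1-t)) and ω̂ grows at most like exp(n(1-t)/2), and n·exp(-n(1-t)/2) has integral at most 2.
-/
theorem integral_pow_mul_le (h : IsDHat ω) (h0 : 0 < hat ω 0) :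
    ∃ K : ℝ, 0 < K ∧ ∀ k : ℕ, ∫ r in (0 : ℝ)..1, r ^ k * ω r ≤
      K * hat ω (1 - 1 / ((k : ℝ) + 1)) := by
  obtain ⟨K, hK0, hK⟩ := h.hat_le_exp_mul h0
  refine ⟨1 + 2 * (Real.exp 2 * K), by positivity, fun k => ?_⟩
  have hs0 := h.hat_pos h0 (one_sub_inv_mem k)
  cases k with
  | zero =>
    simp only [pow_zero, one_mul, Nat.cast_zero, zero_add, div_one, sub_self]
    simp only [Nat.cast_zero, zero_add, div_one, sub_self] at hs0
    have : 0 < Real.exp 2 * K := by positivity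
    change hat ω 0 ≤ _
    nlinarith
  | succ k =>
    set s := 1 - 1 / (((k + 1 : ℕ) : ℝ) + 1) with hs
    have e1 : ∫ r in (0 : ℝ)..1, r ^ (k + 1) * ω r =
        ∫ t in (0 : ℝ)..1, ((k : ℝ) + 1) * t ^ k * hat ω t := by
      rw [← integral_primitive_mul_eq (g := fun t => ((k : ℝ) + 1) * t ^ k)
        ((by fun_prop : Continuous fun t : ℝ => ((k : ℝ) + 1) * t ^ k).intervalIntegrable _ _)
        h.intervalIntegrable]
      refine intervalIntegral.integral_congr fun r _ => ?_
      rw [intervalIntegral.integral_const_mul, integral_pow]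
      have : ((k : ℝ) + 1) ≠ 0 := by positivity
      field_simp
      simp
      ring
    rw [e1]
    have hcont : ContinuousOn (fun t => ((k : ℝ) + 1) * t ^ k * hat ω t) (uIcc 0 1) := by
      rw [uIcc_of_le zero_le_one]
      exact (by fun_prop : ContinuousOn (fun t : ℝ => ((k : ℝ) + 1) * t ^ k) _).mul h.continuousOn_hat
    set n : ℝ := ((k + 1 : ℕ) : ℝ) + 1 with hn
    have hn2 : n = (k : ℝ) + 2 := by rw [hn]; push_cast; ring
    have hn0 : 0 < n := by positivity
    have hderiv : ∀ t : ℝ, HasDerivAt (fun t => 2 * Real.exp (-(n * (1 - t) / 2)))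
        (n * Real.exp (-(n * (1 - t) / 2))) t := fun t => by
      have h1 : HasDerivAt (fun t : ℝ => -(n * (1 - t) / 2)) (n / 2) t :=
        ((((hasDerivAt_id t).const_sub 1).const_mul n).div_const 2).neg.congr_deriv (by ring)
      exact (h1.exp.const_mul 2).congr_deriv (by ring)
    have hexpc : Continuous fun t : ℝ => n * Real.exp (-(n * (1 - t) / 2)) := by fun_prop
    have h2 : ∫ t in (0 : ℝ)..1, n * Real.exp (-(n * (1 - t) / 2)) ≤ 2 := by
      rw [intervalIntegral.integral_eq_sub_of_hasDerivAt (fun t _ => hderiv t)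
        (hexpc.intervalIntegrable _ _)]
      have := Real.exp_pos (-(n * (1 - 0) / 2))
      simp only [sub_self, mul_zero, zero_div, neg_zero, Real.exp_zero]
      linarith
    calc ∫ t in (0 : ℝ)..1, ((k : ℝ) + 1) * t ^ k * hat ω t
        ≤ ∫ t in (0 : ℝ)..1, Real.exp 2 * K * hat ω s * (n * Real.exp (-(n * (1 - t) / 2))) := by
          refine intervalIntegral.integral_mono_on zero_le_one hcont.intervalIntegrable
            ((hexpc.intervalIntegrable _ _).const_mul _) fun t ht => ?_
          have h3 := hK (k + 1) t ht
          have h4 : t ^ k ≤ Real.exp 2 * Real.exp (-(n * (1 - t))) := by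
            have h5 : t ≤ Real.exp (-(1 - t)) := by
              have := Real.add_one_le_exp (-(1 - t)); linarith
            calc t ^ k ≤ Real.exp (-(1 - t)) ^ k := pow_le_pow_left₀ ht.1 h5 k
              _ = Real.exp (k * (-(1 - t))) := by rw [← Real.exp_nat_mul]
              _ ≤ Real.exp (2 + -(n * (1 - t))) := by
                  refine Real.exp_le_exp.2 ?_
                  rw [hn2]
                  linarith [ht.1]
              _ = _ := Real.exp_add _ _
          have h6 : Real.exp (-(n * (1 - t))) * Real.exp (n * (1 - t) / 2) =
              Real.exp (-(n * (1 - t) / 2)) := by rw [← Real.exp_add]; congr 1; ring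
          have h7 := h.hat_nonneg ht
          calc ((k : ℝ) + 1) * t ^ k * hat ω t
              ≤ n * (Real.exp 2 * Real.exp (-(n * (1 - t)))) *
                (K * Real.exp (n * (1 - t) / 2) * hat ω s) := by
                have h8 : 0 ≤ t ^ k := pow_nonneg ht.1 k
                have h9 : (k : ℝ) + 1 ≤ n := by linarith
                gcongr
            _ = Real.exp 2 * K * hat ω s *
                (n * (Real.exp (-(n * (1 - t))) * Real.exp (n * (1 - t) / 2))) := by ring
            _ = _ := by rw [h6]
      _ = Real.exp 2 * K * hat ω s * ∫ t in (0 : ℝ)..1, n * Real.exp (-(n * (1 - t) / 2)) := by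
          rw [intervalIntegral.integral_const_mul]
      _ ≤ Real.exp 2 * K * hat ω s * 2 := by gcongr
      _ ≤ _ := by linarith

/-- The function `(1 - t) ^ (1 - N) / ω̂ t`. -/
noncomputable def _root_.RadialDirichlet.kernelScale (ω : ℝ → ℝ) (N : ℕ) (t : ℝ) : ℝ :=
  (1 - t) / ((1 - t) ^ N * hat ω t)

theorem isDoubling_kernelScale (h : IsDHat ω) (h0 : 0 < hat ω 0) (N : ℕ) :
    ∃ C : ℝ, IsDoubling (kernelScale ω N) C := by
  obtain ⟨C, hC1, hC⟩ := h.exists_doubling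
  refine ⟨2 ^ N * C, ?_, fun t ht => ?_, fun t s h1 h2 h3 h4 => ?_⟩
  · refine ContinuousOn.div (by fun_prop) ((by fun_prop : ContinuousOn _ _).mul
      (h.continuousOn_hat.mono Ico_subset_Icc_self)) fun t ht => ?_
    have h1 := h.hat_pos h0 ht
    have h2 : 0 < 1 - t := sub_pos.2 ht.2
    positivity
  · have h1 := h.hat_pos h0 ht
    have h2 : 0 < 1 - t := sub_pos.2 ht.2
    unfold kernelScale
    positivity
  · have ht := h.hat_pos h0 (t := t) ⟨h1, h4⟩
    have hs := h.hat_pos h0 (t := s) ⟨h1.trans h2, by linarith⟩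
    have h5 : 0 < 1 - t := by linarith
    have h6 : 0 < 1 - s := by linarith
    have h7 : hat ω t / C ≤ hat ω s := by
      rw [div_le_iff₀' (by linarith)]; exact hC t s h1 h2 h3 h4
    unfold kernelScale
    calc (1 - s) / ((1 - s) ^ N * hat ω s) ≤ (1 - t) / (((1 - t) / 2) ^ N * (hat ω t / C)) := by
          gcongr
          linarith
      _ = _ := by rw [div_pow]; field_simp

theorem kernelScale_rpow (h : IsDHat ω) (h0 : 0 < hat ω 0) (N : ℕ) (p : ℝ) {t : ℝ}
    (ht : t ∈ Ico (0 : ℝ) 1) :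
    kernelScale ω N t ^ p = 1 / (hat ω t ^ p * (1 - t) ^ (p * ((N : ℝ) - 1))) := by
  have h1 := h.hat_pos h0 ht
  have h2 : 0 < 1 - t := sub_pos.2 ht.2
  have h3 : kernelScale ω N t = (hat ω t * (1 - t) ^ ((N : ℝ) - 1))⁻¹ := by
    rw [Real.rpow_sub_one h2.ne', Real.rpow_natCast, kernelScale]
    field_simp
  rw [h3, Real.inv_rpow (by positivity), Real.mul_rpow h1.le (by positivity), ← Real.rpow_mul h2.le,
    one_div, mul_comm ((N : ℝ) - 1)]

end IsDHat


/-! ### Symbol estimates for the kernel coefficients -/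

/-- The odd moment `∫_0^1 r ^ (2 k + 1) ω(r) dr`. -/
noncomputable def oddMoment (ω : ℝ → ℝ) (k : ℕ) : ℝ := ∫ r in (0 : ℝ)..1, r ^ (2 * k + 1) * ω r

/-- Coefficients of the function `G` for which `G (conj a * z)` is the reproducing kernel. -/
noncomputable def kernelCoeff (ω : ℝ → ℝ) : ℕ → ℝ
  | 0 => 1 / (2 * oddMoment ω 0)
  | n + 1 => 1 / (2 * ((n : ℝ) + 1) ^ 2 * oddMoment ω n)

/-- Coefficients of the derivative of a power series. -/
def derivCoeff (c : ℕ → ℝ) (n : ℕ) : ℝ := ((n : ℝ) + 1) * c (n + 1)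

namespace IsSymbol

theorem const (m : ℕ) (x : ℝ) {b : ℕ → ℝ} (hb : ∀ n, 0 ≤ b n) (hx : ∃ K : ℝ, ∀ n, |x| ≤ K * b n) :
    IsSymbol m b fun _ => x := by
  induction m generalizing b x with
  | zero => exact hx
  | succ m ih =>
    refine ⟨hx, ?_⟩
    simp only [sub_self]
    exact ih 0 (fun n => div_nonneg (hb n) (by positivity)) ⟨0, by simp⟩

theorem natCast_add_one (m : ℕ) :
    IsSymbol m (fun n => (n : ℝ) + 1) fun n => (n : ℝ) + 1 := by
  have key : ∃ K : ℝ, ∀ n : ℕ, |(n : ℝ) + 1| ≤ K * ((n : ℝ) + 1) :=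
    ⟨1, fun n => by rw [abs_of_nonneg (by positivity), one_mul]⟩
  cases m with
  | zero => exact key
  | succ m =>
    refine ⟨key, ?_⟩
    have := const m 1 (b := fun n : ℕ => ((n : ℝ) + 1) / ((n : ℝ) + 1)) (fun n => by positivity)
      ⟨1, fun n => by rw [div_self (by positivity)]; simp⟩
    convert this using 2
    push_cast; ring

end IsSymbol

theorem isModerate_natCast_add_one : IsModerate fun n : ℕ => (n : ℝ) + 1 :=
  ⟨fun n => by positivity, 2, fun n => by push_cast; linarith [n.cast_nonneg (α := ℝ)]⟩

theorem isModerate_natCast_add_one_inv : IsModerate fun n : ℕ => ((n : ℝ) + 1)⁻¹ :=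
  ⟨fun n => by positivity, 1, fun n => by
    rw [one_mul]; gcongr; linarith⟩

/-- Half of the power, r^(k+1) ≤ exp(-(k+1)(1-r)), pays for (1-r²)^j; the remaining r^k is kept for
the moment estimate. -/
theorem pow_mul_one_sub_sq_pow_le {r : ℝ} (hr : r ∈ Icc (0 : ℝ) 1) (k j : ℕ) :
    r ^ (2 * k + 1) * (1 - r ^ 2) ^ j ≤ 2 ^ j * j.factorial / ((k : ℝ) + 1) ^ j * r ^ k := by
  have h0 : 0 ≤ 1 - r := sub_nonneg.2 hr.2
  have h1 : 1 - r ^ 2 ≤ 2 * (1 - r) := by nlinarith [hr.1]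
  have h1' : 0 ≤ 1 - r ^ 2 := by nlinarith [hr.1, hr.2]
  have h2 : r ^ (k + 1) ≤ Real.exp (-(((k : ℝ) + 1) * (1 - r))) := by
    have h3 : r ≤ Real.exp (-(1 - r)) := by
      have := Real.add_one_le_exp (-(1 - r)); linarith
    calc r ^ (k + 1) ≤ Real.exp (-(1 - r)) ^ (k + 1) := pow_le_pow_left₀ hr.1 h3 _
      _ = _ := by rw [← Real.exp_nat_mul]; push_cast; congr 1; ring
  have h4 := Real.pow_div_factorial_le_exp (((k : ℝ) + 1) * (1 - r)) (by positivity) j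
  rw [div_le_iff₀ (by positivity), mul_pow] at h4
  have hk : 0 ≤ r ^ k := pow_nonneg hr.1 k
  calc r ^ (2 * k + 1) * (1 - r ^ 2) ^ j = r ^ k * (r ^ (k + 1) * (1 - r ^ 2) ^ j) := by ring
    _ ≤ r ^ k * (Real.exp (-(((k : ℝ) + 1) * (1 - r))) * (2 * (1 - r)) ^ j) := by gcongr
    _ = r ^ k * (2 ^ j / ((k : ℝ) + 1) ^ j * (Real.exp (-(((k : ℝ) + 1) * (1 - r))) *
        (((k : ℝ) + 1) ^ j * (1 - r) ^ j))) := by rw [mul_pow]; field_simp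
    _ ≤ r ^ k * (2 ^ j / ((k : ℝ) + 1) ^ j * (Real.exp (-(((k : ℝ) + 1) * (1 - r))) *
        (Real.exp (((k : ℝ) + 1) * (1 - r)) * j.factorial))) := by gcongr
    _ = _ := by rw [← mul_assoc (Real.exp _), ← Real.exp_add]; simp; ring

namespace IsDHat

variable {ω : ℝ → ℝ}

/-- Differencing in k inserts the factor r²-1, so it raises j by one. Generalizing over j makes the
induction immediate, each factor gaining 1/(k+1). -/
theorem isSymbol_integral (h : IsDHat ω) (h0 : 0 < hat ω 0) (m j : ℕ) :
    IsSymbol m (fun k => hat ω (1 - 1 / ((k : ℝ) + 1)) / ((k : ℝ) + 1) ^ j)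
      fun k => ∫ r in (0 : ℝ)..1, r ^ (2 * k + 1) * (r ^ 2 - 1) ^ j * ω r := by
  obtain ⟨K, hK0, hK⟩ := h.integral_pow_mul_le h0
  have key : ∀ j : ℕ, ∃ K : ℝ, ∀ k : ℕ,
      |∫ r in (0 : ℝ)..1, r ^ (2 * k + 1) * (r ^ 2 - 1) ^ j * ω r| ≤
        K * (hat ω (1 - 1 / ((k : ℝ) + 1)) / ((k : ℝ) + 1) ^ j) := by
    intro j
    refine ⟨2 ^ j * j.factorial * K, fun k => ?_⟩
    have hb : ∫ r in (0 : ℝ)..1, r ^ (2 * k + 1) * (1 - r ^ 2) ^ j * ω r ≤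
        ∫ r in (0 : ℝ)..1, 2 ^ j * j.factorial / ((k : ℝ) + 1) ^ j * r ^ k * ω r :=
      h.integral_mul_mono (f := fun r => r ^ (2 * k + 1) * (1 - r ^ 2) ^ j)
        (g := fun r => 2 ^ j * j.factorial / ((k : ℝ) + 1) ^ j * r ^ k)
        (left_mem_Icc.2 zero_le_one) (by fun_prop) (by fun_prop)
        fun r hr => pow_mul_one_sub_sq_pow_le ⟨hr.1, hr.2.le⟩ k j
    have hpos : 0 ≤ ∫ r in (0 : ℝ)..1, r ^ (2 * k + 1) * (1 - r ^ 2) ^ j * ω r :=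
      h.integral_mul_nonneg (g := fun r => r ^ (2 * k + 1) * (1 - r ^ 2) ^ j)
        (left_mem_Icc.2 zero_le_one) fun r hr => by
        have h1 : 0 ≤ 1 - r ^ 2 := by nlinarith [hr.1, hr.2]
        have := hr.1
        positivity
    have e : ∫ r in (0 : ℝ)..1, r ^ (2 * k + 1) * (r ^ 2 - 1) ^ j * ω r =
        (-1) ^ j * ∫ r in (0 : ℝ)..1, r ^ (2 * k + 1) * (1 - r ^ 2) ^ j * ω r := by
      rw [← intervalIntegral.integral_const_mul]
      refine intervalIntegral.integral_congr fun r _ => ?_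
      have : (r ^ 2 - 1) ^ j = (-1) ^ j * (1 - r ^ 2) ^ j := by rw [← mul_pow]; congr 1; ring
      simp only [this]
      ring
    rw [e, abs_mul, abs_pow, abs_neg, abs_one, one_pow, one_mul, abs_of_nonneg hpos]
    refine hb.trans ?_
    simp_rw [mul_assoc (2 ^ j * (j.factorial : ℝ) / ((k : ℝ) + 1) ^ j)]
    rw [intervalIntegral.integral_const_mul]
    calc _ ≤ 2 ^ j * j.factorial / ((k : ℝ) + 1) ^ j * (K * hat ω (1 - 1 / ((k : ℝ) + 1))) := by
          gcongr; exact hK k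
      _ = _ := by ring
  induction m generalizing j with
  | zero => exact key j
  | succ m ih =>
    refine ⟨key j, ?_⟩
    convert ih (j + 1) using 2 with k k
    · rw [pow_succ]; field_simp
    · have hi : ∀ i : ℕ, IntervalIntegrable
          (fun r => r ^ i * (r ^ 2 - 1) ^ j * ω r) volume 0 1 := fun i =>
        h.intervalIntegrable.continuousOn_mul (by fun_prop)
      rw [← intervalIntegral.integral_sub (hi _) (hi _)]
      refine intervalIntegral.integral_congr fun r _ => ?_
      ring

theorem isSymbol_oddMoment (h : IsDHat ω) (h0 : 0 < hat ω 0) (m : ℕ) :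
    IsSymbol m (fun k => hat ω (1 - 1 / ((k : ℝ) + 1))) (oddMoment ω) := by
  have := h.isSymbol_integral h0 m 0
  simp only [pow_zero, div_one, mul_one] at this
  exact this

/-- Only r ≥ s' = (2k+1)/(2k+2) is kept: there r^(2k+1) ≥ e^(-1), because (2k+1)(1-1/s') = -1, and
doubling compares ω̂(s') with ω̂(1-1/(k+1)). -/
theorem le_oddMoment (h : IsDHat ω) :
    ∃ δ : ℝ, 0 < δ ∧ ∀ k : ℕ, δ * hat ω (1 - 1 / ((k : ℝ) + 1)) ≤ oddMoment ω k := by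
  obtain ⟨C, hC1, hC⟩ := h.exists_doubling
  refine ⟨Real.exp (-1) / C, by positivity, fun k => ?_⟩
  have hm := one_sub_inv_mem k
  set s := 1 - 1 / ((k : ℝ) + 1) with hs
  set s' := (1 + s) / 2 with hs'
  have hs'm : s' ∈ Icc (0 : ℝ) 1 := ⟨by linarith [hm.1], by linarith [hm.2]⟩
  have h1 := hC s s' hm.1 (by linarith [hm.2]) le_rfl hm.2
  have hs'pos : 0 < s' := by linarith [hm.1]
  have hpow : Real.exp (-1) ≤ s' ^ (2 * k + 1) := by
    have h2 := Real.one_sub_inv_le_log_of_pos hs'pos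
    rw [← Real.exp_log hs'pos, ← Real.exp_nat_mul]
    refine Real.exp_le_exp.2 ?_
    have h3 : s' = (2 * (k : ℝ) + 1) / (2 * (k : ℝ) + 2) := by
      rw [hs', hs]; field_simp; ring
    have h4 : ((2 * k + 1 : ℕ) : ℝ) * (1 - s'⁻¹) = -1 := by
      rw [h3]; push_cast; field_simp; ring
    rw [← h4]
    gcongr
  have h5 : ∫ r in s'..1, Real.exp (-1) * ω r ≤ ∫ r in s'..1, r ^ (2 * k + 1) * ω r :=
    h.integral_mul_mono (f := fun _ => Real.exp (-1)) hs'm (by fun_prop) (by fun_prop)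
      fun r hr => hpow.trans (pow_le_pow_left₀ hs'pos.le hr.1 _)
  rw [intervalIntegral.integral_const_mul] at h5
  have h6 : 0 ≤ ∫ r in (0 : ℝ)..s', r ^ (2 * k + 1) * ω r := by
    refine intervalIntegral.integral_nonneg_of_ae_restrict hs'm.1 ?_
    rw [← restrict_Ico_eq_restrict_Icc]
    filter_upwards [ae_restrict_mem measurableSet_Ico] with r hr
    exact mul_nonneg (pow_nonneg hr.1 _) (h.nonneg r ⟨hr.1, hr.2.trans_le hs'm.2⟩)
  have hi : ∀ {a b : ℝ}, a ∈ Icc (0 : ℝ) 1 → b ∈ Icc (0 : ℝ) 1 →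
      IntervalIntegrable (fun r => r ^ (2 * k + 1) * ω r) volume a b := fun ha hb =>
    (h.intervalIntegrable_of_mem ha hb).continuousOn_mul (by fun_prop)
  have h7 := intervalIntegral.integral_add_adjacent_intervals
    (hi (left_mem_Icc.2 zero_le_one) hs'm) (hi hs'm (right_mem_Icc.2 zero_le_one))
  calc Real.exp (-1) / C * hat ω s ≤ Real.exp (-1) / C * (C * hat ω s') := by gcongr
    _ = Real.exp (-1) * hat ω s' := by field_simp
    _ ≤ oddMoment ω k := by unfold oddMoment; unfold hat; linarith

theorem oddMoment_pos (h : IsDHat ω) (h0 : 0 < hat ω 0) (k : ℕ) : 0 < oddMoment ω k := by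
  obtain ⟨δ, hδ, h1⟩ := h.le_oddMoment
  exact (mul_pos hδ (h.hat_pos h0 (one_sub_inv_mem k))).trans_le (h1 k)

theorem isModerate_hat (h : IsDHat ω) (h0 : 0 < hat ω 0) :
    IsModerate fun k : ℕ => hat ω (1 - 1 / ((k : ℝ) + 1)) := by
  refine ⟨fun k => h.hat_pos h0 (one_sub_inv_mem k), 1, fun k => ?_⟩
  rw [one_mul]
  exact h.hat_anti (Ico_subset_Icc_self (one_sub_inv_mem k))
    (Ico_subset_Icc_self (one_sub_inv_mem (k + 1))) (one_sub_inv_le (Nat.le_succ k))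

theorem isModerate_hat_inv (h : IsDHat ω) (h0 : 0 < hat ω 0) :
    IsModerate fun k : ℕ => (hat ω (1 - 1 / ((k : ℝ) + 1)))⁻¹ := by
  obtain ⟨C, hC1, hC⟩ := h.exists_doubling
  refine ⟨fun k => inv_pos.2 (h.hat_pos h0 (one_sub_inv_mem k)), C, fun k => ?_⟩
  have h1 := hC _ _ (one_sub_inv_mem k).1 (one_sub_inv_le (Nat.le_succ k)) (one_sub_inv_succ_le k)
    (one_sub_inv_mem k).2
  have h2 := h.hat_pos h0 (one_sub_inv_mem k)
  have h3 := h.hat_pos h0 (one_sub_inv_mem (k + 1))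
  rw [← div_eq_mul_inv, inv_eq_one_div, div_le_div_iff₀ h3 h2, one_mul]
  exact h1

theorem coeffModel_kernelScale (ω : ℝ → ℝ) (N k : ℕ) :
    coeffModel (kernelScale ω N) k =
      ((k : ℝ) + 1) ^ N * (((k : ℝ) + 1)⁻¹ * ((k : ℝ) + 1)⁻¹ *
        (hat ω (1 - 1 / ((k : ℝ) + 1)))⁻¹) := by
  unfold coeffModel kernelScale
  generalize hat ω (1 - 1 / ((k : ℝ) + 1)) = y
  rw [sub_sub_cancel, one_div_pow]
  field_simp

/-- The shifted coefficient is 1/2 times two factors 1/(k+1) and the inverse of a moment, all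
symbols. The lower bound is the upper bound for the moments. -/
theorem isKernelCoeff_kernelCoeff (h : IsDHat ω) (h0 : 0 < hat ω 0) :
    IsKernelCoeff (kernelScale ω 0) (kernelCoeff ω) := by
  refine ⟨?_, ?_, fun m => ?_⟩
  · have := h.oddMoment_pos h0 0
    simp only [kernelCoeff]
    positivity
  · obtain ⟨K, hK0, hK⟩ := (h.isSymbol_oddMoment h0 0).bound_pos (h.isModerate_hat h0).pos
    refine ⟨1 / (2 * K), by positivity, fun k => ?_⟩
    have h1 := h.oddMoment_pos h0 k
    have h2 := h.hat_pos h0 (one_sub_inv_mem k)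
    have h3 := (le_abs_self _).trans (hK k)
    rw [coeffModel_kernelScale, kernelCoeff]
    calc _ = 1 / (2 * ((k : ℝ) + 1) ^ 2 * (K * hat ω (1 - 1 / ((k : ℝ) + 1)))) := by
          generalize hat ω (1 - 1 / ((k : ℝ) + 1)) = y
          rw [pow_zero, one_mul]; field_simp
      _ ≤ _ := by gcongr
  · obtain ⟨δ, hδ, hlow⟩ := h.le_oddMoment
    have h1 := (h.isSymbol_oddMoment h0 m).inv (h.isModerate_hat h0) (h.isModerate_hat_inv h0) hδ hlow
    have h2 := (IsSymbol.natCast_add_one m).inv isModerate_natCast_add_one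
      isModerate_natCast_add_one_inv one_pos (fun n => by rw [one_mul])
    have hM := isModerate_natCast_add_one_inv
    have h3 := (h2.mul hM hM h2).mul (hM.mul hM) (h.isModerate_hat_inv h0) h1
    have h4 := (IsSymbol.const m (1 / 2) (b := fun _ => 1) (fun _ => zero_le_one)
      ⟨1 / 2, fun n => by rw [abs_of_pos (by norm_num)]; norm_num⟩)
    have h5 := h4.mul ⟨fun _ => one_pos, 1, fun _ => by norm_num⟩
      ((hM.mul hM).mul (h.isModerate_hat_inv h0)) h3
    convert h5 using 2 with k k
    · rw [coeffModel_kernelScale, pow_zero]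
    · rw [kernelCoeff]
      have := (h.oddMoment_pos h0 k).ne'
      field_simp

theorem isKernelCoeff_derivCoeff (h : IsDHat ω) (h0 : 0 < hat ω 0) {N : ℕ} {c : ℕ → ℝ}
    (hc : IsKernelCoeff (kernelScale ω N) c) :
    IsKernelCoeff (kernelScale ω (N + 1)) (derivCoeff c) := by
  obtain ⟨C, hD⟩ := h.isDoubling_kernelScale h0 N
  obtain ⟨δ, hδ, hlow⟩ := hc.lower
  have hmodel : ∀ k : ℕ, coeffModel (kernelScale ω (N + 1)) k =
      ((k : ℝ) + 1) * coeffModel (kernelScale ω N) k := fun k => by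
    rw [coeffModel_kernelScale, coeffModel_kernelScale]; ring
  refine ⟨?_, ⟨δ / 4, by positivity, fun k => ?_⟩, fun m => ?_⟩
  · have := (mul_pos hδ (hD.coeffModel_pos 0)).trans_le (hlow 0)
    simpa [derivCoeff] using this
  · have h1 : coeffModel (kernelScale ω N) k ≤ 4 * coeffModel (kernelScale ω N) (k + 1) := by
      rw [coeffModel_kernelScale, coeffModel_kernelScale]
      have h2 := h.hat_pos h0 (one_sub_inv_mem k)
      have h3 := h.hat_pos h0 (one_sub_inv_mem (k + 1))
      have h4 : hat ω (1 - 1 / (((k + 1 : ℕ) : ℝ) + 1)) ≤ hat ω (1 - 1 / ((k : ℝ) + 1)) := by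
        exact h.hat_anti (Ico_subset_Icc_self (one_sub_inv_mem k))
          (Ico_subset_Icc_self (one_sub_inv_mem (k + 1))) (one_sub_inv_le (Nat.le_succ k))
      have h5 : ((k : ℝ) + 1)⁻¹ ≤ 2 * (((k + 1 : ℕ) : ℝ) + 1)⁻¹ := by
        push_cast
        rw [← div_eq_mul_inv, inv_eq_one_div, div_le_div_iff₀ (by positivity) (by positivity)]
        linarith [k.cast_nonneg (α := ℝ)]
      have h6 : (k : ℝ) + 1 ≤ ((k + 1 : ℕ) : ℝ) + 1 := by push_cast; linarith
      calc ((k : ℝ) + 1) ^ N * (((k : ℝ) + 1)⁻¹ * ((k : ℝ) + 1)⁻¹ *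
            (hat ω (1 - 1 / ((k : ℝ) + 1)))⁻¹)
          ≤ (((k + 1 : ℕ) : ℝ) + 1) ^ N * ((2 * (((k + 1 : ℕ) : ℝ) + 1)⁻¹) *
            (2 * (((k + 1 : ℕ) : ℝ) + 1)⁻¹) * (hat ω (1 - 1 / (((k + 1 : ℕ) : ℝ) + 1)))⁻¹) := by
            gcongr
        _ = _ := by ring
    rw [hmodel, derivCoeff]
    have h7 := hlow (k + 1)
    have h8 := hD.coeffModel_pos (k + 1)
    calc δ / 4 * (((k : ℝ) + 1) * coeffModel (kernelScale ω N) k)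
        ≤ δ / 4 * (((k : ℝ) + 1) * (4 * coeffModel (kernelScale ω N) (k + 1))) := by gcongr
      _ = ((k : ℝ) + 1) * (δ * coeffModel (kernelScale ω N) (k + 1)) := by ring
      _ ≤ (((k + 1 : ℕ) : ℝ) + 1) * c (k + 1 + 1) := by
          gcongr
          linarith
  · have h1 := (IsSymbol.natCast_add_one m).shift isModerate_natCast_add_one
    have h2 := (hc.isSymbol m).shift hD.isModerate_coeffModel
    have h3 := h1.mul isModerate_natCast_add_one hD.isModerate_coeffModel h2
    rwa [show coeffModel (kernelScale ω (N + 1)) = _ from funext hmodel]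

theorem isKernelCoeff_iterate (h : IsDHat ω) (h0 : 0 < hat ω 0) (N : ℕ) :
    IsKernelCoeff (kernelScale ω N) (derivCoeff^[N] (kernelCoeff ω)) := by
  induction N with
  | zero => exact h.isKernelCoeff_kernelCoeff h0
  | succ N ih =>
    rw [Function.iterate_succ_apply']
    exact h.isKernelCoeff_derivCoeff h0 ih

end IsDHat


/-! ### Polar coordinates and the reproducing kernel -/

theorem integrableOn_polarCoord_symm {E : Type*} [NormedAddCommGroup E] [NormedSpace ℝ E]
    {g : ℂ → E} (hg : Integrable g) :
    IntegrableOn (fun p : ℝ × ℝ => p.1 • g (Complex.polarCoord.symm p)) polarCoord.target := by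
  have h1 : Integrable (g ∘ Complex.measurableEquivRealProd.symm) :=
    (Complex.volume_preserving_equiv_real_prod.symm).integrable_comp_of_integrable hg
  have h2 := (integrableOn_image_iff_integrableOn_abs_det_fderiv_smul volume
    polarCoord.open_target.measurableSet
    (fun p _ => (hasFDerivAt_polarCoord_symm p).hasFDerivWithinAt) polarCoord.symm.injOn
    (g ∘ Complex.measurableEquivRealProd.symm)).1 h1.integrableOn
  refine h2.congr_fun (fun p hp => ?_) polarCoord.open_target.measurableSet
  have hp1 : 0 < p.1 := hp.1
  simp only [det_fderivPolarCoordSymm, abs_of_pos hp1, Function.comp_apply,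
    Complex.measurableEquivRealProd_symm_polarCoord_symm_apply]

theorem polarCoord_symm_eq_circleMap (r θ : ℝ) :
    Complex.polarCoord.symm (r, θ) = circleMap 0 r θ := by
  rw [Complex.polarCoord_symm_apply, circleMap, zero_add, Complex.exp_mul_I]
  push_cast
  ring

theorem setIntegral_disc_eq {E : Type*} [NormedAddCommGroup E] [NormedSpace ℝ E]
    {g : ℂ → E} (hg : IntegrableOn g disc) :
    ∫ z in disc, g z ∂areaMeasure = (2 : ℝ) • ∫ r in (0 : ℝ)..1, r • circleAverage g 0 r := by
  have hpi := pi_pos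
  have hm : MeasurableSet disc := Metric.isOpen_ball.measurableSet
  have hgi : Integrable (disc.indicator g) := (integrable_indicator_iff hm).2 hg
  have h1 : ∫ z in disc, g z ∂areaMeasure = Real.pi⁻¹ • ∫ z, disc.indicator g z := by
    rw [areaMeasure, Measure.restrict_smul, integral_smul_measure,
      ENNReal.toReal_ofReal (by positivity), integral_indicator hm]
  have hin : ∀ r ∈ Ioi (0 : ℝ), ∫ θ in Ioo (-Real.pi) Real.pi,
      r • disc.indicator g (Complex.polarCoord.symm (r, θ)) =
      (Iio (1 : ℝ)).indicator (fun r => (2 * Real.pi) • r • circleAverage g 0 r) r := by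
    intro r hr
    have hr0 : (0 : ℝ) < r := hr
    by_cases hr1 : r < 1
    · rw [indicator_of_mem (by exact hr1), circleAverage_eq_symm,
        intervalIntegral.integral_of_le (by linarith), integral_Ioc_eq_integral_Ioo,
        integral_smul, smul_comm r, smul_inv_smul₀ (by positivity)]
      congr 1
      refine setIntegral_congr_fun measurableSet_Ioo fun θ _ => ?_
      simp only [polarCoord_symm_eq_circleMap]
      rw [indicator_of_mem]
      rw [disc, mem_ball_zero_iff, norm_circleMap_zero, abs_of_pos hr0]
      exact hr1
    · rw [indicator_of_notMem (by exact hr1)]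
      refine integral_eq_zero_of_ae (Eventually.of_forall fun θ => ?_)
      simp only [polarCoord_symm_eq_circleMap]
      rw [indicator_of_notMem, smul_zero]; rfl
      rw [disc, mem_ball_zero_iff, norm_circleMap_zero, abs_of_pos hr0]
      exact hr1
  rw [h1, ← Complex.integral_comp_polarCoord_symm, polarCoord_target, Measure.volume_eq_prod,
    setIntegral_prod]
  · rw [setIntegral_congr_fun measurableSet_Ioi hin, setIntegral_indicator measurableSet_Iio,
      Ioi_inter_Iio, integral_smul, ← integral_Ioc_eq_integral_Ioo,
      ← intervalIntegral.integral_of_le zero_le_one, smul_smul]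
    congr 1
    field_simp
  · exact integrableOn_polarCoord_symm hgi

theorem setIntegral_disc_mul {ω : ℝ → ℝ} {f : ℂ → ℂ}
    (hf : IntegrableOn (fun z : ℂ => f z * (ω ‖z‖ : ℂ)) disc) :
    ∫ z in disc, f z * (ω ‖z‖ : ℂ) ∂areaMeasure =
      2 * ∫ r in (0 : ℝ)..1, (r * ω r : ℝ) * circleAverage f 0 r := by
  rw [setIntegral_disc_eq hf, Complex.real_smul]
  push_cast
  congr 1
  refine intervalIntegral.integral_congr fun r hr => ?_
  rw [uIcc_of_le zero_le_one] at hr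
  have h1 : circleAverage (fun z : ℂ => f z * (ω ‖z‖ : ℂ)) 0 r =
      ω r • circleAverage f 0 r := by
    rw [← Real.circleAverage_fun_smul]
    refine Real.circleAverage_congr_sphere fun z hz => ?_
    rw [mem_sphere_zero_iff_norm, abs_of_nonneg hr.1] at hz
    simp only [hz, Complex.real_smul]
    ring
  simp only [h1, Complex.real_smul]
  ring

theorem setIntegral_disc_mul_real {ω : ℝ → ℝ} {f : ℂ → ℝ}
    (hf : IntegrableOn (fun z : ℂ => f z * ω ‖z‖) disc) :
    ∫ z in disc, f z * ω ‖z‖ ∂areaMeasure =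
      2 * ∫ r in (0 : ℝ)..1, r * circleAverage f 0 r * ω r := by
  rw [setIntegral_disc_eq hf, smul_eq_mul]
  congr 1
  refine intervalIntegral.integral_congr fun r hr => ?_
  rw [uIcc_of_le zero_le_one] at hr
  have h1 : circleAverage (fun z : ℂ => f z * ω ‖z‖) 0 r = ω r • circleAverage f 0 r := by
    rw [← Real.circleAverage_fun_smul]
    refine Real.circleAverage_congr_sphere fun z hz => ?_
    rw [mem_sphere_zero_iff_norm, abs_of_nonneg hr.1] at hz
    simp only [hz, smul_eq_mul]
    ring
  simp only [h1, smul_eq_mul]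
  ring

namespace IsDHat

variable {ω : ℝ → ℝ}

theorem integrableOn_disc (h : IsDHat ω) : IntegrableOn (fun z : ℂ => ω ‖z‖) disc := by
  rw [disc, integrableOn_fun_norm_addHaar]
  have : IntegrableOn ω (Icc 0 1) :=
    (integrableOn_Icc_iff_integrableOn_Ico (by simp)).2 h.integrableOn
  exact (this.continuousOn_smul (by fun_prop) isCompact_Icc).mono_set Ioo_subset_Icc_self

theorem mass_eq (h : IsDHat ω) : mass ω = 2 * oddMoment ω 0 := by
  have h1 := setIntegral_disc_mul_real (ω := ω) (f := fun _ => 1) (by simpa using h.integrableOn_disc)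
  simp only [one_mul, Real.circleAverage_const, mul_one] at h1
  simpa [mass, oddMoment] using h1

end IsDHat

/-- On the circle conj z = r²/z, so the mean becomes a Cauchy integral for a Taylor coefficient. -/
theorem circleAverage_mul_conj_pow {f : ℂ → ℂ} (hf : DifferentiableOn ℂ f disc) (n : ℕ) {r : ℝ}
    (hr : r ∈ Ioo (0 : ℝ) 1) :
    circleAverage (fun z => f z * conj z ^ n) 0 r =
      r ^ (2 * n) * ((n.factorial : ℂ)⁻¹ * iteratedDeriv n f 0) := by
  have hsub : Metric.closedBall (0 : ℂ) r ⊆ disc := Metric.closedBall_subset_ball hr.2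
  have hd : DiffContOnCl ℂ f (Metric.ball 0 r) := (hf.mono hsub).diffContOnCl_ball subset_rfl
  have h1 := hd.circleIntegral_one_div_sub_center_pow_smul hr.1 n
  have h2 : circleAverage (fun z => f z * conj z ^ n) 0 r =
      circleAverage (fun z => (r ^ (2 * n) : ℝ) • (1 / z ^ n * f z)) 0 r := by
    refine Real.circleAverage_congr_sphere fun z hz => ?_
    rw [mem_sphere_zero_iff_norm, abs_of_pos hr.1] at hz
    have hz0 : z ≠ 0 := norm_pos_iff.1 (by rw [hz]; exact hr.1)
    have h3 : conj z * z = (r : ℂ) ^ 2 := by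
      rw [mul_comm, Complex.mul_conj, Complex.normSq_eq_norm_sq, hz]; push_cast; rfl
    have h4 : conj z ^ n * z ^ n = (r : ℂ) ^ (2 * n) := by rw [← mul_pow, h3, ← pow_mul]
    simp only [Complex.real_smul]
    push_cast
    rw [← h4]
    field_simp
  have h5 : circleAverage (fun z => 1 / z ^ n * f z) 0 r =
      (n.factorial : ℂ)⁻¹ * iteratedDeriv n f 0 := by
    rw [Real.circleAverage_eq_circleIntegral hr.1.ne']
    have h6 : (∮ z in C(0, r), (z - 0)⁻¹ • (1 / z ^ n * f z)) =
        ∮ z in C(0, r), (1 / (z - 0) ^ (n + 1)) • f z := by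
      congr 1
      ext z
      simp only [sub_zero, smul_eq_mul, pow_succ]
      rw [one_div, one_div, mul_inv]
      ring
    rw [h6, h1]
    have : (2 * (Real.pi : ℂ) * Complex.I) ≠ 0 := by simp [pi_pos.ne']
    simp only [smul_eq_mul]
    field_simp
  rw [h2, Real.circleAverage_fun_smul, h5, Complex.real_smul]
  push_cast
  ring

/-- The explicit reproducing kernel. -/
noncomputable def kernelFun (ω : ℝ → ℝ) (a z : ℂ) : ℂ := powerSum (kernelCoeff ω) (conj a * z)

namespace IsDHat

variable {ω : ℝ → ℝ}

theorem isPolyBounded_iterate (h : IsDHat ω) (h0 : 0 < hat ω 0) (N : ℕ) :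
    IsPolyBounded (derivCoeff^[N] (kernelCoeff ω)) := by
  obtain ⟨C, hC⟩ := h.isDoubling_kernelScale h0 N
  exact (h.isKernelCoeff_iterate h0 N).isPolyBounded hC

theorem norm_conj_mul_lt {a z : ℂ} (ha : a ∈ disc) (hz : z ∈ disc) : ‖conj a * z‖ < 1 := by
  rw [disc, mem_ball_zero_iff] at ha hz
  rw [norm_mul, RCLike.norm_conj]
  nlinarith [norm_nonneg a, norm_nonneg z]

theorem hasDerivAt_iterate (h : IsDHat ω) (h0 : 0 < hat ω 0) (N : ℕ) {a z : ℂ} (ha : a ∈ disc)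
    (hz : z ∈ disc) :
    HasDerivAt (fun z => conj a ^ N * powerSum (derivCoeff^[N] (kernelCoeff ω)) (conj a * z))
      (conj a ^ (N + 1) * powerSum (derivCoeff^[N + 1] (kernelCoeff ω)) (conj a * z)) z := by
  have h1 := (h.isPolyBounded_iterate h0 N).hasDerivAt (norm_conj_mul_lt ha hz)
  have h2 : HasDerivAt (fun z : ℂ => conj a * z) (conj a) z := by
    simpa using (hasDerivAt_id z).const_mul (conj a)
  refine ((h1.comp z h2).const_mul (conj a ^ N)).congr_deriv ?_
  rw [Function.iterate_succ_apply', pow_succ]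
  have : derivCoeff (derivCoeff^[N] (kernelCoeff ω)) =
    fun n : ℕ => ((n : ℝ) + 1) * (derivCoeff^[N] (kernelCoeff ω)) (n + 1) := rfl
  rw [this]
  ring

/-- Stated for any K that agrees with the explicit kernel on the disc, because the chosen kernel is
determined only there; openness of the disc passes the equality to derivatives. -/
theorem iteratedDeriv_eq (h : IsDHat ω) (h0 : 0 < hat ω 0) {a : ℂ} (ha : a ∈ disc) {K : ℂ → ℂ}
    (hK : EqOn K (kernelFun ω a) disc) (N : ℕ) :
    EqOn (iteratedDeriv N K)
      (fun z => conj a ^ N * powerSum (derivCoeff^[N] (kernelCoeff ω)) (conj a * z)) disc := by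
  induction N with
  | zero =>
    intro z hz
    simpa [kernelFun] using hK hz
  | succ N ih =>
    intro z hz
    rw [iteratedDeriv_succ]
    have h1 : iteratedDeriv N K =ᶠ[𝓝 z] fun z =>
        conj a ^ N * powerSum (derivCoeff^[N] (kernelCoeff ω)) (conj a * z) :=
      ih.eventuallyEq_of_mem (Metric.isOpen_ball.mem_nhds hz)
    rw [h1.deriv_eq]
    exact (h.hasDerivAt_iterate h0 N ha hz).deriv

/-- For fixed a, the product conj a · z stays in the disc of radius |a| < 1, where the series
converges uniformly. Boundedness puts the derivatives in every A^p_v. -/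
theorem exists_norm_iterate_le (h : IsDHat ω) (h0 : 0 < hat ω 0) (N : ℕ) {a : ℂ} (ha : a ∈ disc) :
    ∃ B : ℝ, ∀ z ∈ disc,
      ‖conj a ^ N * powerSum (derivCoeff^[N] (kernelCoeff ω)) (conj a * z)‖ ≤ B := by
  have ha' : ‖a‖ < 1 := mem_ball_zero_iff.1 ha
  have hs := (h.isPolyBounded_iterate h0 N).summable_norm ha'
  refine ⟨‖conj a ^ N‖ * ∑' n, ‖((derivCoeff^[N] (kernelCoeff ω)) n : ℂ) * a ^ n‖, fun z hz => ?_⟩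
  rw [norm_mul]
  gcongr
  refine tsum_of_norm_bounded hs.hasSum fun n => ?_
  have hz' : ‖z‖ < 1 := mem_ball_zero_iff.1 hz
  rw [norm_mul, norm_mul, norm_pow, norm_pow, norm_mul, RCLike.norm_conj]
  gcongr
  exact mul_le_of_le_one_right (norm_nonneg _) hz'.le

end IsDHat


theorem integrableOn_areaMeasure {E : Type*} [NormedAddCommGroup E] {g : ℂ → E} :
    IntegrableOn g disc areaMeasure ↔ IntegrableOn g disc := by
  rw [IntegrableOn, areaMeasure, Measure.restrict_smul,
    integrable_smul_measure (by simp [Real.pi_pos]) (by simp), IntegrableOn]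

theorem setIntegral_areaMeasure_conj (g : ℂ → ℂ) :
    ∫ z in disc, conj (g z) ∂areaMeasure = conj (∫ z in disc, g z ∂areaMeasure) := integral_conj

theorem dirichletInner_conj (ω : ℝ → ℝ) (f g : ℂ → ℂ) :
    conj (dirichletInner ω f g) = dirichletInner ω g f := by
  simp only [dirichletInner, map_add, map_mul, Complex.conj_conj, Complex.conj_ofReal,
    ← setIntegral_areaMeasure_conj]
  congr 1
  · ring
  · congr 1
    ext z
    ring

namespace IsDHat

variable {ω : ℝ → ℝ}

theorem integrableOn_mul (h : IsDHat ω) {f : ℂ → ℝ} {B : ℝ} (hf : ContinuousOn f disc)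
    (hB : ∀ z ∈ disc, ‖f z‖ ≤ B) : IntegrableOn (fun z : ℂ => f z * ω ‖z‖) disc := by
  have hm : MeasurableSet disc := Metric.isOpen_ball.measurableSet
  exact h.integrableOn_disc.bdd_mul (hf.aestronglyMeasurable hm)
    ((ae_restrict_mem hm).mono hB)

theorem differentiableOn_of_eqOn (h : IsDHat ω) (h0 : 0 < hat ω 0) {a : ℂ} (ha : a ∈ disc)
    {K : ℂ → ℂ} (hK : EqOn K (kernelFun ω a) disc) (N : ℕ) :
    DifferentiableOn ℂ (iteratedDeriv N K) disc := by
  refine DifferentiableOn.congr (fun z hz => ?_) (h.iteratedDeriv_eq h0 ha hK N)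
  exact (h.hasDerivAt_iterate h0 N ha hz).differentiableAt.differentiableWithinAt

theorem memBergman_of_eqOn (h : IsDHat ω) (h0 : 0 < hat ω 0) {a : ℂ} (ha : a ∈ disc)
    {K : ℂ → ℂ} (hK : EqOn K (kernelFun ω a) disc) (N : ℕ) {p : ℝ} (hp : 0 < p) {v : ℝ → ℝ}
    (hv : IsDHat v) : MemBergman p v (iteratedDeriv N K) := by
  have hd := h.differentiableOn_of_eqOn h0 ha hK N
  obtain ⟨B, hB⟩ := h.exists_norm_iterate_le h0 N ha
  refine ⟨hd, integrableOn_areaMeasure.2 (hv.integrableOn_mul (B := B ^ p)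
    (hd.continuousOn.norm.rpow_const fun _ _ => Or.inr hp.le) fun z hz => ?_)⟩
  rw [Real.norm_of_nonneg (by positivity)]
  have := (congrArg norm (h.iteratedDeriv_eq h0 ha hK N hz)).le.trans (hB z hz)
  gcongr

theorem memDirichlet_kernelFun (h : IsDHat ω) (h0 : 0 < hat ω 0) {a : ℂ} (ha : a ∈ disc) :
    MemDirichlet ω (kernelFun ω a) := by
  have h1 := h.memBergman_of_eqOn h0 ha (eqOn_refl _ _) 1 two_pos h
  refine ⟨by simpa using h.differentiableOn_of_eqOn h0 ha (eqOn_refl _ _) 0, ?_⟩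
  simpa [MemBergman, iteratedDeriv_one] using h1.2

/-- Uses |f'| ≤ |f'|² + 1 and the finite mass of ω. -/
theorem integrableOn_deriv_mul (h : IsDHat ω) {f : ℂ → ℂ} (hf : MemDirichlet ω f) :
    IntegrableOn (fun z : ℂ => deriv f z * (ω ‖z‖ : ℂ)) disc := by
  have hm : MeasurableSet disc := Metric.isOpen_ball.measurableSet
  have hw := h.integrableOn_disc
  have hd : ContinuousOn (deriv f) disc := (hf.1.deriv Metric.isOpen_ball).continuousOn
  refine ((integrableOn_areaMeasure.1 hf.2).add hw).mono'
    ((hd.aestronglyMeasurable hm).mul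
      (Complex.continuous_ofReal.comp_aestronglyMeasurable hw.aestronglyMeasurable))
    ((ae_restrict_mem hm).mono fun z hz => ?_)
  have h1 := h.nonneg ‖z‖ ⟨norm_nonneg z, mem_ball_zero_iff.1 hz⟩
  rw [norm_mul, Complex.norm_real, Real.norm_of_nonneg h1, Pi.add_apply, ← add_one_mul]
  gcongr
  nlinarith [sq_nonneg (‖deriv f z‖ - 1)]

theorem integrableOn_deriv_mul_conj_pow (h : IsDHat ω) {f : ℂ → ℂ} (hf : MemDirichlet ω f)
    (n : ℕ) : IntegrableOn (fun z : ℂ => deriv f z * conj z ^ n * (ω ‖z‖ : ℂ)) disc := by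
  have hm : MeasurableSet disc := Metric.isOpen_ball.measurableSet
  have h1 : IntegrableOn (fun z : ℂ => conj z ^ n * (deriv f z * (ω ‖z‖ : ℂ))) disc := by
    refine (h.integrableOn_deriv_mul hf).bdd_mul (c := 1)
      (Continuous.aestronglyMeasurable (by fun_prop)) ((ae_restrict_mem hm).mono fun z hz => ?_)
    rw [norm_pow, RCLike.norm_conj]
    exact pow_le_one₀ (norm_nonneg z) (mem_ball_zero_iff.1 hz).le
  refine h1.congr_fun (fun z _ => ?_) hm
  simp only []
  ring

theorem setIntegral_deriv_mul_conj_pow (h : IsDHat ω) {f : ℂ → ℂ} (hf : MemDirichlet ω f)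
    (n : ℕ) : ∫ z in disc, deriv f z * conj z ^ n * (ω ‖z‖ : ℂ) ∂areaMeasure =
      2 * oddMoment ω n * ((n.factorial : ℂ)⁻¹ * iteratedDeriv n (deriv f) 0) := by
  rw [setIntegral_disc_mul (h.integrableOn_deriv_mul_conj_pow hf n), mul_assoc]
  congr 1
  rw [oddMoment, ← intervalIntegral.integral_ofReal, ← intervalIntegral.integral_mul_const,
    intervalIntegral.integral_of_le zero_le_one, intervalIntegral.integral_of_le zero_le_one,
    integral_Ioc_eq_integral_Ioo, integral_Ioc_eq_integral_Ioo]
  refine setIntegral_congr_fun measurableSet_Ioo fun r hr => ?_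
  simp only [circleAverage_mul_conj_pow (hf.1.deriv Metric.isOpen_ball) n hr]
  push_cast
  ring

theorem hasSum_conj_deriv_kernelFun (h : IsDHat ω) (h0 : 0 < hat ω 0) {a z : ℂ} (ha : a ∈ disc)
    (hz : z ∈ disc) : HasSum (fun n : ℕ => (derivCoeff (kernelCoeff ω) n : ℂ) * a ^ (n + 1) *
      conj z ^ n) (conj (deriv (kernelFun ω a) z)) := by
  have h1 := h.iteratedDeriv_eq h0 ha (eqOn_refl (kernelFun ω a) _) 1 hz
  simp only [iteratedDeriv_one, pow_one, Function.iterate_one] at h1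
  have h2 := ((h.isPolyBounded_iterate h0 1).summable (norm_conj_mul_lt ha hz)).hasSum
  have h3 := (h2.mul_left (conj a)).map (starRingEnd ℂ) Complex.continuous_conj
  rw [h1, powerSum]
  simp only [Function.iterate_one] at h3
  refine HasSum.congr_fun h3 fun n => ?_
  simp only [Function.comp_apply, map_mul, map_pow, Complex.conj_conj, Complex.conj_ofReal]
  ring

/-- The derivative of the kernel is expanded and integrated termwise, dominated by a summable
sequence times |f'|ω. Each moment cancels against the one in the denominator of `kernelCoeff`,
leaving the Taylor terms of f at a. -/
theorem hasSum_dirichletInner (h : IsDHat ω) (h0 : 0 < hat ω 0) {a : ℂ} (ha : a ∈ disc)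
    {f : ℂ → ℂ} (hf : MemDirichlet ω f) :
    HasSum (fun n : ℕ => ((n + 1).factorial : ℂ)⁻¹ * iteratedDeriv (n + 1) f 0 * a ^ (n + 1))
      (∫ z in disc, deriv f z * conj (deriv (kernelFun ω a) z) * (ω ‖z‖ : ℂ) ∂areaMeasure) := by
  have hm : MeasurableSet disc := Metric.isOpen_ball.measurableSet
  have hae : ∀ᵐ z ∂(areaMeasure.restrict disc), z ∈ disc := ae_restrict_mem hm
  have ha' : ‖a‖ < 1 := mem_ball_zero_iff.1 ha
  set c := derivCoeff (kernelCoeff ω) with hc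
  have hs : Summable fun n => ‖(c n : ℂ) * a ^ (n + 1)‖ := by
    refine ((((h.isPolyBounded_iterate h0 1).summable_norm ha').mul_left ‖a‖)).congr fun n => ?_
    rw [← norm_mul, Function.iterate_one, pow_succ]
    congr 1
    ring
  have key := hasSum_integral_of_dominated_convergence (μ := areaMeasure.restrict disc)
    (F := fun n z => ((c n : ℂ) * a ^ (n + 1)) * (deriv f z * conj z ^ n * (ω ‖z‖ : ℂ)))
    (f := fun z => deriv f z * conj (deriv (kernelFun ω a) z) * (ω ‖z‖ : ℂ))
    (fun n z => ‖(c n : ℂ) * a ^ (n + 1)‖ * ‖deriv f z * (ω ‖z‖ : ℂ)‖)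
    (fun n => ((integrableOn_areaMeasure.2
      (h.integrableOn_deriv_mul_conj_pow hf n)).const_mul _).aestronglyMeasurable)
    (fun n => hae.mono fun z hz => ?_) (.of_forall fun z => hs.mul_right _) ?_
    (hae.mono fun z hz => ?_)
  · refine HasSum.congr_fun key fun n => ?_
    rw [integral_const_mul, h.setIntegral_deriv_mul_conj_pow hf n, hc, derivCoeff, kernelCoeff,
      iteratedDeriv_succ', Nat.factorial_succ]
    have h1 : (oddMoment ω n : ℂ) ≠ 0 := by exact_mod_cast (h.oddMoment_pos h0 n).ne'
    have h2 : (n : ℂ) + 1 ≠ 0 := by exact_mod_cast Nat.succ_ne_zero n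
    have h3 : (n.factorial : ℂ) ≠ 0 := by exact_mod_cast n.factorial_ne_zero
    push_cast
    field_simp
  · rw [norm_mul]
    gcongr
    rw [mul_right_comm, norm_mul _ (conj z ^ n), norm_pow, RCLike.norm_conj]
    exact mul_le_of_le_one_right (norm_nonneg _)
      (pow_le_one₀ (norm_nonneg z) (mem_ball_zero_iff.1 hz).le)
  · simp only [tsum_mul_right]
    exact (integrableOn_areaMeasure.2 (h.integrableOn_deriv_mul hf)).norm.const_mul _
  · have h1 := (h.hasSum_conj_deriv_kernelFun h0 ha hz).mul_left (deriv f z * (ω ‖z‖ : ℂ))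
    rw [mul_right_comm]
    refine HasSum.congr_fun h1 fun n => ?_
    ring

theorem isReproducingKernel_kernelFun (h : IsDHat ω) (h0 : 0 < hat ω 0) {a : ℂ}
    (ha : a ∈ disc) : IsReproducingKernel ω a (kernelFun ω a) := by
  refine ⟨h.memDirichlet_kernelFun h0 ha, fun f hf => ?_⟩
  have h1 := Complex.hasSum_taylorSeries_on_ball (r := 1) (c := (0 : ℂ)) hf.1 ha
  rw [hasSum_nat_add_iff' 1 |>.symm] at h1
  have h2 := (h.hasSum_dirichletInner h0 ha hf)
  have h3 : f a - f 0 =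
      ∫ z in disc, deriv f z * conj (deriv (kernelFun ω a) z) * (ω ‖z‖ : ℂ) ∂areaMeasure := by
    refine HasSum.unique ?_ h2
    simpa [mul_comm, mul_left_comm, mul_assoc] using h1
  have h4 : conj (kernelFun ω a 0) * (mass ω : ℂ) = 1 := by
    have h5 : kernelFun ω a 0 = (kernelCoeff ω 0 : ℂ) := by
      rw [kernelFun, mul_zero, powerSum, tsum_eq_single 0 fun n hn => by simp [hn]]
      simp
    have h6 := h.oddMoment_pos h0 0
    rw [h5, Complex.conj_ofReal, h.mass_eq, kernelCoeff]
    norm_cast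
    field_simp
  rw [dirichletInner, ← h3, mul_assoc, h4]
  ring

/-- Uniqueness by symmetry: K(b) = ⟨K, k_b⟩ = conj ⟨k_b, K⟩ = conj k_b(a) = k_a(b), where k denotes
the explicit kernel. -/
theorem eqOn_of_isReproducingKernel (h : IsDHat ω) (h0 : 0 < hat ω 0) {a : ℂ}
    {K : ℂ → ℂ} (hK : IsReproducingKernel ω a K) : EqOn K (kernelFun ω a) disc := by
  intro b hb
  have h1 := (h.isReproducingKernel_kernelFun h0 hb).2 K hK.1
  have h2 := hK.2 _ (h.memDirichlet_kernelFun h0 hb)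
  rw [h1, ← dirichletInner_conj, ← h2, kernelFun, kernelFun, powerSum, powerSum,
    ← Complex.conjCLE_apply, ContinuousLinearEquiv.map_tsum]
  congr 1
  ext n
  simp [mul_comm]

theorem isReproducingKernel_dirichletKernel (h : IsDHat ω) (h0 : 0 < hat ω 0) {a : ℂ}
    (ha : a ∈ disc) : IsReproducingKernel ω a (dirichletKernel ω a) := by
  have hex : ∃ K, IsReproducingKernel ω a K := ⟨_, h.isReproducingKernel_kernelFun h0 ha⟩
  rw [dirichletKernel, dif_pos hex]
  exact hex.choose_spec

theorem eqOn_dirichletKernel (h : IsDHat ω) (h0 : 0 < hat ω 0) {a : ℂ} (ha : a ∈ disc) :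
    EqOn (dirichletKernel ω a) (kernelFun ω a) disc :=
  h.eqOn_of_isReproducingKernel h0 (h.isReproducingKernel_dirichletKernel h0 ha)

end IsDHat


/-! ### Integrating primitives against a second weight -/

namespace IsDoubling

variable {φ ψ : ℝ → ℝ} {C : ℝ}

theorem rpow (h : IsDoubling ψ C) {p : ℝ} (hp : 0 < p) :
    IsDoubling (fun t => ψ t ^ p) (C ^ p) where
  continuousOn := h.continuousOn.rpow_const fun s hs => Or.inl (h.pos s hs).ne'
  pos t ht := Real.rpow_pos_of_pos (h.pos t ht) p
  le_mul t s h0 hts hs ht := by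
    have h1 := h.pos t ⟨h0, ht⟩
    rw [← Real.mul_rpow (zero_le_one.trans h.one_le) h1.le]
    exact Real.rpow_le_rpow (h.pos s ⟨h0.trans hts, by linarith⟩).le (h.le_mul t s h0 hts hs ht)
      hp.le

theorem intervalIntegrable (h : IsDoubling φ C) {a b : ℝ} (ha : a ∈ Ico (0 : ℝ) 1)
    (hb : b ∈ Ico (0 : ℝ) 1) : IntervalIntegrable φ volume a b :=
  (h.continuousOn.mono (ordConnected_Ico.uIcc_subset ha hb)).intervalIntegrable

theorem integral_nonneg (h : IsDoubling φ C) {a b : ℝ} (ha : 0 ≤ a) (hab : a ≤ b) (hb : b < 1) :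
    0 ≤ ∫ t in a..b, φ t :=
  intervalIntegral.integral_nonneg hab fun t ht => (h.pos t ⟨ha.trans ht.1, ht.2.trans_lt hb⟩).le

theorem integral_mono_right (h : IsDoubling φ C) {a b : ℝ} (ha : 0 ≤ a) (hab : a ≤ b)
    (hb : b < 1) : ∫ t in (0 : ℝ)..a, φ t ≤ ∫ t in (0 : ℝ)..b, φ t := by
  have h1 := intervalIntegral.integral_add_adjacent_intervals
    (h.intervalIntegrable ⟨le_rfl, one_pos⟩ ⟨ha, hab.trans_lt hb⟩)
    (h.intervalIntegrable ⟨ha, hab.trans_lt hb⟩ ⟨ha.trans hab, hb⟩)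
  linarith [h.integral_nonneg ha hab hb]

theorem integral_half_pos (h : IsDoubling φ C) : 0 < ∫ t in (0 : ℝ)..1 / 2, φ t :=
  intervalIntegral.intervalIntegral_pos_of_pos_on
    (h.intervalIntegrable ⟨le_rfl, one_pos⟩ ⟨by norm_num, by norm_num⟩)
    (fun t ht => h.pos t ⟨ht.1.le, by linarith [ht.2]⟩) (by norm_num)

theorem one_add_integral_le (h : IsDoubling φ C) :
    ∃ K : ℝ, 0 < K ∧ ∀ u ∈ Ico (1 / 2 : ℝ) 1,
      1 + ∫ t in (0 : ℝ)..u, φ t ≤ K * ∫ t in (0 : ℝ)..u, φ t := by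
  have h1 := h.integral_half_pos
  refine ⟨(∫ t in (0 : ℝ)..1 / 2, φ t)⁻¹ + 1, by positivity, fun u hu => ?_⟩
  have h2 := h.integral_mono_right (by norm_num) hu.1 hu.2
  rw [add_mul, one_mul]
  gcongr
  rwa [inv_mul_eq_div, one_le_div h1]

theorem mapsTo_mul_left {α : ℝ} (hα : α ∈ Ico (0 : ℝ) 1) :
    MapsTo (fun t => α * t) (Icc 0 1) (Ico 0 1) := fun _ ht =>
  ⟨mul_nonneg hα.1 ht.1, (mul_le_of_le_one_right hα.1 ht.2).trans_lt hα.2⟩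

theorem continuousOn_comp_mul (h : IsDoubling φ C) {α : ℝ} (hα : α ∈ Ico (0 : ℝ) 1) :
    ContinuousOn (fun t => φ (α * t)) (Icc 0 1) :=
  h.continuousOn.comp (by fun_prop) (mapsTo_mul_left hα)

theorem continuousOn_primitive_comp_mul (h : IsDoubling φ C) {α : ℝ} (hα : α ∈ Ico (0 : ℝ) 1) :
    ContinuousOn (fun r => ∫ t in (0 : ℝ)..α * r, φ t) (Icc 0 1) := by
  have h1 : ContinuousOn (fun x => ∫ t in (0 : ℝ)..x, φ t) (Icc 0 α) := by
    have h2 := intervalIntegral.continuousOn_primitive_interval (μ := volume) (f := φ) (a := 0)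
      (b := α) ((h.continuousOn.mono (ordConnected_Ico.uIcc_subset ⟨le_rfl, one_pos⟩
        hα)).integrableOn_compact isCompact_uIcc)
    rwa [uIcc_of_le hα.1] at h2
  exact h1.comp (by fun_prop) fun t ht =>
    ⟨mul_nonneg hα.1 ht.1, mul_le_of_le_one_right hα.1 ht.2⟩

end IsDoubling

namespace IsDHat

variable {φ v : ℝ → ℝ} {C : ℝ}

theorem intervalIntegrable_mul_hat (hv : IsDHat v) (h : IsDoubling φ C) {a b : ℝ}
    (ha : a ∈ Ico (0 : ℝ) 1) (hb : b ∈ Ico (0 : ℝ) 1) :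
    IntervalIntegrable (fun t => φ t * hat v t) volume a b :=
  ((h.continuousOn.mul (hv.continuousOn_hat.mono Ico_subset_Icc_self)).mono
    (ordConnected_Ico.uIcc_subset ha hb)).intervalIntegrable

theorem integral_one_add_primitive_mul (hv : IsDHat v) (h : IsDoubling φ C) {α : ℝ}
    (hα : α ∈ Ico (0 : ℝ) 1) :
    ∫ r in (0 : ℝ)..1, (1 + ∫ t in (0 : ℝ)..α * r, φ t) * v r =
      hat v 0 + ∫ t in (0 : ℝ)..1, α * φ (α * t) * hat v t := by
  have hc : ContinuousOn (fun t => α * φ (α * t)) (uIcc 0 1) := by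
    rw [uIcc_of_le zero_le_one]
    exact continuousOn_const.mul (h.continuousOn_comp_mul hα)
  rw [← integral_primitive_mul_eq hc.intervalIntegrable hv.intervalIntegrable, hat,
    ← intervalIntegral.integral_add hv.intervalIntegrable]
  · congr 1
    ext r
    rw [intervalIntegral.integral_const_mul, intervalIntegral.mul_integral_comp_mul_left, mul_zero,
      add_mul, one_mul]
  · refine hv.intervalIntegrable.continuousOn_mul ?_
    rw [uIcc_of_le zero_le_one]
    refine (h.continuousOn_primitive_comp_mul hα).congr fun r _ => ?_
    rw [intervalIntegral.integral_const_mul, intervalIntegral.mul_integral_comp_mul_left, mul_zero]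

/-- Three doublings, through 1/2 and 3/4, reach 7/8, the threshold used later for r and |a|. -/
theorem hat_zero_le (hv : IsDHat v) :
    ∃ K : ℝ, 0 < K ∧ ∀ t ∈ Icc (0 : ℝ) (7 / 8), hat v 0 ≤ K * hat v t := by
  obtain ⟨D, hD1, hD⟩ := hv.exists_doubling
  refine ⟨D * (D * D), by positivity, fun t ht => ?_⟩
  have h1 := hD 0 (1 / 2) le_rfl (by norm_num) (by norm_num) one_pos
  have h2 := hD (1 / 2) (3 / 4) (by norm_num) (by norm_num) (by norm_num) (by norm_num)
  have h3 := hD (3 / 4) (7 / 8) (by norm_num) (by norm_num) (by norm_num) (by norm_num)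
  have h4 : hat v (7 / 8) ≤ hat v t :=
    hv.hat_anti ⟨ht.1, by linarith [ht.2]⟩ ⟨by norm_num, by norm_num⟩ ht.2
  calc hat v 0 ≤ D * hat v (1 / 2) := h1
    _ ≤ D * (D * hat v (3 / 4)) := by gcongr
    _ ≤ D * (D * (D * hat v (7 / 8))) := by gcongr
    _ ≤ D * (D * (D * hat v t)) := by gcongr
    _ = D * (D * D) * hat v t := by ring

theorem integral_mul_hat_nonneg (hv : IsDHat v) (h : IsDoubling φ C) {a b : ℝ} (ha : 0 ≤ a)
    (hab : a ≤ b) (hb : b < 1) : 0 ≤ ∫ t in a..b, φ t * hat v t :=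
  intervalIntegral.integral_nonneg hab fun t ht =>
    mul_nonneg (h.pos t ⟨ha.trans ht.1, ht.2.trans_lt hb⟩).le
      (hv.hat_nonneg ⟨ha.trans ht.1, ht.2.trans hb.le⟩)

theorem hat_zero_le_integral (hv : IsDHat v) (h : IsDoubling φ C) :
    ∃ K : ℝ, 0 < K ∧ ∀ α ∈ Ico (1 / 2 : ℝ) 1,
      hat v 0 ≤ K * ∫ t in (0 : ℝ)..α, φ t * hat v t := by
  obtain ⟨K, hK0, hK⟩ := hv.hat_zero_le
  have hI := h.integral_half_pos
  have hm0 : (0 : ℝ) ∈ Ico (0 : ℝ) 1 := ⟨le_rfl, one_pos⟩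
  have hm1 : (1 / 2 : ℝ) ∈ Ico (0 : ℝ) 1 := ⟨by norm_num, by norm_num⟩
  refine ⟨K / ∫ t in (0 : ℝ)..1 / 2, φ t, by positivity, fun α hα => ?_⟩
  have hα' : α ∈ Ico (0 : ℝ) 1 := ⟨by linarith [hα.1], hα.2⟩
  have h1 := intervalIntegral.integral_add_adjacent_intervals
    (hv.intervalIntegrable_mul_hat h hm0 hm1) (hv.intervalIntegrable_mul_hat h hm1 hα')
  have h2 := hv.integral_mul_hat_nonneg h (by norm_num) hα.1 hα.2
  have h3 : (∫ t in (0 : ℝ)..1 / 2, φ t) * hat v 0 ≤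
      K * ∫ t in (0 : ℝ)..1 / 2, φ t * hat v t := by
    rw [← intervalIntegral.integral_mul_const, ← intervalIntegral.integral_const_mul]
    refine intervalIntegral.integral_mono_on (by norm_num)
      ((h.intervalIntegrable hm0 hm1).mul_const _)
      ((hv.intervalIntegrable_mul_hat h hm0 hm1).const_mul _) fun t ht => ?_
    have h4 := hK t ⟨ht.1, by linarith [ht.2]⟩
    have h5 := h.pos t ⟨ht.1, by linarith [ht.2]⟩
    calc φ t * hat v 0 ≤ φ t * (K * hat v t) := by gcongr
      _ = K * (φ t * hat v t) := by ring
  rw [div_mul_eq_mul_div, le_div_iff₀ hI, mul_comm]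
  refine h3.trans ?_
  gcongr
  linarith

/-- Rescaling by α puts v̂(αt) on the right, which is at least v̂(t). -/
theorem integral_mul_hat_le_integral_comp (hv : IsDHat v) (h : IsDoubling φ C) {α : ℝ}
    (hα : α ∈ Ico (0 : ℝ) 1) :
    ∫ t in (0 : ℝ)..1, α * φ (α * t) * hat v t ≤ ∫ t in (0 : ℝ)..α, φ t * hat v t := by
  have h1 : ∫ t in (0 : ℝ)..α, φ t * hat v t =
      ∫ t in (0 : ℝ)..1, α * (φ (α * t) * hat v (α * t)) := by
    rw [intervalIntegral.integral_const_mul,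
      intervalIntegral.mul_integral_comp_mul_left (f := fun t => φ t * hat v t)]
    simp
  have hc := continuousOn_const (c := α).mul (h.continuousOn_comp_mul hα)
  have hc' := continuousOn_const (c := α).mul ((h.continuousOn_comp_mul hα).mul
    (hv.continuousOn_hat.comp (by fun_prop)
      ((IsDoubling.mapsTo_mul_left hα).mono_right Ico_subset_Icc_self)))
  have hc2 := hc.mul hv.continuousOn_hat
  rw [← uIcc_of_le zero_le_one] at hc2 hc'
  rw [h1]
  refine intervalIntegral.integral_mono_on zero_le_one hc2.intervalIntegrable
    hc'.intervalIntegrable fun t ht => ?_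
  have h2 := IsDoubling.mapsTo_mul_left hα ht
  have h3 := h.pos _ h2
  have h4 := hv.hat_anti (Ico_subset_Icc_self h2) ht (mul_le_of_le_one_left ht.1 hα.2.le)
  have h5 := hα.1
  simp only [mul_assoc]
  gcongr

theorem integral_one_add_primitive_mul_le (hv : IsDHat v) (h : IsDoubling φ C) :
    ∃ K : ℝ, 0 < K ∧ ∀ α ∈ Ico (1 / 2 : ℝ) 1,
      ∫ r in (0 : ℝ)..1, (1 + ∫ t in (0 : ℝ)..α * r, φ t) * v r ≤
        K * ∫ t in (0 : ℝ)..α, φ t * hat v t := by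
  obtain ⟨K, hK0, hK⟩ := hv.hat_zero_le_integral h
  refine ⟨K + 1, by positivity, fun α hα => ?_⟩
  have hα' : α ∈ Ico (0 : ℝ) 1 := ⟨by linarith [hα.1], hα.2⟩
  rw [hv.integral_one_add_primitive_mul h hα']
  linarith [hK α hα, hv.integral_mul_hat_le_integral_comp h hα']

/-- The reverse comparison of v̂(αt) with v̂(t) needs t to be at most the midpoint of αt and 1. This
holds when αt ≤ 2α-1, which explains the shortened range. -/
theorem integral_mul_hat_le_comp (hv : IsDHat v) (h : IsDoubling φ C) :
    ∃ K : ℝ, 0 < K ∧ ∀ α ∈ Ico (3 / 4 : ℝ) 1,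
      ∫ t in (0 : ℝ)..2 * α - 1, φ t * hat v t ≤
        K * ∫ t in (0 : ℝ)..1, α * φ (α * t) * hat v t := by
  obtain ⟨D, hD1, hD⟩ := hv.exists_doubling
  refine ⟨D, by positivity, fun α hα => ?_⟩
  have hα0 : 0 < α := by linarith [hα.1]
  have hα' : α ∈ Ico (0 : ℝ) 1 := ⟨hα0.le, hα.2⟩
  set b := (2 * α - 1) / α with hb
  have hb0 : 0 ≤ b := div_nonneg (by linarith [hα.1]) hα0.le
  have hb1 : b ≤ 1 := by rw [hb, div_le_one hα0]; linarith [hα.2]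
  have hαb : α * b = 2 * α - 1 := mul_div_cancel₀ _ hα0.ne'
  have h1 : ∫ t in (0 : ℝ)..2 * α - 1, φ t * hat v t =
      ∫ t in (0 : ℝ)..b, α * (φ (α * t) * hat v (α * t)) := by
    rw [intervalIntegral.integral_const_mul,
      intervalIntegral.mul_integral_comp_mul_left (f := fun t => φ t * hat v t), hαb]
    simp
  have hc := continuousOn_const (c := α).mul (h.continuousOn_comp_mul hα')
  have hc' := continuousOn_const (c := α).mul ((h.continuousOn_comp_mul hα').mul
    (hv.continuousOn_hat.comp (by fun_prop)
      ((IsDoubling.mapsTo_mul_left hα').mono_right Ico_subset_Icc_self)))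
  have hc2 := hc.mul hv.continuousOn_hat
  have hsub : uIcc 0 b ⊆ Icc (0 : ℝ) 1 := by
    rw [uIcc_of_le hb0]; exact Icc_subset_Icc_right hb1
  have hsub' : uIcc b 1 ⊆ Icc (0 : ℝ) 1 := by
    rw [uIcc_of_le hb1]; exact Icc_subset_Icc_left hb0
  have h2 := intervalIntegral.integral_add_adjacent_intervals
    (ContinuousOn.intervalIntegrable (μ := volume) (hc2.mono hsub))
    (ContinuousOn.intervalIntegrable (μ := volume) (hc2.mono hsub'))
  have h3 : 0 ≤ ∫ t in b..1, α * φ (α * t) * hat v t :=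
    intervalIntegral.integral_nonneg hb1 fun t ht => by
      have ht' : t ∈ Icc (0 : ℝ) 1 := ⟨hb0.trans ht.1, ht.2⟩
      have := (h.pos _ (IsDoubling.mapsTo_mul_left hα' ht')).le
      have := hv.hat_nonneg ht'
      positivity
  rw [h1]
  have h4 : ∫ t in (0 : ℝ)..b, α * (φ (α * t) * hat v (α * t)) ≤
      D * ∫ t in (0 : ℝ)..b, α * φ (α * t) * hat v t := by
    rw [← intervalIntegral.integral_const_mul]
    refine intervalIntegral.integral_mono_on hb0 (hc'.mono hsub).intervalIntegrable
      ((hc2.mono hsub).intervalIntegrable.const_mul _) fun t ht => ?_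
    have ht' : t ∈ Icc (0 : ℝ) 1 := ⟨ht.1, ht.2.trans hb1⟩
    have h5 := IsDoubling.mapsTo_mul_left hα' ht'
    have h6 : α * t ≤ 2 * α - 1 := hαb ▸ mul_le_mul_of_nonneg_left ht.2 hα0.le
    -- Equivalent to t(2-α) ≤ 1, which follows from (2α-1)(2-α) = α - 2(1-α)² ≤ α.
    have h7 : t ≤ (1 + α * t) / 2 := by
      have : α * t * (2 - α) ≤ α := by
        nlinarith [sq_nonneg (α - 1), hα.2, mul_le_mul_of_nonneg_right h6 (by linarith [hα.2] :
          0 ≤ 2 - α)]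
      nlinarith
    have h8 := hD (α * t) t h5.1 (mul_le_of_le_one_left ht.1 hα.2.le) h7 h5.2
    have h9 := (h.pos _ h5).le
    calc α * (φ (α * t) * hat v (α * t)) ≤ α * (φ (α * t) * (D * hat v t)) := by gcongr
      _ = D * (α * φ (α * t) * hat v t) := by ring
  refine h4.trans ?_
  gcongr
  simp only [Pi.mul_apply] at h2
  linarith

/-- The map t ↦ (1+t)/2 restores the range lost near α: φ grows by at most C and v̂ decreases. -/
theorem integral_mul_hat_doubling (hv : IsDHat v) (h : IsDoubling φ C) {α : ℝ}
    (hα : α ∈ Ico (1 / 2 : ℝ) 1) :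
    ∫ t in (1 / 2 : ℝ)..α, φ t * hat v t ≤ C * ∫ t in (0 : ℝ)..2 * α - 1, φ t * hat v t := by
  have hm0 : (0 : ℝ) ∈ Ico (0 : ℝ) 1 := ⟨le_rfl, one_pos⟩
  have hβ : 2 * α - 1 ∈ Ico (0 : ℝ) 1 := ⟨by linarith [hα.1], by linarith [hα.2]⟩
  have hmaps : MapsTo (fun s : ℝ => 1 / 2 * s + 1 / 2) (Ico 0 1) (Ico 0 1) := fun s hs =>
    ⟨by linarith [hs.1], by linarith [hs.2]⟩
  have h1 : ∫ t in (1 / 2 : ℝ)..α, φ t * hat v t =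
      1 / 2 * ∫ s in (0 : ℝ)..2 * α - 1, φ (1 / 2 * s + 1 / 2) * hat v (1 / 2 * s + 1 / 2) := by
    rw [intervalIntegral.mul_integral_comp_mul_add (f := fun t => φ t * hat v t)]
    congr 1 <;> ring
  have hc := (h.continuousOn.mul (hv.continuousOn_hat.mono Ico_subset_Icc_self)).comp
    (by fun_prop) hmaps
  have h2 : ∫ s in (0 : ℝ)..2 * α - 1, φ (1 / 2 * s + 1 / 2) * hat v (1 / 2 * s + 1 / 2) ≤
      C * ∫ t in (0 : ℝ)..2 * α - 1, φ t * hat v t := by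
    rw [← intervalIntegral.integral_const_mul]
    refine intervalIntegral.integral_mono_on hβ.1
      (hc.mono (ordConnected_Ico.uIcc_subset hm0 hβ)).intervalIntegrable
      ((hv.intervalIntegrable_mul_hat h hm0 hβ).const_mul _) fun t ht => ?_
    have ht1 : t < 1 := ht.2.trans_lt hβ.2
    have ht' : t ∈ Ico (0 : ℝ) 1 := ⟨ht.1, ht1⟩
    have h3 := h.le_mul t (1 / 2 * t + 1 / 2) ht.1 (by linarith) (by linarith) ht1
    have h4 := hv.hat_anti (Ico_subset_Icc_self ht') (Ico_subset_Icc_self (hmaps ht'))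
      (by linarith : t ≤ 1 / 2 * t + 1 / 2)
    have h5 := hv.hat_nonneg (Ico_subset_Icc_self (hmaps ht'))
    have h6 := h.pos t ht'
    have h7 := h.one_le
    calc φ (1 / 2 * t + 1 / 2) * hat v (1 / 2 * t + 1 / 2)
        ≤ C * φ t * hat v t := by gcongr
      _ = C * (φ t * hat v t) := by ring
  have h3 := mul_nonneg (zero_le_one.trans h.one_le) (hv.integral_mul_hat_nonneg h le_rfl hβ.1 hβ.2)
  rw [h1]
  linarith

theorem integral_mul_hat_le (hv : IsDHat v) (h : IsDoubling φ C) :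
    ∃ K : ℝ, 0 < K ∧ ∀ α ∈ Ico (3 / 4 : ℝ) 1,
      ∫ t in (0 : ℝ)..α, φ t * hat v t ≤
        K * ∫ r in (0 : ℝ)..1, (1 + ∫ t in (0 : ℝ)..α * r, φ t) * v r := by
  obtain ⟨D, hD0, hD⟩ := hv.integral_mul_hat_le_comp h
  have hI := h.integral_half_pos
  have hC := h.one_le
  have hm0 : (0 : ℝ) ∈ Ico (0 : ℝ) 1 := ⟨le_rfl, one_pos⟩
  have hm1 : (1 / 2 : ℝ) ∈ Ico (0 : ℝ) 1 := ⟨by norm_num, by norm_num⟩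
  refine ⟨(∫ t in (0 : ℝ)..1 / 2, φ t) + C * D, by positivity, fun α hα => ?_⟩
  have hα' : α ∈ Ico (0 : ℝ) 1 := ⟨by linarith [hα.1], hα.2⟩
  have hα2 : α ∈ Ico (1 / 2 : ℝ) 1 := ⟨by linarith [hα.1], hα.2⟩
  have h0 : 0 ≤ hat v 0 := hv.hat_nonneg ⟨le_rfl, zero_le_one⟩
  have h1 := intervalIntegral.integral_add_adjacent_intervals
    (hv.intervalIntegrable_mul_hat h hm0 hm1) (hv.intervalIntegrable_mul_hat h hm1 hα')
  have h2 := hv.integral_mul_hat_doubling h hα2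
  have h3 : ∫ t in (0 : ℝ)..1 / 2, φ t * hat v t ≤ (∫ t in (0 : ℝ)..1 / 2, φ t) * hat v 0 := by
    rw [← intervalIntegral.integral_mul_const]
    refine intervalIntegral.integral_mono_on (by norm_num)
      (hv.intervalIntegrable_mul_hat h hm0 hm1) ((h.intervalIntegrable hm0 hm1).mul_const _)
      fun t ht => ?_
    have ht' : t ∈ Icc (0 : ℝ) 1 := ⟨ht.1, by linarith [ht.2]⟩
    have := h.pos t ⟨ht.1, by linarith [ht.2]⟩
    gcongr
    exact hv.hat_anti ⟨le_rfl, zero_le_one⟩ ht' ht.1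
  have h4 := mul_le_mul_of_nonneg_left (hD α hα) (zero_le_one.trans hC)
  have h5 : 0 ≤ ∫ t in (0 : ℝ)..1, α * φ (α * t) * hat v t :=
    intervalIntegral.integral_nonneg zero_le_one fun t ht =>
      mul_nonneg (mul_nonneg hα'.1 (h.pos _ (IsDoubling.mapsTo_mul_left hα' ht)).le)
        (hv.hat_nonneg ht)
  rw [hv.integral_one_add_primitive_mul h hα']
  nlinarith [mul_nonneg hI.le h5, mul_nonneg (mul_nonneg (zero_le_one.trans hC) hD0.le) h0]

end IsDHat


/-! ### Bergman norms and the final comparison -/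

theorem circleAverage_comp_mul_left {E : Type*} [NormedAddCommGroup E] [NormedSpace ℝ E]
    (g : ℂ → E) (w : ℂ) (r : ℝ) :
    circleAverage (fun z => g (w * z)) 0 r = circleAverage g 0 (‖w‖ * r) := by
  rw [Real.circleAverage_eq_integral_add (f := g) w.arg, Real.circleAverage_def]
  have h (θ : ℝ) : w * circleMap 0 r θ = circleMap 0 (‖w‖ * r) (θ + w.arg) := by
    nth_rewrite 1 [← Complex.norm_mul_exp_arg_mul_I w]
    simp only [circleMap, zero_add]
    push_cast
    rw [add_mul, Complex.exp_add]
    ring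
  simp only [h]

theorem circleAverage_nonneg {f : ℂ → ℝ} (hf : ∀ z, 0 ≤ f z) (r : ℝ) :
    0 ≤ circleAverage f 0 r := by
  rw [Real.circleAverage_def]
  exact smul_nonneg (by have := pi_pos; positivity)
    (intervalIntegral.integral_nonneg (by have := pi_pos; positivity) fun _ _ => hf _)

theorem IsPolyBounded.continuousOn_circleAverage {c : ℕ → ℝ} (hc : IsPolyBounded c) {p : ℝ}
    (hp : 0 < p) {α : ℝ} (hα : α ∈ Ico (0 : ℝ) 1) :
    ContinuousOn (fun r => circleAverage (fun z => ‖powerSum c z‖ ^ p) 0 (α * r)) (Icc 0 1) := by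
  set u : ℝ → ℝ := fun r => α * max 0 (min 1 r) with hu
  have hmem : ∀ r, u r ∈ Ico (0 : ℝ) 1 := fun r => IsDoubling.mapsTo_mul_left hα
    ⟨le_max_left _ _, max_le zero_le_one (min_le_left _ _)⟩
  have h1 : Continuous fun x : ℝ × ℝ => powerSum c (circleMap 0 (u x.1) x.2) := by
    refine hc.differentiableOn.continuousOn.comp_continuous ?_ fun x =>
      mem_ball_zero_iff.2 (circleMap_mem_disc (hmem x.1) x.2)
    simp only [circleMap]
    fun_prop
  have h2 : Continuous fun r => circleAverage (fun z => ‖powerSum c z‖ ^ p) 0 (u r) := by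
    simp only [Real.circleAverage_def]
    refine Continuous.const_smul (M := ℝ) (α := ℝ)
      (intervalIntegral.continuous_parametric_intervalIntegral_of_continuous' (μ := volume)
      (f := fun r θ => ‖powerSum c (circleMap 0 (u r) θ)‖ ^ p) ?_ 0 (2 * Real.pi)) _
    exact h1.norm.rpow_const fun _ => Or.inr hp.le
  refine h2.continuousOn.congr fun r hr => ?_
  simp only [hu, min_eq_right hr.2, max_eq_right hr.1]

namespace IsKernelCoeff

variable {ψ v : ℝ → ℝ} {C : ℝ} {c : ℕ → ℝ}

theorem integral_circleAverage_le (hc : IsKernelCoeff ψ c) (h : IsDoubling ψ C) {p : ℝ}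
    (hp : 0 < p) (hv : IsDHat v) :
    ∃ K : ℝ, 0 < K ∧ ∀ α ∈ Ico (0 : ℝ) 1,
      ∫ r in (0 : ℝ)..1, r * circleAverage (fun z => ‖powerSum c z‖ ^ p) 0 (α * r) * v r ≤
        K * ∫ r in (0 : ℝ)..1, (1 + ∫ t in (0 : ℝ)..α * r, ψ t ^ p) * v r := by
  obtain ⟨K, hK0, hK⟩ := hc.circleAverage_le h hp
  refine ⟨K, hK0, fun α hα => ?_⟩
  rw [← intervalIntegral.integral_const_mul]
  simp only [← mul_assoc]
  refine hv.integral_mul_mono ⟨le_rfl, zero_le_one⟩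
    (continuousOn_id.mul ((hc.isPolyBounded h).continuousOn_circleAverage hp hα))
    (continuousOn_const.mul
      (continuousOn_const.add ((h.rpow hp).continuousOn_primitive_comp_mul hα))) fun r hr => ?_
  have h1 := hK _ (IsDoubling.mapsTo_mul_left hα (Ico_subset_Icc_self hr))
  refine le_trans (mul_le_of_le_one_left (circleAverage_nonneg (fun z => ?_) _) hr.2.le) h1
  positivity

/-- The lower estimate of the means needs αr ≥ 3/4, so only r ≥ 7/8 is used. The part r ≤ 7/8 is at
most a constant times v̂(0), hence by doubling at most a constant times v̂(7/8), which the outer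
part dominates. -/
theorem le_integral_circleAverage (hc : IsKernelCoeff ψ c) (h : IsDoubling ψ C) {p : ℝ}
    (hp : 0 < p) (hv : IsDHat v) :
    ∃ K : ℝ, 0 < K ∧ ∀ α ∈ Ico (7 / 8 : ℝ) 1,
      ∫ r in (0 : ℝ)..1, (1 + ∫ t in (0 : ℝ)..α * r, ψ t ^ p) * v r ≤
        K * ∫ r in (0 : ℝ)..1,
          r * circleAverage (fun z => ‖powerSum c z‖ ^ p) 0 (α * r) * v r := by
  obtain ⟨K, hK0, hK⟩ := hc.le_circleAverage h hp
  obtain ⟨D, hD0, hD⟩ := hv.hat_zero_le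
  have hφ := h.rpow hp
  set I := ∫ t in (0 : ℝ)..7 / 8, ψ t ^ p with hI
  have hI0 : 0 ≤ I := hφ.integral_nonneg le_rfl (by norm_num) (by norm_num)
  refine ⟨((1 + I) * D + 1) * (2 * K), by positivity, fun α hα => ?_⟩
  have hα' : α ∈ Ico (0 : ℝ) 1 := ⟨by linarith [hα.1], hα.2⟩
  have hcS := (hc.isPolyBounded h).continuousOn_circleAverage hp hα'
  have hcI := continuousOn_const (c := (1 : ℝ)).add (hφ.continuousOn_primitive_comp_mul hα')
  have h0 : (0 : ℝ) ∈ Icc (0 : ℝ) 1 := ⟨le_rfl, zero_le_one⟩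
  have h78 : (7 / 8 : ℝ) ∈ Icc (0 : ℝ) 1 := ⟨by norm_num, by norm_num⟩
  have h1 : (1 : ℝ) ∈ Icc (0 : ℝ) 1 := ⟨zero_le_one, le_rfl⟩
  have hS0 : ∀ r, 0 ≤ circleAverage (fun z => ‖powerSum c z‖ ^ p) 0 r := fun r =>
    circleAverage_nonneg (fun z => by positivity) r
  have hIpos : ∀ r ∈ Icc (0 : ℝ) 1, 0 ≤ ∫ t in (0 : ℝ)..α * r, ψ t ^ p := fun r hr =>
    have := IsDoubling.mapsTo_mul_left hα' hr
    hφ.integral_nonneg le_rfl this.1 this.2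
  have hint : ∀ {f : ℝ → ℝ}, ContinuousOn f (Icc 0 1) → ∀ {x y : ℝ}, x ∈ Icc (0 : ℝ) 1 →
      y ∈ Icc (0 : ℝ) 1 → IntervalIntegrable (fun r => f r * v r) volume x y :=
    fun hf _ _ hx hy => (hv.intervalIntegrable_of_mem hx hy).continuousOn_mul
      (hf.mono (ordConnected_Icc.uIcc_subset hx hy))
  have hsub : Icc (7 / 8 : ℝ) 1 ⊆ Icc 0 1 := Icc_subset_Icc_left h78.1
  have hsplit := intervalIntegral.integral_add_adjacent_intervals
    (hint hcI h0 h78) (hint hcI h78 h1)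
  have hcr := continuousOn_id.mul hcS
  have hsplit' := intervalIntegral.integral_add_adjacent_intervals
    (hint hcr h0 h78) (hint hcr h78 h1)
  have hpos' : 0 ≤ ∫ r in (0 : ℝ)..7 / 8,
      (id r * circleAverage (fun z => ‖powerSum c z‖ ^ p) 0 (α * r)) * v r :=
    intervalIntegral.integral_nonneg h78.1 fun r hr =>
      mul_nonneg (mul_nonneg hr.1 (hS0 _)) (hv.nonneg r ⟨hr.1, by linarith [hr.2]⟩)
  have htail : ∫ r in (7 / 8 : ℝ)..1, (1 + ∫ t in (0 : ℝ)..α * r, ψ t ^ p) * v r ≤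
      2 * K * ∫ r in (7 / 8 : ℝ)..1,
        (id r * circleAverage (fun z => ‖powerSum c z‖ ^ p) 0 (α * r)) * v r := by
    rw [← intervalIntegral.integral_const_mul]
    simp only [← mul_assoc]
    refine hv.integral_mul_mono h78 (hcI.mono hsub)
      ((continuousOn_const.mul continuousOn_id).mul (hcS.mono hsub)) fun r hr => ?_
    -- (7/8)² = 49/64 exceeds 3/4.
    have h2 : 3 / 4 ≤ α * r := by nlinarith [hα.1, hr.1]
    have h3 := hK (α * r) h2
      (IsDoubling.mapsTo_mul_left hα' ⟨h78.1.trans hr.1, hr.2.le⟩).2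
    refine h3.trans ?_
    refine mul_le_mul_of_nonneg_right ?_ (hS0 _)
    simp only [id]
    nlinarith [hr.1]
  have hhead : ∫ r in (0 : ℝ)..7 / 8, (1 + ∫ t in (0 : ℝ)..α * r, ψ t ^ p) * v r ≤
      (1 + I) * hat v 0 := by
    have h2 : ∫ r in (0 : ℝ)..7 / 8, (1 + ∫ t in (0 : ℝ)..α * r, ψ t ^ p) * v r ≤
        ∫ r in (0 : ℝ)..7 / 8, (1 + I) * v r := by
      refine intervalIntegral.integral_mono_on h78.1 (hint hcI h0 h78)
        ((hv.intervalIntegrable_of_mem h0 h78).const_mul _) fun r hr => ?_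
      have h3 := hv.nonneg r ⟨hr.1, by linarith [hr.2]⟩
      have h4 := hφ.integral_mono_right (mul_nonneg hα'.1 hr.1)
        ((mul_le_of_le_one_left hr.1 hα.2.le).trans hr.2) (by norm_num)
      gcongr
    refine h2.trans ?_
    rw [intervalIntegral.integral_const_mul]
    gcongr
    have h5 := intervalIntegral.integral_add_adjacent_intervals
      (hv.intervalIntegrable_of_mem h0 h78) (hv.intervalIntegrable_of_mem h78 h1)
    have h6 := hv.hat_nonneg h78
    simp only [hat] at h6 ⊢
    linarith
  have hmass : hat v (7 / 8) ≤
      ∫ r in (7 / 8 : ℝ)..1, (1 + ∫ t in (0 : ℝ)..α * r, ψ t ^ p) * v r := by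
    have h2 := hv.integral_mul_mono (f := fun _ => 1) h78 continuousOn_const (hcI.mono hsub)
      fun r hr => le_add_of_nonneg_right (hIpos r ⟨h78.1.trans hr.1, hr.2.le⟩)
    simpa [hat] using h2
  have hD' := hD (7 / 8) ⟨h78.1, le_rfl⟩
  simp only [Pi.add_apply, Pi.mul_apply, id] at hsplit hsplit' hpos' htail
  rw [← hsplit, ← hsplit']
  set T := ∫ r in (7 / 8 : ℝ)..1, (1 + ∫ t in (0 : ℝ)..α * r, ψ t ^ p) * v r
  set Y := ∫ r in (7 / 8 : ℝ)..1,
    r * circleAverage (fun z => ‖powerSum c z‖ ^ p) 0 (α * r) * v r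
  set X := ∫ r in (0 : ℝ)..7 / 8,
    r * circleAverage (fun z => ‖powerSum c z‖ ^ p) 0 (α * r) * v r
  calc _ ≤ (1 + I) * (D * T) + T := by
        refine add_le_add_left (hhead.trans ?_) _
        gcongr
        exact hD'.trans (by gcongr)
    _ = ((1 + I) * D + 1) * T := by ring
    _ ≤ ((1 + I) * D + 1) * (2 * K * (X + Y)) := by
        gcongr
        exact htail.trans (by gcongr; linarith)
    _ = _ := by ring

end IsKernelCoeff

namespace IsDHat

variable {ω : ℝ → ℝ}

theorem circleAverage_iteratedDeriv (h : IsDHat ω) (h0 : 0 < hat ω 0) {a : ℂ} (ha : a ∈ disc)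
    {K : ℂ → ℂ} (hK : EqOn K (kernelFun ω a) disc) (N : ℕ) (p : ℝ) {r : ℝ}
    (hr : r ∈ Ico (0 : ℝ) 1) :
    circleAverage (fun z => ‖iteratedDeriv N K z‖ ^ p) 0 r =
      (‖a‖ ^ N) ^ p * circleAverage
        (fun z => ‖powerSum (derivCoeff^[N] (kernelCoeff ω)) z‖ ^ p) 0 (‖a‖ * r) := by
  rw [← RCLike.norm_conj a, ← circleAverage_comp_mul_left, ← smul_eq_mul,
    ← Real.circleAverage_fun_smul]
  refine Real.circleAverage_congr_sphere fun z hz => ?_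
  rw [mem_sphere_zero_iff_norm, abs_of_nonneg hr.1] at hz
  have hz' : z ∈ disc := mem_ball_zero_iff.2 (hz ▸ hr.2)
  simp only [h.iteratedDeriv_eq h0 ha hK N hz', smul_eq_mul]
  rw [norm_mul, Real.mul_rpow (norm_nonneg _) (norm_nonneg _), norm_pow]

theorem bergmanNormPow_iteratedDeriv (h : IsDHat ω) (h0 : 0 < hat ω 0) {a : ℂ} (ha : a ∈ disc)
    {K : ℂ → ℂ} (hK : EqOn K (kernelFun ω a) disc) (N : ℕ) {p : ℝ} (hp : 0 < p) {v : ℝ → ℝ}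
    (hv : IsDHat v) :
    bergmanNormPow p v (iteratedDeriv N K) =
      2 * (‖a‖ ^ N) ^ p * ∫ r in (0 : ℝ)..1, r * circleAverage
        (fun z => ‖powerSum (derivCoeff^[N] (kernelCoeff ω)) z‖ ^ p) 0 (‖a‖ * r) * v r := by
  have hm := integrableOn_areaMeasure.1 (h.memBergman_of_eqOn h0 ha hK N hp hv).2
  rw [bergmanNormPow, setIntegral_disc_mul_real hm, mul_assoc,
    ← intervalIntegral.integral_const_mul ((‖a‖ ^ N) ^ p),
    intervalIntegral.integral_of_le zero_le_one,
    intervalIntegral.integral_of_le zero_le_one, integral_Ioc_eq_integral_Ioo,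
    integral_Ioc_eq_integral_Ioo]
  refine congrArg _ (setIntegral_congr_fun measurableSet_Ioo fun r hr => ?_)
  simp only [h.circleAverage_iteratedDeriv h0 ha hK N p (Ioo_subset_Ico_self hr)]
  ring

theorem integral_kernelScale_rpow (h : IsDHat ω) (h0 : 0 < hat ω 0) (N : ℕ) (p : ℝ) (v : ℝ → ℝ)
    {u : ℝ} (hu : u ∈ Ico (0 : ℝ) 1) :
    ∫ t in (0 : ℝ)..u, v t / (hat ω t ^ p * (1 - t) ^ (p * ((N : ℝ) - 1))) =
      ∫ t in (0 : ℝ)..u, kernelScale ω N t ^ p * v t := by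
  refine intervalIntegral.integral_congr fun t ht => ?_
  rw [uIcc_of_le hu.1] at ht
  simp only [h.kernelScale_rpow h0 N p ⟨ht.1, ht.2.trans_lt hu.2⟩, one_div_mul_eq_div]

end IsDHat

theorem eventually_toBoundary {x : ℝ} (hx : x < 1) : ∀ᶠ a in toBoundary, ‖a‖ ∈ Ioo x 1 :=
  Eventually.comap (p := fun r => r ∈ Ioo x 1) (Ioo_mem_nhdsLT hx) _

theorem isTheta_of_eventually {β : Type*} {l : Filter β} {f g : β → ℝ} (C C' : ℝ)
    (h : ∀ᶠ x in l, 0 ≤ f x ∧ 0 ≤ g x ∧ f x ≤ C * g x ∧ g x ≤ C' * f x) : f =Θ[l] g := by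
  refine ⟨IsBigO.of_bound C (h.mono fun x hx => ?_), IsBigO.of_bound C' (h.mono fun x hx => ?_)⟩ <;>
  · rw [Real.norm_of_nonneg hx.1, Real.norm_of_nonneg hx.2.1]
    tauto

theorem isTheta_integralMean (p : ℝ) (hp : 0 < p) (ω : ℝ → ℝ) (hω : IsDHat ω)
    (hω0 : 0 < hat ω 0) (N : ℕ) :
    (fun x : ℝ × ℂ => integralMean p x.1 (iteratedDeriv N (dirichletKernel ω x.2)))
      =Θ[(𝓝[<] (1 : ℝ)) ×ˢ toBoundary]
      (fun x : ℝ × ℂ => ∫ t in (0 : ℝ)..(‖x.2‖ * x.1),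
        1 / (hat ω t ^ p * (1 - t) ^ (p * ((N : ℝ) - 1)))) := by
  obtain ⟨C, hC⟩ := hω.isDoubling_kernelScale hω0 N
  have hc := hω.isKernelCoeff_iterate hω0 N
  obtain ⟨K₁, hK₁, h₁⟩ := hc.circleAverage_le hC hp
  obtain ⟨K₂, hK₂, h₂⟩ := hc.le_circleAverage hC hp
  obtain ⟨K₃, hK₃, h₃⟩ := (hC.rpow hp).one_add_integral_le
  have hev : ∀ᶠ x : ℝ × ℂ in (𝓝[<] (1 : ℝ)) ×ˢ toBoundary,
      x.1 ∈ Ioo (7 / 8 : ℝ) 1 ∧ ‖x.2‖ ∈ Ioo (7 / 8 : ℝ) 1 :=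
    (eventually_mem_set.2 (Ioo_mem_nhdsLT (by norm_num))).prod_mk
      (eventually_toBoundary (by norm_num))
  have key : ∀ x : ℝ × ℂ, x.1 ∈ Ioo (7 / 8 : ℝ) 1 → ‖x.2‖ ∈ Ioo (7 / 8 : ℝ) 1 →
      3 / 4 ≤ ‖x.2‖ * x.1 ∧ ‖x.2‖ * x.1 < 1 := fun x hr ha =>
    ⟨by nlinarith [hr.1, ha.1], by nlinarith [hr.1, hr.2, ha.1, ha.2]⟩
  -- The factor |a|^(Np) from differentiating F(conj a · z) lies between (7/8)^(Np) and 1; `K₃`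
  -- removes the summand 1 from 1 + ∫ψ^p.
  refine isTheta_of_eventually (K₁ * K₃) (K₂ / ((7 / 8) ^ N) ^ p) (hev.mono fun x hx => ?_)
  obtain ⟨hr, ha⟩ := hx
  have had : x.2 ∈ disc := mem_ball_zero_iff.2 ha.2
  obtain ⟨hu, hu1⟩ := key x hr ha
  have hu' : ‖x.2‖ * x.1 ∈ Ico (0 : ℝ) 1 := ⟨by linarith, hu1⟩
  have hI0 := (hC.rpow hp).integral_nonneg le_rfl hu'.1 hu1
  have hS0 : 0 ≤ circleAverage
      (fun z => ‖powerSum (derivCoeff^[N] (kernelCoeff ω)) z‖ ^ p) 0 (‖x.2‖ * x.1) :=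
    circleAverage_nonneg (fun z => by positivity) _
  have e1 := hω.circleAverage_iteratedDeriv hω0 had (hω.eqOn_dirichletKernel hω0 had) N p
    ⟨by linarith [hr.1], hr.2⟩
  have e2 := hω.integral_kernelScale_rpow hω0 N p (fun _ => 1) hu'
  simp only [mul_one] at e2
  rw [integralMean, e1, e2]
  have b1 := h₁ _ hu'
  have b2 := h₂ _ hu hu1
  have b3 := h₃ _ ⟨by linarith, hu1⟩
  have hx1 : (‖x.2‖ ^ N) ^ p ≤ 1 :=
    Real.rpow_le_one (by positivity) (pow_le_one₀ (norm_nonneg _) ha.2.le) hp.le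
  have hx2 : ((7 / 8 : ℝ) ^ N) ^ p ≤ (‖x.2‖ ^ N) ^ p := by
    have := ha.1
    gcongr
  refine ⟨by positivity, hI0, ?_, ?_⟩
  · calc _ ≤ circleAverage
          (fun z => ‖powerSum (derivCoeff^[N] (kernelCoeff ω)) z‖ ^ p) 0 (‖x.2‖ * x.1) :=
        mul_le_of_le_one_left hS0 hx1
      _ ≤ K₁ * (K₃ * ∫ t in (0 : ℝ)..‖x.2‖ * x.1, kernelScale ω N t ^ p) :=
        b1.trans (by gcongr)
      _ = _ := by ring
  · rw [div_mul_eq_mul_div, le_div_iff₀ (by positivity)]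
    calc _ ≤ (K₂ * circleAverage
          (fun z => ‖powerSum (derivCoeff^[N] (kernelCoeff ω)) z‖ ^ p) 0 (‖x.2‖ * x.1)) *
            (‖x.2‖ ^ N) ^ p := by
          gcongr
          linarith
      _ = _ := by ring

theorem isTheta_bergmanNormPow (p : ℝ) (hp : 0 < p) (ω : ℝ → ℝ) (hω : IsDHat ω)
    (hω0 : 0 < hat ω 0) (N : ℕ) (v : ℝ → ℝ) (hv : IsDHat v) :
    (fun a : ℂ => bergmanNormPow p v (iteratedDeriv N (dirichletKernel ω a)))
      =Θ[toBoundary]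
      (fun a : ℂ => ∫ t in (0 : ℝ)..‖a‖,
        hat v t / (hat ω t ^ p * (1 - t) ^ (p * ((N : ℝ) - 1)))) := by
  obtain ⟨C, hC⟩ := hω.isDoubling_kernelScale hω0 N
  have hc := hω.isKernelCoeff_iterate hω0 N
  obtain ⟨K₁, hK₁, h₁⟩ := hc.integral_circleAverage_le hC hp hv
  obtain ⟨K₂, hK₂, h₂⟩ := hc.le_integral_circleAverage hC hp hv
  obtain ⟨K₃, hK₃, h₃⟩ := hv.integral_one_add_primitive_mul_le (hC.rpow hp)
  obtain ⟨K₄, hK₄, h₄⟩ := hv.integral_mul_hat_le (hC.rpow hp)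
  have hev := eventually_toBoundary (by norm_num : (7 / 8 : ℝ) < 1)
  refine isTheta_of_eventually (2 * (K₁ * K₃)) (K₄ * K₂ / (2 * ((7 / 8) ^ N) ^ p))
    (hev.mono fun a ha => ?_)
  have had : a ∈ disc := mem_ball_zero_iff.2 ha.2
  have ha' : ‖a‖ ∈ Ico (0 : ℝ) 1 := ⟨norm_nonneg a, ha.2⟩
  have hJ0 := hv.integral_mul_hat_nonneg (hC.rpow hp) le_rfl ha'.1 ha'.2
  have hS0 : 0 ≤ ∫ r in (0 : ℝ)..1, r * circleAverage
      (fun z => ‖powerSum (derivCoeff^[N] (kernelCoeff ω)) z‖ ^ p) 0 (‖a‖ * r) * v r :=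
    hv.integral_mul_nonneg ⟨le_rfl, zero_le_one⟩ fun r hr =>
      mul_nonneg hr.1 (circleAverage_nonneg (fun z => by positivity) _)
  rw [hω.bergmanNormPow_iteratedDeriv hω0 had (hω.eqOn_dirichletKernel hω0 had) N hp hv,
    hω.integral_kernelScale_rpow hω0 N p _ ha']
  have b1 := h₁ _ ha'
  have b2 := h₂ _ ⟨ha.1.le, ha.2⟩
  have b3 := h₃ _ ⟨by linarith [ha.1], ha.2⟩
  have b4 := h₄ _ ⟨by linarith [ha.1], ha.2⟩
  have hx1 : (‖a‖ ^ N) ^ p ≤ 1 :=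
    Real.rpow_le_one (by positivity) (pow_le_one₀ (norm_nonneg _) ha.2.le) hp.le
  have hx2 : ((7 / 8 : ℝ) ^ N) ^ p ≤ (‖a‖ ^ N) ^ p := by
    have := ha.1
    gcongr
  set S := ∫ r in (0 : ℝ)..1, r * circleAverage
      (fun z => ‖powerSum (derivCoeff^[N] (kernelCoeff ω)) z‖ ^ p) 0 (‖a‖ * r) * v r
  set J := ∫ t in (0 : ℝ)..‖a‖, kernelScale ω N t ^ p * hat v t
  refine ⟨by positivity, hJ0, ?_, ?_⟩
  · calc _ ≤ 2 * 1 * (K₁ * (K₃ * J)) := by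
          gcongr
          exact b1.trans (by gcongr)
      _ = _ := by ring
  · rw [div_mul_eq_mul_div, le_div_iff₀ (by positivity)]
    calc _ ≤ (K₄ * (K₂ * S)) * (2 * (‖a‖ ^ N) ^ p) := by
          gcongr
          exact b4.trans (by gcongr)
      _ = _ := by ring

end RadialDirichlet

theorem mainTheorem5 (p : ℝ) (hp : 0 < p) (ω : ℝ → ℝ) (hω : RadialDirichlet.IsDHat ω)
    (hω0 : 0 < RadialDirichlet.hat ω 0) (N : ℕ) :
    (∀ a ∈ RadialDirichlet.disc,
      RadialDirichlet.IsReproducingKernel ω a (RadialDirichlet.dirichletKernel ω a)) ∧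
    ((fun x : ℝ × ℂ =>
        RadialDirichlet.integralMean p x.1
          (iteratedDeriv N (RadialDirichlet.dirichletKernel ω x.2)))
      =Θ[(𝓝[<] (1 : ℝ)) ×ˢ RadialDirichlet.toBoundary]
      (fun x : ℝ × ℂ =>
        ∫ t in (0 : ℝ)..(‖x.2‖ * x.1),
          1 / (RadialDirichlet.hat ω t ^ p * (1 - t) ^ (p * ((N : ℝ) - 1))))) ∧
    (∀ v : ℝ → ℝ, RadialDirichlet.IsDHat v →
      (∀ a ∈ RadialDirichlet.disc,
        RadialDirichlet.MemBergman p v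
          (iteratedDeriv N (RadialDirichlet.dirichletKernel ω a))) ∧
      ((fun a : ℂ =>
          RadialDirichlet.bergmanNormPow p v
            (iteratedDeriv N (RadialDirichlet.dirichletKernel ω a)))
        =Θ[RadialDirichlet.toBoundary]
        (fun a : ℂ =>
          ∫ t in (0 : ℝ)..‖a‖,
            RadialDirichlet.hat v t /
              (RadialDirichlet.hat ω t ^ p * (1 - t) ^ (p * ((N : ℝ) - 1)))))) := by
  refine ⟨fun a ha => hω.isReproducingKernel_dirichletKernel hω0 ha,
    RadialDirichlet.isTheta_integralMean p hp ω hω hω0 N, fun v hv =>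
      ⟨fun a ha => hω.memBergman_of_eqOn hω0 ha (hω.eqOn_dirichletKernel hω0 ha) N hp hv,
        RadialDirichlet.isTheta_bergmanNormPow p hp ω hω hω0 N v hv⟩⟩
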